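/- **Setting.** Let $d\ge 0$, $n\ge 3$ be integers, $\gamma,c>0$, and let $\mathbb T^d=(\mathbb R/2\pi\mathbb Z)^d$ carry Lebesgue measure. Let $\sigma_1:\mathbb T^d\to[0,\infty)$ be $C^\infty$, radially symmetric (a function of the distance to the origin of $\mathbb T^d$), with $\int_{\mathbb T^d}\sigma_1\,dx\ne 0$. Let $\sigma_2:\mathbb R^n\to[0,\infty)$ be $C^\infty$, radially symmetric and compactly supported, with $\widehat\sigma_2(\xi)=\int_{\mathbb R^n}\sigma_2(z)e^{-i\xi\cdot z}\,dz\neq 0$ for all $\xi\in\mathbb R^n$ and $(-\Delta)^{-1/2}\sigma_2\in L^2(\mathbb R^n)$. Put $$\kappa=\int_{\mathbb R^n}\frac{|\widehat\sigma_2(\xi)|^2}{|\xi|^2}\,\frac{d\xi}{(2\pi)^n}.$$ The Schrödinger–Wave system linearized around the plane wave with wave vector $k=0$ is, for $u(t,x)\in\mathbb C$ and $\psi(t,x,z)\in\mathbb R$, $$i\partial_t u+\tfrac12\Delta_x u=\gamma\Phi,\qquad \tfrac1{c^2}\partial_{tt}^2\psi-\Delta_z\psi=-\gamma\,\sigma_2(z)\,\big(\sigma_1\star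 2\,\mathrm{Re}\,u\big)(t,x),$$ $$\Phi(t,x)=\iint_{\mathbb T^d\times\mathbb R^n}\sigma_1(x-y)\sigma_2(z)\psi(t,y,z)\,dz\,dy,\qquad \pi:=-\tfrac1{2c^2}\partial_t\psi .$$ Solutions are understood in the weak sense (tested against smooth functions of $x$, resp. smooth compactly supported functions of $(x,z)$), with $(u,\psi,\pi)$ continuous in $t\ge0$ with values in $H^1(\mathbb T^d)\times L^2(\mathbb T^d;\dot H^1(\mathbb R^n))\times L^2(\mathbb T^d\times\mathbb R^n)$. **Theorem (linearized stability for the Schrödinger–Wave system, $k=0$).** Assume the smallness condition $4\gamma^2\kappa\,\|\sigma_1\|_{L^1}^2<1$. Let $u^{\mathrm{Init}}\in H^1(\mathbb T^d)$, $\psi^{\mathrm{Init}}\in L^2(\mathbb T^d;\dot H^1(\mathbb R^n))$, $\pi^{\mathrm{Init}}\in L^2(\mathbb T^d\times\mathbb R^n)$ be such that $\int_{\mathbb T^d}u^{\mathrm{Init}}\,dx=0$. If $n\in\{3,4\}$, assume in addition that the wave data have zero mean in $x$ as well: $\int_{\mathbb T^d}\psi^{\mathrm{Init}}(x,\cdot)\,dx=0$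 and $\int_{\mathbb T^d}\pi^{\mathrm{Init}}(x,\cdot)\,dx=0$. Then there is a constant $C>0$, depending only on the parameters and on the initial data, such that every solution $(u,\psi,\pi)$ with these initial data satisfies $$\sup_{t\ge 0}\|u(t,\cdot)\|_{H^1(\mathbb T^d)}\le C .$$ -/

import Mathlib

open MeasureTheory Set
open scoped ContDiff ENNReal

noncomputable section

namespace SchrodingerWave

/-! ### The torus `𝕋^d = (ℝ / 2πℤ)^d` with Lebesgue measure (total mass `(2π)^d`) -/

instance fact_two_pi_pos : Fact (0 < 2 * Real.pi) := ⟨Real.two_pi_pos⟩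

/-- The torus `𝕋^d`. -/
abbrev Torus (d : ℕ) : Type := Fin d → AddCircle (2 * Real.pi)

/-- The space `ℝ^n` of the transverse variable `z`. -/
abbrev Rn (n : ℕ) : Type := EuclideanSpace ℝ (Fin n)

/-- The covering map `ℝ^d → 𝕋^d`. -/
def torusProj {d : ℕ} (x : Fin d → ℝ) : Torus d := fun i => (x i : AddCircle (2 * Real.pi))

/-- `f` is `C^∞` on the torus, i.e. its periodic lift to `ℝ^d` is `C^∞`. -/
def TorusSmooth {d : ℕ} {F : Type*} [NormedAddCommGroup F] [NormedSpace ℝ F]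
    (f : Torus d → F) : Prop :=
  ContDiff ℝ ∞ (fun x : Fin d → ℝ => f (torusProj x))

/-- The partial derivative `∂_j f` on the torus. -/
def torusPartial {d : ℕ} (j : Fin d) (f : Torus d → ℂ) (x : Torus d) : ℂ :=
  deriv (fun s : ℝ => f (x + Pi.single j (s : AddCircle (2 * Real.pi)))) 0

/-- The Laplacian `Δ_x f = ∑_j ∂_j ∂_j f` on the torus. -/
def torusLaplacian {d : ℕ} (f : Torus d → ℂ) (x : Torus d) : ℂ :=
  ∑ j, torusPartial j (torusPartial j f) x

/-- Convolution on the torus of a real kernel `σ` with `f`. -/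
def torusConv {d : ℕ} (σ f : Torus d → ℝ) (x : Torus d) : ℝ :=
  ∫ y, σ (x - y) * f y

/-! ### Helper facts: smooth functions and their partial derivatives are continuous -/

theorem isOpenQuotientMap_torusProj (d : ℕ) :
    IsOpenQuotientMap (torusProj : (Fin d → ℝ) → Torus d) :=
  IsOpenQuotientMap.piMap (f := fun (_ : Fin d) (s : ℝ) => (s : AddCircle (2 * Real.pi)))
    (fun _ => QuotientAddGroup.isOpenQuotientMap_mk)

theorem TorusSmooth.continuous {d : ℕ} {F : Type*} [NormedAddCommGroup F] [NormedSpace ℝ F]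
    {f : Torus d → F} (hf : TorusSmooth f) : Continuous f :=
  (isOpenQuotientMap_torusProj d).isQuotientMap.continuous_iff.2 (ContDiff.continuous hf)

theorem torusPartial_torusProj {d : ℕ} {f : Torus d → ℂ} (hf : TorusSmooth f) (j : Fin d)
    (x : Fin d → ℝ) :
    torusPartial j f (torusProj x)
      = fderiv ℝ (fun y : Fin d → ℝ => f (torusProj y)) x (Pi.single j 1) := by
  have hd : DifferentiableAt ℝ (fun y : Fin d → ℝ => f (torusProj y)) x :=
    (ContDiff.differentiable hf (by simp)).differentiableAt
  have hl : HasDerivAt (fun s : ℝ => x + s • (Pi.single j 1 : Fin d → ℝ)) (Pi.single j 1) 0 := by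
    simpa using ((hasDerivAt_id (0 : ℝ)).smul_const (Pi.single j 1 : Fin d → ℝ)).const_add x
  have hx : x = x + (0 : ℝ) • (Pi.single j 1 : Fin d → ℝ) := by simp
  have hc := (hx ▸ hd.hasFDerivAt :
    HasFDerivAt (fun y : Fin d → ℝ => f (torusProj y))
      (fderiv ℝ (fun y : Fin d → ℝ => f (torusProj y)) x)
      (x + (0 : ℝ) • (Pi.single j 1 : Fin d → ℝ))).comp_hasDerivAt (0 : ℝ) hl
  unfold torusPartial
  rw [← hc.deriv]
  congr 1
  funext s
  simp only [Function.comp]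
  congr 1
  funext i
  by_cases h : i = j
  · subst h; simp [torusProj]
  · simp [torusProj, h]

theorem TorusSmooth.torusPartial {d : ℕ} {f : Torus d → ℂ} (hf : TorusSmooth f) (j : Fin d) :
    TorusSmooth (SchrodingerWave.torusPartial j f) := by
  unfold TorusSmooth
  simp_rw [torusPartial_torusProj hf j]
  exact (ContDiff.fderiv_right hf (m := ∞) (by simp)).clm_apply contDiff_const

/-! ### The Sobolev space `H¹(𝕋^d)` -/

/-- `L²(𝕋^d; ℂ)`. -/
abbrev L2Torus (d : ℕ) : Type := Lp ℂ 2 (volume : Measure (Torus d))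

theorem integrable_L2Torus_mul {d : ℕ} (f : L2Torus d) {φ : Torus d → ℂ} (hφ : Continuous φ) :
    Integrable (fun x => f x * φ x) (volume : Measure (Torus d)) := by
  have h1 : Integrable (fun x => f x) (volume : Measure (Torus d)) :=
    (Lp.memLp f).integrable (by norm_num)
  obtain ⟨C, hC⟩ := isCompact_univ.exists_bound_of_continuousOn (hφ.continuousOn (s := univ))
  exact h1.mul_bdd (c := C) hφ.aestronglyMeasurable
    (Filter.Eventually.of_forall fun x => hC x (mem_univ x))

/-- The space `H¹(𝕋^d; ℂ)`: the pairs `(f, ∇f)` with `f ∈ L²` and weak gradient `∇f ∈ L²`.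
Its norm is `(‖f‖²_{L²} + ∑_j ‖∂_j f‖²_{L²})^{1/2}`. -/
def H1Torus (d : ℕ) :
    Submodule ℂ (WithLp 2 (L2Torus d × PiLp 2 (fun _ : Fin d => L2Torus d))) where
  carrier := {p | ∀ (j : Fin d) (φ : Torus d → ℂ), TorusSmooth φ →
    ∫ x, p.fst x * torusPartial j φ x = - ∫ x, p.snd j x * φ x}
  zero_mem' := by
    intro j φ _
    have h0 : ∀ ψ : Torus d → ℂ, ∫ x, (0 : L2Torus d) x * ψ x = 0 := by
      intro ψ
      refine integral_eq_zero_of_ae ?_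
      filter_upwards [Lp.coeFn_zero ℂ 2 (volume : Measure (Torus d))] with x hx
      rw [hx]; simp
    exact (h0 (torusPartial j φ)).trans (by rw [← neg_zero]; exact congrArg _ (h0 φ).symm)
  add_mem' := by
    intro p q hp hq j φ hφ
    have ha : ∀ (a b : L2Torus d) (ψ : Torus d → ℂ), Continuous ψ →
        ∫ x, (a + b : L2Torus d) x * ψ x = (∫ x, a x * ψ x) + ∫ x, b x * ψ x := by
      intro a b ψ hψ
      rw [← integral_add (integrable_L2Torus_mul a hψ) (integrable_L2Torus_mul b hψ)]
      refine integral_congr_ae ?_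
      filter_upwards [Lp.coeFn_add a b] with x hx
      rw [hx, Pi.add_apply, add_mul]
    have h1 := ha p.fst q.fst _ (hφ.torusPartial j).continuous
    have h2 := ha (p.snd j) (q.snd j) _ hφ.continuous
    have h3 := hp j φ hφ
    have h4 := hq j φ hφ
    simp only [WithLp.add_fst, WithLp.add_snd, PiLp.add_apply]
    rw [h1, h2, h3, h4]
    ring
  smul_mem' := by
    intro a p hp j φ hφ
    have hs : ∀ (b : L2Torus d) (ψ : Torus d → ℂ),
        ∫ x, (a • b : L2Torus d) x * ψ x = a * ∫ x, b x * ψ x := by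
      intro b ψ
      rw [← integral_const_mul]
      refine integral_congr_ae ?_
      filter_upwards [Lp.coeFn_smul a b] with x hx
      simp [hx, mul_assoc]
    have h3 := hp j φ hφ
    simp only [WithLp.smul_fst, WithLp.smul_snd, PiLp.smul_apply]
    rw [hs, hs, h3]
    ring

/-- The function `f` underlying an element `(f, ∇f)` of `H¹(𝕋^d)`. -/
def H1Torus.toFun {d : ℕ} (u : H1Torus d) : Torus d → ℂ := u.1.fst

/-! ### The homogeneous Sobolev space `Ḣ¹(ℝ^n)` and the space `L²(𝕋^d; Ḣ¹(ℝ^n))` -/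

/-- The critical Sobolev exponent `2n/(n-2)`, written as `2 + 4/(n-2)`. -/
def sobolevExponent (n : ℕ) : ℝ≥0∞ := 2 + 4 / ((n : ℝ≥0∞) - 2)

theorem sobolevExponent_eq {n : ℕ} (hn : 3 ≤ n) :
    sobolevExponent n = ENNReal.ofReal (2 * n / (n - 2)) := by
  have h3 : (3 : ℝ) ≤ n := by exact_mod_cast hn
  have h : ((n : ℝ≥0∞) - 2) = ENNReal.ofReal ((n : ℝ) - 2) := by
    rw [ENNReal.ofReal_sub _ (by norm_num)]; simp
  have h4 : (4 : ℝ≥0∞) = ENNReal.ofReal 4 := by simp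
  have h2 : (2 : ℝ≥0∞) = ENNReal.ofReal 2 := by simp
  unfold sobolevExponent
  rw [h, h4, ← ENNReal.ofReal_div_of_pos (by linarith), h2,
    ← ENNReal.ofReal_add (by norm_num) (div_nonneg (by norm_num) (by linarith))]
  congr 1
  have : (n : ℝ) - 2 ≠ 0 := by linarith
  field_simp
  ring

instance fact_one_le_sobolevExponent (n : ℕ) : Fact (1 ≤ sobolevExponent n) :=
  ⟨le_trans (by norm_num) (le_self_add : (2 : ℝ≥0∞) ≤ 2 + 4 / ((n : ℝ≥0∞) - 2))⟩

/-- For `n ≥ 3`, the real space `Ḣ¹(ℝ^n)`: the completion of `C_c^∞(ℝ^n)` with respect to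
`‖∇φ‖_{L²}`, realized as the set of pairs `(f, ∇f)` in the closure of
`{(φ, ∇φ) : φ ∈ C_c^∞(ℝ^n)}` in `L^{2n/(n-2)}(ℝ^n) × L²(ℝ^n; ℝ^n)`.
By the Sobolev inequality the norm of this product is, on the closure,
equivalent to `‖∇f‖_{L²}`. -/
def HDot (n : ℕ) : Submodule ℝ
    (Lp ℝ (sobolevExponent n) (volume : Measure (Rn n)) ×
      Lp (Rn n) 2 (volume : Measure (Rn n))) :=
  (Submodule.span ℝ {p | ∃ φ : Rn n → ℝ, ContDiff ℝ ∞ φ ∧ HasCompactSupport φ ∧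
    p.1 =ᵐ[volume] φ ∧ p.2 =ᵐ[volume] gradient φ}).topologicalClosure

/-- The function `f` underlying an element `(f, ∇f)` of `Ḣ¹(ℝ^n)`. -/
def HDot.toFun {n : ℕ} (f : HDot n) : Rn n → ℝ := f.1.1

/-- The gradient `∇f` of an element `(f, ∇f)` of `Ḣ¹(ℝ^n)`. -/
def HDot.grad {n : ℕ} (f : HDot n) : Rn n → Rn n := f.1.2

/-- `L²(𝕋^d; Ḣ¹(ℝ^n))`. -/
abbrev L2HDot (d n : ℕ) : Type := Lp (HDot n) 2 (volume : Measure (Torus d))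

/-- `L²(𝕋^d × ℝ^n)`, real-valued. -/
abbrev L2Prod (d n : ℕ) : Type := Lp ℝ 2 (volume : Measure (Torus d × Rn n))

/-! ### The form functions, the constant `κ` -/

/-- The Fourier transform `σ̂(ξ) = ∫ σ(z) e^{-iξ·z} dz`. -/
def fourierHat {n : ℕ} (σ : Rn n → ℝ) (ξ : Rn n) : ℂ :=
  ∫ z, Complex.exp (-(Complex.I * ((inner ℝ ξ z : ℝ) : ℂ))) * (σ z : ℂ)

/-- `κ = ∫ |σ̂₂(ξ)|² / |ξ|² dξ / (2π)^n`. -/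
def kappa {n : ℕ} (σ₂ : Rn n → ℝ) : ℝ :=
  (∫ ξ, ‖fourierHat σ₂ ξ‖ ^ 2 / ‖ξ‖ ^ 2) / (2 * Real.pi) ^ n

/-- The assumptions on `σ₁ : 𝕋^d → [0, ∞)`. Here `‖x i‖` is the distance of `x i` to `0` in
`ℝ / 2πℤ`, so that `∑ i, ‖x i‖ ^ 2` is the squared distance of `x` to the origin of `𝕋^d`. -/
structure IsFormFunction₁ {d : ℕ} (σ₁ : Torus d → ℝ) : Prop where
  nonneg : ∀ x, 0 ≤ σ₁ x
  smooth : TorusSmooth σ₁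
  radial : ∀ x y : Torus d, ∑ i, ‖x i‖ ^ 2 = ∑ i, ‖y i‖ ^ 2 → σ₁ x = σ₁ y
  integral_ne_zero : ∫ x, σ₁ x ≠ 0

/-- The assumptions on `σ₂ : ℝ^n → [0, ∞)`. The field `integrable` says that
`(-Δ)^{-1/2} σ₂ ∈ L²(ℝ^n)`. -/
structure IsFormFunction₂ {n : ℕ} (σ₂ : Rn n → ℝ) : Prop where
  nonneg : ∀ z, 0 ≤ σ₂ z
  smooth : ContDiff ℝ ∞ σ₂
  compactSupport : HasCompactSupport σ₂
  radial : ∀ z w : Rn n, ‖z‖ = ‖w‖ → σ₂ z = σ₂ w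
  integrable : Integrable (fun ξ => ‖fourierHat σ₂ ξ‖ ^ 2 / ‖ξ‖ ^ 2)
  hat_ne_zero : ∀ ξ, fourierHat σ₂ ξ ≠ 0

/-! ### The linearized Schrödinger–Wave system (`k = 0`) -/

/-- The potential `Φ(x) = ∬ σ₁(x - y) σ₂(z) ψ(y, z) dz dy`. -/
def potential {d n : ℕ} (σ₁ : Torus d → ℝ) (σ₂ : Rn n → ℝ) (ψ : L2HDot d n) : Torus d → ℝ :=
  torusConv σ₁ (fun y => ∫ z, σ₂ z * HDot.toFun (ψ y) z)

/-- Real test functions `φ ∈ C_c^∞(𝕋^d × ℝ^n)`. -/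
structure IsTestFunction {d n : ℕ} (φ : Torus d × Rn n → ℝ) : Prop where
  smooth : ContDiff ℝ ∞ (fun p : (Fin d → ℝ) × Rn n => φ (torusProj p.1, p.2))
  compactSupport : HasCompactSupport φ

/-- `(u, ψ, ϖ)`, with `ϖ = -∂_t ψ / (2c²)`, is a (weak) solution for `t ≥ 0`, continuous in time
with values in the energy space `H¹(𝕋^d) × L²(𝕋^d; Ḣ¹(ℝ^n)) × L²(𝕋^d × ℝ^n)`, of
`i ∂_t u + ½ Δ_x u = γ Φ`, `c⁻² ∂_t² ψ - Δ_z ψ = -γ σ₂ (σ₁ ⋆ 2 Re u)`, that is of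
`i ∂_t u = -½ Δ_x u + γ Φ`, `∂_t ψ = -2c² ϖ`, `∂_t ϖ = -½ Δ_z ψ + γ σ₂ (σ₁ ⋆ Re u)`. -/
structure IsSolution {d n : ℕ} (γ c : ℝ) (σ₁ : Torus d → ℝ) (σ₂ : Rn n → ℝ)
    (u : ℝ → H1Torus d) (ψ : ℝ → L2HDot d n) (ϖ : ℝ → L2Prod d n) : Prop where
  continuousOn_u : ContinuousOn u (Ici 0)
  continuousOn_ψ : ContinuousOn ψ (Ici 0)
  continuousOn_ϖ : ContinuousOn ϖ (Ici 0)
  schrodinger : ∀ φ : Torus d → ℂ, TorusSmooth φ → ∀ t ∈ Ici (0 : ℝ),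
    HasDerivWithinAt (fun s => Complex.I * ∫ x, H1Torus.toFun (u s) x * φ x)
      (-(1 / 2) * (∫ x, H1Torus.toFun (u t) x * torusLaplacian φ x)
        + (γ : ℂ) * ∫ x, (potential σ₁ σ₂ (ψ t) x : ℂ) * φ x) (Ici 0) t
  velocity : ∀ φ : Torus d × Rn n → ℝ, IsTestFunction φ → ∀ t ∈ Ici (0 : ℝ),
    HasDerivWithinAt (fun s => ∫ x, ∫ z, HDot.toFun (ψ s x) z * φ (x, z))
      (-2 * c ^ 2 * ∫ p, ϖ t p * φ p) (Ici 0) t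
  wave : ∀ φ : Torus d × Rn n → ℝ, IsTestFunction φ → ∀ t ∈ Ici (0 : ℝ),
    HasDerivWithinAt (fun s => ∫ p, ϖ s p * φ p)
      ((1 / 2) * (∫ x, ∫ z, inner ℝ (HDot.grad (ψ t x) z) (gradient (fun w => φ (x, w)) z))
        + γ * ∫ p : Torus d × Rn n,
            σ₂ p.2 * torusConv σ₁ (fun y => (H1Torus.toFun (u t) y).re) p.1 * φ p) (Ici 0) t

end SchrodingerWave

end

/-! The system has constant coefficients in `x` and `σ₁` is even, so it splits into independent
modes. The real Hartley functions `cas (k · x) = cos (k · x) + sin (k · x)`, `k ∈ ℤ^d`, are used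
instead of exponentials: they are orthogonal and complete, they diagonalize both the Laplacian and
the convolution with `σ₁`, and they keep the coefficients of the real fields `ψ` and `ϖ` real.

Let `q + ip`, `ψ`, `ϖ` denote the coefficients of a mode of frequency `k`, let `s` be the eigenvalue
of `σ₁ ⋆`, and put `ℓ(ψ) = ∫ σ₂ ψ`. The mode solves a linear Hamiltonian system with conserved
energy `|k|²/4 (q² + p²) + γ s q ℓ(ψ) + c² ‖ϖ‖² + ¼ ‖∇ψ‖²`. By Plancherel, `|ℓ(ψ)| ≤ √κ ‖∇ψ‖`
(`IsFormFunction₂.abs_functional_le`), and `|s| ≤ ‖σ₁‖_{L¹}`. For `k ≠ 0` one has `|k|² ≥ 1`, and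
the smallness condition is what makes this form coercive after completing the square
(`IsModeSolution.norm_sq_le`). Parseval for `u` and `∇u`, and Bessel inequalities for `ψ` and `ϖ`,
sum these bounds over `k ≠ 0`.

The energy gives no control of `q, p` at `k = 0`. There `q` is constant, hence `0`, so the wave is
free and `p' = -γ s ℓ(ψ)`. If the wave data have zero mean, this wave has zero energy and `p` is
constant. If `n ≥ 5`, the time integral of the wave equation gives `-Δ ∫₀ᵗ ψ = 2 (ϖ(t) - ϖ(0))`,
whose right side is bounded in `L²`. Moreover `(-Δ)⁻¹ σ₂ ∈ L²`, because `|ξ|⁻⁴` is integrable near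
`0`. Hence `ℓ(∫₀ᵗ ψ)`, and with it `p`, is bounded (`IsFormFunction₂.exists_functional_le`).

Energy conservation must be proved for weak solutions, whose energy cannot be differentiated
directly. With `B` the polarized energy, the equations integrated over `[a, b]` give `B (X b - X a)
(∫ X) = 0`; so `B` is constant on the averages over `[t, t + r]`, and `r → 0` gives conservation
(`bilin_apply_self_eq`). The orthogonality tests a weak Laplace equation against an element of `Ḣ¹ ∩
L²`, which rests on density of test functions (`mem_closure_span_jet`). -/

noncomputable section

namespace SchrodingerWave

open scoped SchwartzMap FourierTransform LineDeriv Laplacian Topology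

/-! ### Characters of the torus and the Hartley functions -/

/-- The squared length of a frequency. -/
def freqSq {d : ℕ} (k : Fin d → ℤ) : ℝ := ∑ i, (k i : ℝ) ^ 2

theorem freqSq_nonneg {d : ℕ} (k : Fin d → ℤ) : 0 ≤ freqSq k :=
  Finset.sum_nonneg fun _ _ => sq_nonneg _

theorem one_le_freqSq {d : ℕ} {k : Fin d → ℤ} (hk : k ≠ 0) : 1 ≤ freqSq k := by
  obtain ⟨i, hi⟩ := Function.ne_iff.mp hk
  have h1 : (1 : ℝ) ≤ (k i : ℝ) ^ 2 := by
    have : (1 : ℤ) ≤ k i ^ 2 := Int.one_le_abs (pow_ne_zero 2 hi) |>.trans_eq (abs_of_nonneg (sq_nonneg _))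
    exact_mod_cast this
  exact h1.trans (Finset.single_le_sum (f := fun i => (k i : ℝ) ^ 2)
    (fun _ _ => sq_nonneg _) (Finset.mem_univ i))

/-- The character `x ↦ exp (i k · x)` of the torus. -/
def torusChar {d : ℕ} (k : Fin d → ℤ) : C(Torus d, ℂ) where
  toFun x := ∏ i, fourier (k i) (x i)
  continuous_toFun := by fun_prop

theorem torusChar_apply {d : ℕ} (k : Fin d → ℤ) (x : Torus d) :
    torusChar k x = ∏ i, fourier (k i) (x i) := rfl

theorem torusChar_neg {d : ℕ} (k : Fin d → ℤ) (x : Torus d) :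
    torusChar (-k) x = starRingEnd ℂ (torusChar k x) := by
  simp only [torusChar_apply, Pi.neg_apply, fourier_neg, map_prod]

theorem torusChar_add_index {d : ℕ} (k l : Fin d → ℤ) (x : Torus d) :
    torusChar (k + l) x = torusChar k x * torusChar l x := by
  simp only [torusChar_apply, Pi.add_apply, fourier_add, ← Finset.prod_mul_distrib]

theorem torusChar_add {d : ℕ} (k : Fin d → ℤ) (x y : Torus d) :
    torusChar k (x + y) = torusChar k x * torusChar k y := by
  simp only [torusChar_apply, Pi.add_apply, ← Finset.prod_mul_distrib]
  refine Finset.prod_congr rfl fun i _ => ?_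
  rw [fourier_apply, fourier_apply, fourier_apply, smul_add, AddCircle.toCircle_add, Circle.coe_mul]

theorem torusChar_zero {d : ℕ} (x : Torus d) : torusChar (0 : Fin d → ℤ) x = 1 := by
  simp [torusChar_apply]

theorem torusChar_neg_apply {d : ℕ} (k : Fin d → ℤ) (x : Torus d) :
    torusChar k (-x) = starRingEnd ℂ (torusChar k x) := by
  rw [← torusChar_neg]
  simp only [torusChar_apply, Pi.neg_apply, fourier_apply]
  simp

theorem norm_torusChar_apply {d : ℕ} (k : Fin d → ℤ) (x : Torus d) : ‖torusChar k x‖ = 1 := by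
  simp only [torusChar_apply, norm_prod, fourier_apply, Circle.norm_coe, Finset.prod_const_one]

theorem torusChar_single {d : ℕ} (k : Fin d → ℤ) (j : Fin d) (s : ℝ) :
    torusChar k (Pi.single j (s : AddCircle (2 * Real.pi))) = Complex.exp (Complex.I * (k j : ℝ) * s) := by
  rw [torusChar_apply, Finset.prod_eq_single j]
  · rw [Pi.single_eq_same, fourier_coe_apply]
    congr 1
    have : (Real.pi : ℂ) ≠ 0 := by exact_mod_cast Real.pi_ne_zero
    push_cast
    field_simp
  · intro i _ hi
    rw [Pi.single_eq_of_ne hi, fourier_eval_zero]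
  · simp

theorem torusChar_torusProj {d : ℕ} (k : Fin d → ℤ) (x : Fin d → ℝ) :
    torusChar k (torusProj x) = Complex.exp (Complex.I * ((∑ i, (k i : ℝ) * x i : ℝ) : ℂ)) := by
  rw [torusChar_apply]
  have : (Real.pi : ℂ) ≠ 0 := by exact_mod_cast Real.pi_ne_zero
  simp only [torusProj, fourier_coe_apply, ← Complex.exp_sum]
  congr 1
  push_cast
  rw [Finset.mul_sum]
  refine Finset.sum_congr rfl fun i _ => ?_
  field_simp

theorem integral_fourier_eq_zero {n : ℤ} (hn : n ≠ 0) :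
    ∫ x : AddCircle (2 * Real.pi), fourier n x = 0 := by
  have h := integral_add_right_eq_self (μ := (volume : Measure (AddCircle (2 * Real.pi))))
    (fun x => (fourier n x : ℂ)) ((2 * Real.pi / 2 / n : ℝ) : AddCircle (2 * Real.pi))
  simp_rw [fourier_add_half_inv_index hn Real.two_pi_pos] at h
  rw [integral_neg] at h
  linear_combination (-1 / 2 : ℂ) * h

theorem integral_torusChar {d : ℕ} {k : Fin d → ℤ} (hk : k ≠ 0) :
    ∫ x : Torus d, torusChar k x = 0 := by
  simp only [torusChar_apply]
  rw [MeasureTheory.integral_fintype_prod_volume_eq_prod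
    (f := fun i (y : AddCircle (2 * Real.pi)) => (fourier (k i) y : ℂ))]
  obtain ⟨i, hi⟩ := Function.ne_iff.mp hk
  exact Finset.prod_eq_zero (Finset.mem_univ i) (integral_fourier_eq_zero hi)

/-- The total mass of the torus. -/
def torusMass (d : ℕ) : ℝ := (volume : Measure (Torus d)).real univ

theorem torusMass_pos (d : ℕ) : 0 < torusMass d := by
  unfold torusMass
  exact measureReal_univ_pos

/-- The Hartley function `x ↦ cos (k · x) + sin (k · x)`. -/
def torusCas {d : ℕ} (k : Fin d → ℤ) : C(Torus d, ℝ) where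
  toFun x := (torusChar k x).re + (torusChar k x).im
  continuous_toFun := by fun_prop

theorem torusCas_apply {d : ℕ} (k : Fin d → ℤ) (x : Torus d) :
    torusCas k x = (torusChar k x).re + (torusChar k x).im := rfl

theorem torusCas_neg {d : ℕ} (k : Fin d → ℤ) (x : Torus d) :
    torusCas (-k) x = (torusChar k x).re - (torusChar k x).im := by
  simp [torusCas_apply, torusChar_neg, sub_eq_add_neg]

theorem torusCas_zero {d : ℕ} (x : Torus d) : torusCas (0 : Fin d → ℤ) x = 1 := by
  simp [torusCas_apply, torusChar_zero]

/-- The parts even and odd in `x` are separated, so that an even kernel integrated against this acts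
diagonally. -/
theorem torusCas_add {d : ℕ} (k : Fin d → ℤ) (x y : Torus d) :
    torusCas k (x + y) = (torusChar k x).re * torusCas k y + (torusChar k x).im * torusCas (-k) y := by
  rw [torusCas_neg, torusCas_apply, torusCas_apply, torusChar_add]
  simp only [Complex.mul_re, Complex.mul_im]
  ring

theorem abs_torusCas_le {d : ℕ} (k : Fin d → ℤ) (x : Torus d) : |torusCas k x| ≤ 2 := by
  rw [torusCas_apply]
  have h := norm_torusChar_apply k x
  have h1 := Complex.abs_re_le_norm (torusChar k x)
  have h2 := Complex.abs_im_le_norm (torusChar k x)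
  exact (abs_add_le _ _).trans (by linarith)

theorem ofReal_torusCas {d : ℕ} (k : Fin d → ℤ) (x : Torus d) :
    (torusCas k x : ℂ)
      = (1 - Complex.I) / 2 * torusChar k x + (1 + Complex.I) / 2 * torusChar (-k) x := by
  rw [torusChar_neg, torusCas_apply]
  apply Complex.ext <;> simp <;> ring

theorem torusChar_eq_torusCas {d : ℕ} (k : Fin d → ℤ) (x : Torus d) :
    torusChar k x = (1 + Complex.I) / 2 * (torusCas k x : ℂ)
      + (1 - Complex.I) / 2 * (torusCas (-k) x : ℂ) := by
  rw [torusCas_neg, torusCas_apply]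
  apply Complex.ext <;> simp <;> ring

theorem integrable_of_continuous {d : ℕ} {F : Type*} [NormedAddCommGroup F]
    {f : Torus d → F} (hf : Continuous f) :
    Integrable f (volume : Measure (Torus d)) :=
  hf.integrable_of_hasCompactSupport (HasCompactSupport.of_compactSpace f)

/-- The product is `cos ((k - l) · x) + sin ((k + l) · x)`. The sine always integrates to zero, also
when `k + l = 0`, so `cas k` and `cas (-k)` are orthogonal for `k ≠ 0`. -/
theorem integral_torusCas_mul {d : ℕ} (k l : Fin d → ℤ) :
    ∫ x, torusCas k x * torusCas l x = if k = l then torusMass d else 0 := by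
  have hre : ∀ m : Fin d → ℤ, ∫ x, (torusChar m x).re = (∫ x, torusChar m x).re := fun m =>
    integral_re (𝕜 := ℂ) (integrable_of_continuous (torusChar m).continuous)
  have him : ∀ m : Fin d → ℤ, ∫ x, (torusChar m x).im = (∫ x, torusChar m x).im := fun m =>
    integral_im (𝕜 := ℂ) (integrable_of_continuous (torusChar m).continuous)
  have h : ∀ x : Torus d, torusCas k x * torusCas l x
      = (torusChar (k - l) x).re + (torusChar (k + l) x).im := by
    intro x
    rw [sub_eq_add_neg, torusChar_add_index, torusChar_add_index, torusChar_neg,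
      torusCas_apply, torusCas_apply]
    simp
    ring
  simp_rw [h]
  rw [integral_add (integrable_of_continuous (by fun_prop)) (integrable_of_continuous (by fun_prop)),
    hre, him]
  have h0 : ∫ x : Torus d, torusChar (0 : Fin d → ℤ) x = (torusMass d : ℂ) := by
    simp [torusChar_zero, torusMass]
  have hz : (∫ x : Torus d, torusChar (k + l) x).im = 0 := by
    by_cases hkl : k + l = 0
    · rw [hkl, h0, Complex.ofReal_im]
    · rw [integral_torusChar hkl, Complex.zero_im]
  rw [hz, add_zero]
  split_ifs with hkl
  · rw [hkl, sub_self, h0, Complex.ofReal_re]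
  · rw [integral_torusChar (sub_ne_zero.2 hkl), Complex.zero_re]

/-! ### Smoothness and derivatives -/

theorem torusSmooth_torusChar {d : ℕ} (k : Fin d → ℤ) : TorusSmooth (fun x => torusChar k x) := by
  unfold TorusSmooth
  simp_rw [torusChar_torusProj]
  have h : ContDiff ℝ ∞ (fun x : Fin d → ℝ => ∑ i, (k i : ℝ) * x i) :=
    ContDiff.sum fun i _ => contDiff_const.mul (contDiff_apply ℝ ℝ i)
  exact Complex.contDiff_exp.comp (contDiff_const.mul (Complex.ofRealCLM.contDiff.comp h))

theorem torusSmooth_torusCas {d : ℕ} (k : Fin d → ℤ) : TorusSmooth (fun x => torusCas k x) := by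
  have h := torusSmooth_torusChar k
  unfold TorusSmooth at h ⊢
  simp_rw [torusCas_apply]
  exact (Complex.reCLM.contDiff.comp h).add (Complex.imCLM.contDiff.comp h)

theorem torusSmooth_ofReal_torusCas {d : ℕ} (k : Fin d → ℤ) :
    TorusSmooth (fun x => (torusCas k x : ℂ)) :=
  Complex.ofRealCLM.contDiff.comp (torusSmooth_torusCas k)

theorem hasDerivAt_torusChar {d : ℕ} (k : Fin d → ℤ) (j : Fin d) (x : Torus d) :
    HasDerivAt (fun s : ℝ => torusChar k (x + Pi.single j (s : AddCircle (2 * Real.pi))))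
      (Complex.I * (k j : ℝ) * torusChar k x) 0 := by
  simp_rw [torusChar_add, torusChar_single]
  have h : HasDerivAt (fun s : ℝ => Complex.exp (Complex.I * (k j : ℝ) * s))
      (Complex.I * (k j : ℝ)) 0 := by
    have := (((Complex.ofRealCLM.hasDerivAt (x := (0 : ℝ))).const_mul
      (Complex.I * (k j : ℝ))).cexp)
    simpa using this
  simpa [mul_comm] using h.const_mul (torusChar k x)

/-- Since `(cos + sin)' = cos - sin`, a derivative reflects the frequency. A second derivative
reflects it back, which makes `cas k` an eigenfunction of the Laplacian. -/
theorem torusPartial_torusCas {d : ℕ} (k : Fin d → ℤ) (j : Fin d) :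
    torusPartial j (fun x => (torusCas k x : ℂ)) = fun x => (k j : ℝ) * (torusCas (-k) x : ℂ) := by
  funext x
  unfold torusPartial
  simp_rw [ofReal_torusCas]
  have h := ((hasDerivAt_torusChar k j x).const_mul ((1 - Complex.I) / 2)).add
    ((hasDerivAt_torusChar (-k) j x).const_mul ((1 + Complex.I) / 2))
  refine (HasDerivAt.deriv h).trans ?_
  simp only [neg_neg, Pi.neg_apply]
  push_cast
  linear_combination (-1/2 * (k j : ℂ) * torusChar k x - 1 / 2 * (k j : ℂ) * torusChar (-k) x)
    * Complex.I_sq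

theorem torusLaplacian_torusCas {d : ℕ} (k : Fin d → ℤ) (x : Torus d) :
    torusLaplacian (fun x => (torusCas k x : ℂ)) x = -(freqSq k : ℂ) * torusCas k x := by
  unfold torusLaplacian freqSq
  have h : ∀ j : Fin d, torusPartial j (torusPartial j (fun x => (torusCas k x : ℂ))) x
      = -((k j : ℂ) ^ 2) * torusCas k x := by
    intro j
    rw [torusPartial_torusCas]
    have h1 := congrFun (torusPartial_torusCas (-k) j) x
    unfold torusPartial at h1 ⊢
    rw [neg_neg] at h1
    rw [deriv_const_mul_field, h1]
    push_cast
    simp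
    ring
  simp_rw [h]
  rw [← Finset.sum_mul, Finset.sum_neg_distrib]
  push_cast
  rfl

/-! ### Completeness -/

/-- The Hartley function as a complex-valued continuous function. -/
def torusCasC {d : ℕ} (k : Fin d → ℤ) : C(Torus d, ℂ) where
  toFun x := (torusCas k x : ℂ)
  continuous_toFun := by fun_prop

/-- The star algebra of trigonometric polynomials. -/
def torusTrigAlgebra (d : ℕ) : StarSubalgebra ℂ C(Torus d, ℂ) where
  toSubalgebra := Algebra.adjoin ℂ (range torusChar)
  star_mem' := by
    change Algebra.adjoin ℂ (range torusChar) ≤ star (Algebra.adjoin ℂ (range torusChar))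
    refine Algebra.adjoin_le ?_
    rintro _ ⟨n, rfl⟩
    refine Algebra.subset_adjoin ⟨-n, ?_⟩
    ext1 x
    simp only [torusChar_neg, starRingEnd_apply, ContinuousMap.star_apply]

theorem torusTrigAlgebra_coe (d : ℕ) :
    (torusTrigAlgebra d).toSubalgebra.toSubmodule = Submodule.span ℂ (range torusChar) := by
  apply Algebra.adjoin_eq_span_of_subset
  refine .trans (fun x => Submonoid.closure_induction (fun _ => id) ⟨0, ?_⟩ ?_) Submodule.subset_span
  · ext z
    simp [torusChar_zero]
  · rintro _ _ _ _ ⟨m, rfl⟩ ⟨n, rfl⟩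
    refine ⟨m + n, ?_⟩
    ext z
    simp [torusChar_add_index]

theorem torusTrigAlgebra_separatesPoints (d : ℕ) : (torusTrigAlgebra d).SeparatesPoints := by
  intro x y hxy
  obtain ⟨i, hi⟩ := Function.ne_iff.mp hxy
  refine ⟨_, ⟨torusChar (Pi.single i 1), Algebra.subset_adjoin ⟨Pi.single i 1, rfl⟩, rfl⟩, ?_⟩
  have h : ∀ z : Torus d, torusChar (Pi.single i 1) z = fourier 1 (z i) := by
    intro z
    rw [torusChar_apply, Finset.prod_eq_single i]
    · simp
    · intro j _ hj
      rw [Pi.single_eq_of_ne hj, fourier_zero]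
    · simp
  dsimp only
  rw [h, h, fourier_one, fourier_one]
  contrapose hi
  exact AddCircle.injective_toCircle Real.two_pi_pos.ne' (Circle.coe_injective hi)

/-- Stone–Weierstrass gives density for the characters, and each character is a combination of `cas
k` and `cas (-k)`. -/
theorem span_torusCasC_closure_eq_top (d : ℕ) :
    (Submodule.span ℂ (range (torusCasC (d := d)))).topologicalClosure = ⊤ := by
  have h1 : (Submodule.span ℂ (range (torusChar (d := d)))).topologicalClosure = ⊤ := by
    rw [← torusTrigAlgebra_coe]
    exact congr_arg (Subalgebra.toSubmodule <| StarSubalgebra.toSubalgebra ·)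
      (ContinuousMap.starSubalgebra_topologicalClosure_eq_top_of_separatesPoints _
        (torusTrigAlgebra_separatesPoints d))
  have h2 : Submodule.span ℂ (range (torusChar (d := d)))
      ≤ Submodule.span ℂ (range (torusCasC (d := d))) := by
    rw [Submodule.span_le]
    rintro _ ⟨k, rfl⟩
    have h : torusChar k = ((1 + Complex.I) / 2) • torusCasC k
        + ((1 - Complex.I) / 2) • torusCasC (-k) := by
      ext x
      exact torusChar_eq_torusCas k x
    rw [h]
    exact Submodule.add_mem _ (Submodule.smul_mem _ _ (Submodule.subset_span ⟨k, rfl⟩))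
      (Submodule.smul_mem _ _ (Submodule.subset_span ⟨-k, rfl⟩))
  exact top_le_iff.1 (h1.ge.trans (Submodule.topologicalClosure_mono h2))

/-- The Hartley coefficient of `f`. -/
def casCoeff {d : ℕ} {F : Type*} [NormedAddCommGroup F] [NormedSpace ℝ F]
    (k : Fin d → ℤ) (f : Torus d → F) : F := ∫ x, torusCas k x • f x

/-- The normalized Hartley function in `L²`. -/
def casLp {d : ℕ} (k : Fin d → ℤ) : L2Torus d :=
  (((Real.sqrt (torusMass d))⁻¹ : ℝ) : ℂ) • ContinuousMap.toLp (E := ℂ) 2 volume ℂ (torusCasC k)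

theorem orthonormal_casLp (d : ℕ) : Orthonormal ℂ (casLp (d := d)) := by
  have hN := torusMass_pos d
  rw [orthonormal_iff_ite]
  intro k l
  have h : ∫ x, (starRingEnd ℂ) (torusCasC k x) * torusCasC l x
      = ((∫ x, torusCas k x * torusCas l x : ℝ) : ℂ) := by
    refine Eq.trans ?_ integral_ofReal
    refine integral_congr_ae (Filter.Eventually.of_forall fun x => ?_)
    simp [torusCasC]
  rw [casLp, casLp, inner_smul_left, inner_smul_right, ContinuousMap.inner_toLp]
  rw [show (∫ x, torusCasC l x * (starRingEnd ℂ) (torusCasC k x) : ℂ)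
    = ∫ x, (starRingEnd ℂ) (torusCasC k x) * torusCasC l x by simp_rw [mul_comm], h, integral_torusCas_mul]
  rw [Complex.conj_ofReal]
  split_ifs
  · norm_cast
    field_simp
    rw [Real.sq_sqrt hN.le]
  · simp

theorem span_casLp_closure (d : ℕ) :
    (Submodule.span ℂ (range (casLp (d := d)))).topologicalClosure = ⊤ := by
  have h1 : (Submodule.span ℂ (range fun k : Fin d → ℤ =>
      (ContinuousMap.toLp (E := ℂ) 2 volume ℂ (torusCasC k) : L2Torus d))).topologicalClosure = ⊤ := by
    simpa only [Submodule.map_span, ContinuousLinearMap.coe_coe, ← range_comp, Function.comp_def] using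
      (ContinuousMap.toLp_denseRange ℂ (volume : Measure (Torus d)) ℂ
        (p := 2) (by simp)).topologicalClosure_map_submodule (span_torusCasC_closure_eq_top d)
  have h2 : (Submodule.span ℂ (range fun k : Fin d → ℤ =>
      (ContinuousMap.toLp (E := ℂ) 2 volume ℂ (torusCasC k) : L2Torus d)))
      ≤ Submodule.span ℂ (range (casLp (d := d))) := by
    rw [Submodule.span_le]
    rintro _ ⟨k, rfl⟩
    have hne : (((Real.sqrt (torusMass d))⁻¹ : ℝ) : ℂ) ≠ 0 := by
      exact_mod_cast inv_ne_zero (Real.sqrt_ne_zero'.2 (torusMass_pos d))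
    have := Submodule.smul_mem (Submodule.span ℂ (range (casLp (d := d))))
      (((Real.sqrt (torusMass d))⁻¹ : ℝ) : ℂ)⁻¹ (Submodule.subset_span ⟨k, rfl⟩)
    rwa [casLp, inv_smul_smul₀ hne] at this
  exact top_le_iff.1 (h1.ge.trans (Submodule.topologicalClosure_mono h2))

/-- Parseval for the Hilbert basis `casLp`; the factor `torusMass d` is the squared norm of the
unnormalized Hartley functions. -/
theorem hasSum_norm_sq_casCoeff {d : ℕ} (f : L2Torus d) :
    HasSum (fun k : Fin d → ℤ => ‖casCoeff k f‖ ^ 2) (torusMass d * ‖f‖ ^ 2) := by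
  have hN := torusMass_pos d
  let b : HilbertBasis (Fin d → ℤ) ℂ (L2Torus d) :=
    HilbertBasis.mk (orthonormal_casLp d) (span_casLp_closure d).ge
  have h := b.hasSum_inner_mul_inner f f
  have hk : ∀ k, inner ℂ (b k) f = (((Real.sqrt (torusMass d))⁻¹ : ℝ) : ℂ) * casCoeff k f := by
    intro k
    rw [show b k = casLp k from congrFun (HilbertBasis.coe_mk _ _) k, casLp, inner_smul_left,
      Complex.conj_ofReal, MeasureTheory.L2.inner_def]
    congr 1
    refine integral_congr_ae ?_
    filter_upwards [ContinuousMap.coeFn_toLp (p := 2) (𝕜 := ℂ) (volume : Measure (Torus d)) (torusCasC k)] with x hx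
    rw [hx]
    simp [torusCasC, mul_comm]
  have h2 : ∀ k, inner ℂ f (b k) * inner ℂ (b k) f
      = (((torusMass d)⁻¹ * ‖casCoeff k f‖ ^ 2 : ℝ) : ℂ) := by
    intro k
    rw [← inner_conj_symm, hk, map_mul, Complex.conj_ofReal]
    have e : (starRingEnd ℂ) (casCoeff k f) * casCoeff k f = ((‖casCoeff k f‖ ^ 2 : ℝ) : ℂ) := by
      rw [mul_comm, Complex.mul_conj, Complex.normSq_eq_norm_sq]
    have e2 : (((Real.sqrt (torusMass d))⁻¹ : ℝ) : ℂ) * (((Real.sqrt (torusMass d))⁻¹ : ℝ) : ℂ)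
        = (((torusMass d)⁻¹ : ℝ) : ℂ) := by
      norm_cast
      rw [← mul_inv, Real.mul_self_sqrt hN.le]
    push_cast at e e2 ⊢
    linear_combination (((Real.sqrt (torusMass d))⁻¹ : ℂ)) ^ 2 * e + (‖casCoeff k f‖ : ℂ) ^ 2 * e2
  simp_rw [h2] at h
  rw [inner_self_eq_norm_sq_to_K] at h
  have h3 : HasSum (fun k => (torusMass d)⁻¹ * ‖casCoeff k f‖ ^ 2) (‖f‖ ^ 2) := by
    have := Complex.hasSum_re h
    convert this using 1
    · funext k
      rw [Complex.ofReal_re]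
    · exact (by rw [← Complex.ofReal_pow, Complex.ofReal_re] : ‖f‖ ^ 2 = ((‖f‖ : ℂ) ^ 2).re)
  have h4 := h3.mul_left (torusMass d)
  simpa only [mul_inv_cancel_left₀ hN.ne'] using h4

/-! ### The space `Ḣ¹(ℝ^n)` -/

/-- Completeness gives their meaning to the Bochner integrals in `HDot n`, namely the Hartley
coefficients and the time averages. -/
instance completeSpace_HDot (n : ℕ) : CompleteSpace (HDot n) := by
  unfold HDot
  infer_instance

/-- The gradient as a continuous linear map. -/
def HDot.gradCLM (n : ℕ) : HDot n →L[ℝ] Lp (Rn n) 2 (volume : Measure (Rn n)) :=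
  (ContinuousLinearMap.snd ℝ _ _).comp (HDot n).subtypeL

theorem HDot.gradCLM_apply {n : ℕ} (f : HDot n) : (HDot.gradCLM n f : Rn n → Rn n) = HDot.grad f := rfl

/-- The underlying function as a continuous linear map. -/
def HDot.valCLM (n : ℕ) : HDot n →L[ℝ] Lp ℝ (sobolevExponent n) (volume : Measure (Rn n)) :=
  (ContinuousLinearMap.fst ℝ _ _).comp (HDot n).subtypeL

theorem HDot.valCLM_apply {n : ℕ} (f : HDot n) : (HDot.valCLM n f : Rn n → ℝ) = HDot.toFun f := rfl

/-- The pairs `(φ, ∇φ)` with `φ ∈ C_c^∞`. -/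
def testPairs (n : ℕ) : Submodule ℝ
    (Lp ℝ (sobolevExponent n) (volume : Measure (Rn n)) ×
      Lp (Rn n) 2 (volume : Measure (Rn n))) where
  carrier := {p | ∃ φ : Rn n → ℝ, ContDiff ℝ ∞ φ ∧ HasCompactSupport φ ∧
    p.1 =ᵐ[volume] φ ∧ p.2 =ᵐ[volume] gradient φ}
  zero_mem' := by
    refine ⟨0, contDiff_const, HasCompactSupport.zero, Lp.coeFn_zero _ _ _, ?_⟩
    filter_upwards [Lp.coeFn_zero (Rn n) 2 volume] with x hx
    simp [gradient]
  add_mem' := by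
    rintro p q ⟨φ, h1, h2, h3, h4⟩ ⟨η, k1, k2, k3, k4⟩
    refine ⟨φ + η, h1.add k1, h2.add k2, ?_, ?_⟩
    · filter_upwards [Lp.coeFn_add p.1 q.1, h3, k3] with x hx h k
      rw [Prod.fst_add, hx, Pi.add_apply, h, k, Pi.add_apply]
    · filter_upwards [Lp.coeFn_add p.2 q.2, h4, k4] with x hx h k
      simp only [Prod.snd_add, hx, Pi.add_apply, h, k, gradient]
      rw [fderiv_add (h1.differentiable (by simp)).differentiableAt
        (k1.differentiable (by simp)).differentiableAt, map_add]
  smul_mem' := by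
    rintro a p ⟨φ, h1, h2, h3, h4⟩
    refine ⟨a • φ, contDiff_const.smul h1, h2.smul_left (f := fun _ => a), ?_, ?_⟩
    · filter_upwards [Lp.coeFn_smul a p.1, h3] with x hx h
      rw [Prod.smul_fst, hx, Pi.smul_apply, h, Pi.smul_apply]
    · filter_upwards [Lp.coeFn_smul a p.2, h4] with x hx h
      simp only [Prod.smul_snd, hx, Pi.smul_apply, h, gradient]
      rw [fderiv_const_smul (h1.differentiable (by simp)).differentiableAt, map_smul]

/-- A closed property of elements of `Ḣ¹` which holds for test functions holds everywhere. -/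
theorem HDot.induction {n : ℕ} {P : HDot n → Prop} (hc : IsClosed {f | P f})
    (ht : ∀ (φ : Rn n → ℝ) (f : HDot n), ContDiff ℝ ∞ φ → HasCompactSupport φ →
      HDot.toFun f =ᵐ[volume] φ → HDot.grad f =ᵐ[volume] gradient φ → P f) (f : HDot n) : P f := by
  have hspan : HDot n = (testPairs n).topologicalClosure := by
    unfold HDot
    congr 1
    exact Submodule.span_eq (testPairs n)
  have hf : f.1 ∈ closure ((testPairs n : Submodule ℝ _) : Set _) := by
    exact hspan.le f.2
  obtain ⟨x, hx, hlim⟩ := mem_closure_iff_seq_limit.1 hf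
  have hmem : ∀ m, x m ∈ HDot n := fun m => by
    exact hspan.ge (Submodule.le_topologicalClosure _ (hx m))
  refine hc.mem_of_tendsto (f := fun m => (⟨x m, hmem m⟩ : HDot n))
    (tendsto_subtype_rng.2 hlim) (Filter.Eventually.of_forall fun m => ?_)
  obtain ⟨φ, h1, h2, h3, h4⟩ := hx m
  exact ht φ _ h1 h2 h3 h4

instance fact_one_le_sobolevExponent_conj (n : ℕ) :
    Fact (1 ≤ (1 - (sobolevExponent n)⁻¹)⁻¹) := by simp [fact_iff]

instance holderConjugate_sobolevExponent (n : ℕ) :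
    ENNReal.HolderConjugate (sobolevExponent n) (1 - (sobolevExponent n)⁻¹)⁻¹ :=
  ENNReal.HolderConjugate.inv_one_sub_inv' (fact_one_le_sobolevExponent n).out

/-- Pairing of `Ḣ¹` with a compactly supported continuous function. -/
def HDot.pair {n : ℕ} {η : Rn n → ℝ} (h1 : Continuous η) (h2 : HasCompactSupport η) :
    HDot n →L[ℝ] ℝ :=
  (((ContinuousLinearMap.mul ℝ ℝ).lpPairing volume (sobolevExponent n)
    (1 - (sobolevExponent n)⁻¹)⁻¹).flip
    ((h1.memLp_of_hasCompactSupport h2).toLp η)).comp (HDot.valCLM n)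

theorem HDot.pair_apply {n : ℕ} {η : Rn n → ℝ} (h1 : Continuous η) (h2 : HasCompactSupport η)
    (f : HDot n) : HDot.pair h1 h2 f = ∫ z, HDot.toFun f z * η z := by
  unfold HDot.pair
  simp only [ContinuousLinearMap.coe_comp, Function.comp_apply, ContinuousLinearMap.flip_apply,
    ContinuousLinearMap.lpPairing_eq_integral]
  refine integral_congr_ae ?_
  filter_upwards [(h1.memLp_of_hasCompactSupport (p := (1 - (sobolevExponent n)⁻¹)⁻¹)
    (μ := volume) h2).coeFn_toLp] with z hz
  rw [hz, HDot.valCLM_apply]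
  rfl

/-- Pairing of the gradient of an element of `Ḣ¹` with a square integrable vector field. -/
def HDot.gradPair {n : ℕ} (F : Lp (Rn n) 2 (volume : Measure (Rn n))) : HDot n →L[ℝ] ℝ :=
  (innerSL ℝ F).comp (HDot.gradCLM n)

theorem HDot.gradPair_apply {n : ℕ} (F : Lp (Rn n) 2 (volume : Measure (Rn n))) (f : HDot n) :
    HDot.gradPair F f = inner ℝ F (HDot.gradCLM n f) := rfl

theorem continuous_gradient {n : ℕ} {φ : Rn n → ℝ} (h : ContDiff ℝ ∞ φ) :
    Continuous (gradient φ) :=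
  (InnerProductSpace.toDual ℝ (Rn n)).symm.continuous.comp (h.continuous_fderiv (by simp))

theorem hasCompactSupport_gradient {n : ℕ} {φ : Rn n → ℝ} (h : HasCompactSupport φ) :
    HasCompactSupport (gradient φ) :=
  (h.fderiv (𝕜 := ℝ)).comp_left (g := (InnerProductSpace.toDual ℝ (Rn n)).symm) (map_zero _)

theorem inner_gradient {n : ℕ} (φ : Rn n → ℝ) (x y : Rn n) :
    inner ℝ (gradient φ x) y = fderiv ℝ φ x y := by
  rw [gradient, InnerProductSpace.toDual_symm_apply]

theorem inner_gradient_right {n : ℕ} (φ : Rn n → ℝ) (x y : Rn n) :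
    inner ℝ y (gradient φ x) = fderiv ℝ φ x y := by
  rw [real_inner_comm, inner_gradient]

theorem memLp_test {n : ℕ} {F : Type*} [NormedAddCommGroup F] {φ : Rn n → F} (h1 : Continuous φ)
    (h2 : HasCompactSupport φ) (p : ℝ≥0∞) : MemLp φ p (volume : Measure (Rn n)) :=
  h1.memLp_of_hasCompactSupport h2

theorem inner_toLp_left {n : ℕ} {F : Type*} [NormedAddCommGroup F] [InnerProductSpace ℝ F]
    {η : Rn n → F} (h : MemLp η 2 (volume : Measure (Rn n)))
    (g : Lp F 2 (volume : Measure (Rn n))) :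
    inner ℝ (h.toLp η) g = ∫ z, inner ℝ (η z) (g z) := by
  rw [MeasureTheory.L2.inner_def]
  refine integral_congr_ae ?_
  filter_upwards [h.coeFn_toLp] with z hz
  rw [hz]

/-- The gradient of an element of `Ḣ¹` is its weak gradient. -/
theorem HDot.integral_inner_grad_mul {n : ℕ} (f : HDot n) {η : Rn n → ℝ} (h1 : ContDiff ℝ ∞ η)
    (h2 : HasCompactSupport η) (y : Rn n) :
    ∫ z, inner ℝ (η z • y) (HDot.grad f z) = - ∫ z, HDot.toFun f z * fderiv ℝ η z y := by
  have hc : Continuous fun z => η z • y := h1.continuous.smul continuous_const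
  have hs : HasCompactSupport fun z => η z • y := h2.smul_right
  have hm := memLp_test hc hs 2
  have hc' : Continuous fun z => fderiv ℝ η z y :=
    (h1.continuous_fderiv (by simp)).clm_apply continuous_const
  have hs' : HasCompactSupport fun z => fderiv ℝ η z y :=
    (h2.fderiv (𝕜 := ℝ)).comp_left (g := fun L : Rn n →L[ℝ] ℝ => L y) rfl
  -- Both sides are continuous on `Ḣ¹`, so it is enough to integrate by parts for test functions.
  have key : HDot.gradPair (hm.toLp _) f = - HDot.pair hc' hs' f := by
    refine HDot.induction (P := fun f => HDot.gradPair (hm.toLp _) f = - HDot.pair hc' hs' f)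
      (isClosed_eq (HDot.gradPair _).continuous (HDot.pair hc' hs').continuous.neg) ?_ f
    intro φ g k1 k2 k3 k4
    rw [HDot.gradPair_apply, HDot.pair_apply, inner_toLp_left]
    have e1 : ∫ z, inner ℝ (η z • y) (HDot.gradCLM n g z) = ∫ z, fderiv ℝ φ z y * η z := by
      refine integral_congr_ae ?_
      filter_upwards [k4] with z hz
      rw [HDot.gradCLM_apply, hz, inner_gradient_right, map_smul, smul_eq_mul, mul_comm]
    have e2 : ∫ z, HDot.toFun g z * fderiv ℝ η z y = ∫ z, φ z * fderiv ℝ η z y := by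
      refine integral_congr_ae ?_
      filter_upwards [k3] with z hz
      rw [hz]
    have hcφ : Continuous fun z => fderiv ℝ φ z y :=
      (k1.continuous_fderiv (by simp)).clm_apply continuous_const
    rw [e1, e2, integral_mul_fderiv_eq_neg_fderiv_mul_of_integrable, neg_neg]
    · exact (hcφ.mul h1.continuous).integrable_of_hasCompactSupport h2.mul_left
    · exact (k1.continuous.mul hc').integrable_of_hasCompactSupport hs'.mul_left
    · exact (k1.continuous.mul h1.continuous).integrable_of_hasCompactSupport h2.mul_left
    · exact fun x _ => (k1.differentiable (by simp)).differentiableAt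
    · exact fun x _ => (h1.differentiable (by simp)).differentiableAt
  rw [HDot.gradPair_apply, HDot.pair_apply, inner_toLp_left] at key
  exact key

/-! ### Schwartz functions and the Fourier transform -/

/-- Complexification of a real Schwartz function. -/
def schwartzOfReal (n : ℕ) : 𝓢(Rn n, ℝ) →L[ℝ] 𝓢(Rn n, ℂ) :=
  SchwartzMap.postcompCLM Complex.ofRealCLM

theorem schwartzOfReal_apply {n : ℕ} (φ : 𝓢(Rn n, ℝ)) (x : Rn n) :
    schwartzOfReal n φ x = (φ x : ℂ) := rfl

/-- Real part of a complex Schwartz function. -/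
def schwartzRe (n : ℕ) : 𝓢(Rn n, ℂ) →L[ℝ] 𝓢(Rn n, ℝ) :=
  SchwartzMap.postcompCLM Complex.reCLM

theorem schwartzRe_apply {n : ℕ} (φ : 𝓢(Rn n, ℂ)) (x : Rn n) :
    schwartzRe n φ x = (φ x).re := rfl

theorem lineDerivOp_postcompCLM {n : ℕ} {F G : Type*} [NormedAddCommGroup F] [NormedSpace ℝ F]
    [NormedAddCommGroup G] [NormedSpace ℝ G] (L : F →L[ℝ] G) (φ : 𝓢(Rn n, F)) (v : Rn n) :
    ∂_{v} (SchwartzMap.postcompCLM (𝕜 := ℝ) L φ) = SchwartzMap.postcompCLM (𝕜 := ℝ) L (∂_{v} φ) := by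
  ext x
  rw [SchwartzMap.lineDerivOp_apply_eq_fderiv, SchwartzMap.postcompCLM_apply,
    SchwartzMap.lineDerivOp_apply_eq_fderiv]
  have h : HasFDerivAt (fun y => L (φ y)) (L.comp (fderiv ℝ φ x)) x :=
    L.hasFDerivAt.comp x (φ.differentiableAt.hasFDerivAt)
  have e : ((SchwartzMap.postcompCLM (𝕜 := ℝ) L φ : 𝓢(Rn n, G)) : Rn n → G) = fun y => L (φ y) := rfl
  rw [e, h.fderiv]
  rfl

theorem laplacian_postcompCLM {n : ℕ} {F G : Type*} [NormedAddCommGroup F] [NormedSpace ℝ F]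
    [NormedAddCommGroup G] [NormedSpace ℝ G] (L : F →L[ℝ] G) (φ : 𝓢(Rn n, F)) :
    Δ (SchwartzMap.postcompCLM (𝕜 := ℝ) L φ) = SchwartzMap.postcompCLM (𝕜 := ℝ) L (Δ φ) := by
  rw [SchwartzMap.laplacian_eq_sum (EuclideanSpace.basisFun (Fin n) ℝ),
    SchwartzMap.laplacian_eq_sum (EuclideanSpace.basisFun (Fin n) ℝ), map_sum]
  simp_rw [lineDerivOp_postcompCLM]

theorem integrable_norm_sq_schwartz {n : ℕ} {F : Type*} [NormedAddCommGroup F] [NormedSpace ℝ F]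
    (φ : 𝓢(Rn n, F)) : Integrable (fun x => ‖φ x‖ ^ 2) (volume : Measure (Rn n)) :=
  (φ.memLp 2 volume).integrable_norm_pow (by norm_num)

theorem norm_gradient_sq {n : ℕ} (φ : 𝓢(Rn n, ℝ)) (x : Rn n) :
    ‖gradient φ x‖ ^ 2 = ∑ j, ‖(∂_{EuclideanSpace.basisFun (Fin n) ℝ j} (schwartzOfReal n φ)) x‖ ^ 2 := by
  rw [← (EuclideanSpace.basisFun (Fin n) ℝ).sum_sq_norm_inner_right (gradient φ x)]
  refine Finset.sum_congr rfl fun j _ => ?_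
  unfold schwartzOfReal
  rw [inner_gradient_right, lineDerivOp_postcompCLM, SchwartzMap.postcompCLM_apply,
    SchwartzMap.lineDerivOp_apply_eq_fderiv]
  simp

theorem norm_fourier_lineDerivOp {n : ℕ} (g : 𝓢(Rn n, ℂ)) (v ξ : Rn n) :
    ‖𝓕 (∂_{v} g) ξ‖ ^ 2 = (2 * Real.pi) ^ 2 * inner ℝ ξ v ^ 2 * ‖𝓕 g ξ‖ ^ 2 := by
  have h : (fun x : Rn n => inner ℝ x v).HasTemperateGrowth := by fun_prop
  rw [SchwartzMap.fourier_lineDerivOp_eq, smul_apply,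
    SchwartzMap.smulLeftCLM_apply_apply h, norm_smul, norm_smul]
  simp only [norm_mul, Complex.norm_I, mul_one, Complex.norm_ofNat, Complex.norm_real,
    Real.norm_eq_abs]
  rw [mul_pow, mul_pow, mul_pow, sq_abs, sq_abs]
  ring

theorem sum_norm_fourier_lineDerivOp {n : ℕ} (g : 𝓢(Rn n, ℂ)) (ξ : Rn n) :
    ∑ j, ‖𝓕 (∂_{EuclideanSpace.basisFun (Fin n) ℝ j} g) ξ‖ ^ 2
      = (2 * Real.pi * ‖ξ‖) ^ 2 * ‖𝓕 g ξ‖ ^ 2 := by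
  simp_rw [norm_fourier_lineDerivOp]
  rw [← Finset.sum_mul, ← Finset.mul_sum,
    (EuclideanSpace.basisFun (Fin n) ℝ).sum_sq_inner_left ξ]
  ring

theorem integrable_norm_mul_fourier_sq {n : ℕ} (g : 𝓢(Rn n, ℂ)) :
    Integrable (fun ξ => (2 * Real.pi * ‖ξ‖) ^ 2 * ‖𝓕 g ξ‖ ^ 2) (volume : Measure (Rn n)) := by
  simp_rw [← sum_norm_fourier_lineDerivOp]
  exact integrable_finsetSum _ fun j _ => integrable_norm_sq_schwartz _

/-- Plancherel applied to each partial derivative, whose transform has modulus `2π |ξ_j|` times that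
of `φ`. -/
theorem integral_norm_gradient_sq {n : ℕ} (φ : 𝓢(Rn n, ℝ)) :
    ∫ x, ‖gradient φ x‖ ^ 2
      = ∫ ξ, (2 * Real.pi * ‖ξ‖) ^ 2 * ‖𝓕 (schwartzOfReal n φ) ξ‖ ^ 2 := by
  simp_rw [norm_gradient_sq, ← sum_norm_fourier_lineDerivOp]
  rw [integral_finsetSum _ fun j _ => integrable_norm_sq_schwartz _,
    integral_finsetSum _ fun j _ => integrable_norm_sq_schwartz _]
  refine Finset.sum_congr rfl fun j _ => ?_
  rw [SchwartzMap.integral_norm_sq_fourier]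

/-- The homogeneous duality estimate `|∫ φ g| ≤ ‖(-Δ)^{-1/2} g‖ ‖∇φ‖`. -/
theorem norm_integral_mul_le {n : ℕ} (hn : 3 ≤ n) (φ : 𝓢(Rn n, ℝ)) (g : 𝓢(Rn n, ℂ))
    (hg : Integrable (fun ξ => ‖𝓕 g ξ‖ ^ 2 / (2 * Real.pi * ‖ξ‖) ^ 2) (volume : Measure (Rn n))) :
    ‖∫ x, (φ x : ℂ) * g x‖
      ≤ √(∫ ξ, ‖𝓕 g ξ‖ ^ 2 / (2 * Real.pi * ‖ξ‖) ^ 2) * √(∫ x, ‖gradient φ x‖ ^ 2) := by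
  have : Nonempty (Fin n) := ⟨⟨0, by omega⟩⟩
  have e : ∫ x, (φ x : ℂ) * g x = ∫ ξ, inner ℂ (𝓕 (schwartzOfReal n φ) ξ) (𝓕 g ξ) := by
    rw [SchwartzMap.integral_inner_fourier_fourier]
    refine integral_congr_ae (Filter.Eventually.of_forall fun x => ?_)
    simp [schwartzOfReal_apply, mul_comm]
  have hF := integrable_norm_mul_fourier_sq (schwartzOfReal n φ)
  -- The weight `2π |ξ|` is moved from one factor to the other before Cauchy–Schwarz; only the null
  -- set `ξ = 0` is lost.
  set A : Rn n → ℝ := fun ξ => ‖𝓕 g ξ‖ / (2 * Real.pi * ‖ξ‖)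
  set B : Rn n → ℝ := fun ξ => (2 * Real.pi * ‖ξ‖) * ‖𝓕 (schwartzOfReal n φ) ξ‖
  have hcg : Continuous fun ξ => 𝓕 g ξ := (𝓕 g).continuous
  have hcφ : Continuous fun ξ => 𝓕 (schwartzOfReal n φ) ξ := (𝓕 (schwartzOfReal n φ)).continuous
  have hA2 : ∀ ξ, A ξ ^ 2 = ‖𝓕 g ξ‖ ^ 2 / (2 * Real.pi * ‖ξ‖) ^ 2 := fun ξ => div_pow _ _ _
  have hB2 : ∀ ξ, B ξ ^ 2 = (2 * Real.pi * ‖ξ‖) ^ 2 * ‖𝓕 (schwartzOfReal n φ) ξ‖ ^ 2 :=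
    fun ξ => mul_pow _ _ _
  have hAm : AEStronglyMeasurable A (volume : Measure (Rn n)) := by
    have : Measurable A := hcg.measurable.norm.div (by fun_prop)
    exact this.aestronglyMeasurable
  have hBm : AEStronglyMeasurable B (volume : Measure (Rn n)) :=
    Continuous.aestronglyMeasurable (by fun_prop)
  have hA : MemLp A 2 (volume : Measure (Rn n)) :=
    (memLp_two_iff_integrable_sq hAm).2 (by simpa only [hA2] using hg)
  have hB : MemLp B 2 (volume : Measure (Rn n)) :=
    (memLp_two_iff_integrable_sq hBm).2 (by simpa only [hB2] using hF)
  rw [e, integral_norm_gradient_sq]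
  calc ‖∫ ξ, inner ℂ (𝓕 (schwartzOfReal n φ) ξ) (𝓕 g ξ)‖
      ≤ ∫ ξ, A ξ * B ξ := by
        refine norm_integral_le_of_norm_le (hA.integrable_mul hB) ?_
        have hne : ∀ᵐ ξ : Rn n, ξ ≠ 0 := by
          simp [ae_iff]
        filter_upwards [hne] with ξ hξ
        have h0 : 2 * Real.pi * ‖ξ‖ ≠ 0 :=
          mul_ne_zero Real.two_pi_pos.ne' (norm_ne_zero_iff.2 hξ)
        refine (norm_inner_le_norm _ _).trans_eq ?_
        simp only [A, B]
        field_simp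
    _ ≤ _ := by
        have h := integral_mul_le_Lp_mul_Lq_of_nonneg (μ := (volume : Measure (Rn n)))
          (Real.HolderConjugate.two_two) (f := A) (g := B)
          (Filter.Eventually.of_forall fun ξ => by positivity)
          (Filter.Eventually.of_forall fun ξ => by positivity) (by simpa using hA) (by simpa using hB)
        simp_rw [Real.sqrt_eq_rpow]
        simpa only [Real.rpow_two, hA2, hB2] using h

/-! ### The resolvent of the Laplacian on Schwartz functions. -/

theorem hasTemperateGrowth_resolvent {n : ℕ} {ε : ℝ} (hε : 0 < ε) :
    (fun ξ : Rn n => (ε + (2 * Real.pi * ‖ξ‖) ^ 2)⁻¹).HasTemperateGrowth := by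
  -- The symbol is `ε⁻¹ (1 + |x|²)⁻¹` evaluated at `x = (2π / √ε) ξ`.
  have h := (Function.hasTemperateGrowth_one_add_norm_sq_rpow (Rn n) (-1)).comp
    ((((2 * Real.pi / √ε) • ContinuousLinearMap.id ℝ (Rn n)) : Rn n →L[ℝ] Rn n).hasTemperateGrowth)
  have h2 := (Function.HasTemperateGrowth.const (E := Rn n) (ε⁻¹ : ℝ)).mul h
  refine (congrArg Function.HasTemperateGrowth (funext fun ξ => ?_)).mp h2
  have h3 : √ε ^ 2 = ε := Real.sq_sqrt hε.le
  simp only [Pi.mul_apply, Function.comp, Real.rpow_neg_one, smul_apply,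
    ContinuousLinearMap.id_apply, norm_smul, ← mul_inv]
  rw [mul_pow, Real.norm_eq_abs, sq_abs, div_pow, h3]
  congr 1
  field_simp

/-- For `ε > 0` the symbol is smooth at the origin, so `(ε - Δ)⁻¹` preserves Schwartz functions,
unlike `(-Δ)⁻¹`. -/
theorem exists_resolvent {n : ℕ} {ε : ℝ} (hε : 0 < ε) (g : 𝓢(Rn n, ℂ)) :
    ∃ χ : 𝓢(Rn n, ℂ), ε • χ - Δ χ = g ∧
      ∀ ξ, 𝓕 χ ξ = (ε + (2 * Real.pi * ‖ξ‖) ^ 2)⁻¹ • 𝓕 g ξ := by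
  have hm := hasTemperateGrowth_resolvent (n := n) hε
  refine ⟨SchwartzMap.fourierMultiplierCLM ℂ
    (fun ξ : Rn n => (ε + (2 * Real.pi * ‖ξ‖) ^ 2)⁻¹) g, ?_, ?_⟩
  · have h2 : (fun ξ : Rn n => ‖ξ‖ ^ 2).HasTemperateGrowth := by fun_prop
    rw [SchwartzMap.laplacian_eq_fourierMultiplierCLM]
    have e : (‖·‖ ^ 2 : Rn n → ℝ) = fun ξ : Rn n => ‖ξ‖ ^ 2 := rfl
    rw [e, SchwartzMap.fourierMultiplierCLM_fourierMultiplierCLM_apply h2 hm]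
    rw [SchwartzMap.fourierMultiplierCLM_apply, SchwartzMap.fourierMultiplierCLM_apply, neg_smul,
      sub_neg_eq_add, ← FourierTransform.fourierInv_smul, ← FourierTransform.fourierInv_smul,
      ← FourierTransform.fourierInv_add]
    refine Eq.trans (congrArg _ ?_) (FourierTransform.fourierInv_fourier_eq (F := 𝓢(Rn n, ℂ)) g)
    ext ξ
    have hpos : ε + (2 * Real.pi * ‖ξ‖) ^ 2 ≠ 0 := by positivity
    rw [add_apply, smul_apply, smul_apply, SchwartzMap.smulLeftCLM_apply_apply hm,
      SchwartzMap.smulLeftCLM_apply_apply (h2.mul hm), smul_smul, smul_smul, ← add_smul]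
    simp only [Pi.mul_apply]
    rw [show ε * (ε + (2 * Real.pi * ‖ξ‖) ^ 2)⁻¹
      + (2 * Real.pi) ^ 2 * (‖ξ‖ ^ 2 * (ε + (2 * Real.pi * ‖ξ‖) ^ 2)⁻¹) = 1 by field_simp, one_smul]
  · intro ξ
    rw [SchwartzMap.fourierMultiplierCLM_apply, FourierTransform.fourier_fourierInv_eq,
      SchwartzMap.smulLeftCLM_apply_apply hm]

/-! ### The constant `κ` -/

/-- The form function `σ₂` as a real Schwartz function. -/
def IsFormFunction₂.schwartz {n : ℕ} {σ₂ : Rn n → ℝ} (h : IsFormFunction₂ σ₂) : 𝓢(Rn n, ℝ) :=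
  h.compactSupport.toSchwartzMap h.smooth

theorem IsFormFunction₂.schwartz_apply {n : ℕ} {σ₂ : Rn n → ℝ} (h : IsFormFunction₂ σ₂) (z : Rn n) :
    h.schwartz z = σ₂ z := rfl

theorem IsFormFunction₂.fourierHat_smul {n : ℕ} {σ₂ : Rn n → ℝ} (h : IsFormFunction₂ σ₂)
    (η : Rn n) : fourierHat σ₂ ((2 * Real.pi) • η) = 𝓕 (schwartzOfReal n h.schwartz) η := by
  rw [SchwartzMap.fourier_coe, Real.fourier_eq']
  unfold fourierHat
  refine integral_congr_ae (Filter.Eventually.of_forall fun z => ?_)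
  simp only [schwartzOfReal_apply, h.schwartz_apply, smul_eq_mul]
  congr 2
  rw [real_inner_smul_left, real_inner_comm]
  push_cast
  ring

theorem IsFormFunction₂.hat_div_smul {n : ℕ} {σ₂ : Rn n → ℝ} (h : IsFormFunction₂ σ₂) (η : Rn n) :
    ‖𝓕 (schwartzOfReal n h.schwartz) η‖ ^ 2 / (2 * Real.pi * ‖η‖) ^ 2
      = ‖fourierHat σ₂ ((2 * Real.pi) • η)‖ ^ 2 / ‖(2 * Real.pi) • η‖ ^ 2 := by
  rw [h.fourierHat_smul, norm_smul, Real.norm_of_nonneg Real.two_pi_pos.le]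

theorem IsFormFunction₂.integrable_hat_div {n : ℕ} {σ₂ : Rn n → ℝ} (h : IsFormFunction₂ σ₂) :
    Integrable (fun ξ => ‖𝓕 (schwartzOfReal n h.schwartz) ξ‖ ^ 2 / (2 * Real.pi * ‖ξ‖) ^ 2)
      (volume : Measure (Rn n)) := by
  simp_rw [h.hat_div_smul]
  exact h.integrable.comp_smul Real.two_pi_pos.ne'

/-- The substitution `ξ = 2π η` between the two normalizations of the Fourier transform has Jacobian
`(2π)^n`, the factor in the definition of `kappa`. -/
theorem IsFormFunction₂.integral_hat_div {n : ℕ} {σ₂ : Rn n → ℝ} (h : IsFormFunction₂ σ₂) :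
    ∫ ξ, ‖𝓕 (schwartzOfReal n h.schwartz) ξ‖ ^ 2 / (2 * Real.pi * ‖ξ‖) ^ 2 = kappa σ₂ := by
  simp_rw [h.hat_div_smul]
  rw [Measure.integral_comp_smul volume (fun ξ => ‖fourierHat σ₂ ξ‖ ^ 2 / ‖ξ‖ ^ 2), kappa,
    finrank_euclideanSpace_fin, abs_of_pos (by positivity), smul_eq_mul]
  field_simp

theorem norm_sq_Lp_two {n : ℕ} {F : Type*} [NormedAddCommGroup F] [InnerProductSpace ℝ F]
    (f : Lp F 2 (volume : Measure (Rn n))) : ‖f‖ ^ 2 = ∫ z, ‖f z‖ ^ 2 := by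
  rw [← real_inner_self_eq_norm_sq, MeasureTheory.L2.inner_def]
  simp_rw [real_inner_self_eq_norm_sq]

theorem HDot.norm_gradCLM_of_test {n : ℕ} {f : HDot n} {φ : Rn n → ℝ}
    (h : HDot.grad f =ᵐ[volume] gradient φ) :
    ‖HDot.gradCLM n f‖ = √(∫ z, ‖gradient φ z‖ ^ 2) := by
  rw [← Real.sqrt_sq (norm_nonneg (HDot.gradCLM n f)), norm_sq_Lp_two]
  congr 1
  refine integral_congr_ae ?_
  filter_upwards [h] with z hz
  rw [HDot.gradCLM_apply, hz]

/-- The functional `f ↦ ∫ σ₂ f` on `Ḣ¹`. -/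
def IsFormFunction₂.functional {n : ℕ} {σ₂ : Rn n → ℝ} (h : IsFormFunction₂ σ₂) : HDot n →L[ℝ] ℝ :=
  HDot.pair h.smooth.continuous h.compactSupport

/-- `√κ` is the norm of `(-Δ)^{-1/2} σ₂` in `L²`. The homogeneous duality estimate for test
functions passes to `Ḣ¹` by density. -/
theorem IsFormFunction₂.abs_functional_le {n : ℕ} (hn : 3 ≤ n) {σ₂ : Rn n → ℝ}
    (h : IsFormFunction₂ σ₂) (f : HDot n) :
    |h.functional f| ≤ √(kappa σ₂) * ‖HDot.gradCLM n f‖ := by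
  refine HDot.induction (P := fun f => |h.functional f| ≤ √(kappa σ₂) * ‖HDot.gradCLM n f‖)
    (isClosed_le h.functional.continuous.abs
      (continuous_const.mul (HDot.gradCLM n).continuous.norm)) ?_ f
  intro φ f h1 h2 h3 h4
  rw [HDot.norm_gradCLM_of_test h4, ← h.integral_hat_div]
  refine Eq.trans_le ?_ (norm_integral_mul_le hn (h2.toSchwartzMap h1)
    (schwartzOfReal n h.schwartz) h.integrable_hat_div)
  rw [IsFormFunction₂.functional, HDot.pair_apply]
  have e : ∫ z, HDot.toFun f z * σ₂ z = ∫ z, φ z * σ₂ z := by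
    refine integral_congr_ae ?_
    filter_upwards [h3] with z hz
    rw [hz]
  have e2 : ∫ x, ((h2.toSchwartzMap h1 x : ℝ) : ℂ) * schwartzOfReal n h.schwartz x
      = ((∫ z, φ z * σ₂ z : ℝ) : ℂ) := by
    refine Eq.trans ?_ integral_ofReal
    refine integral_congr_ae (Filter.Eventually.of_forall fun x => ?_)
    simp [schwartzOfReal_apply, h.schwartz_apply]
  rw [e, e2, Complex.norm_real, Real.norm_eq_abs]

/-! ### Extending weak identities from test functions to Schwartz functions -/

theorem gradient_eventuallyEq {n : ℕ} {f g : Rn n → ℝ} {x : Rn n} (h : f =ᶠ[𝓝 x] g) :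
    gradient f x = gradient g x := by
  unfold gradient
  rw [h.fderiv_eq]

theorem memLp_gradient_schwartz {n : ℕ} (φ : 𝓢(Rn n, ℝ)) :
    MemLp (gradient φ) 2 (volume : Measure (Rn n)) := by
  have hc : Continuous (gradient φ) := continuous_gradient (φ.smooth ⊤)
  refine (memLp_norm_iff hc.aestronglyMeasurable).1 ?_
  refine (memLp_congr_ae (Filter.Eventually.of_forall fun z => ?_)).1
    ((SchwartzMap.fderivCLM ℝ (Rn n) ℝ φ).memLp 2 volume).norm
  simp [gradient]

/-- A weak first-order identity tested on `C_c^∞` extends to Schwartz functions. -/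
theorem integral_schwartz_eq_zero {n : ℕ} {a : Rn n → ℝ} {b : Rn n → Rn n}
    (ha : MemLp a 2 (volume : Measure (Rn n))) (hb : MemLp b 2 (volume : Measure (Rn n)))
    (h : ∀ η : Rn n → ℝ, ContDiff ℝ ∞ η → HasCompactSupport η →
      ∫ z, (a z * η z + inner ℝ (b z) (gradient η z)) = 0) (φ : 𝓢(Rn n, ℝ)) :
    ∫ z, (a z * φ z + inner ℝ (b z) (gradient φ z)) = 0 := by
  -- The Schwartz function is cut off by `χ (z / (m + 1))`. The gradient falling on the cutoff is at
  -- most `C |φ|`, uniformly in `m`, which gives the dominating function.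
  let χ : ContDiffBump (0 : Rn n) := ⟨1, 2, one_pos, one_lt_two⟩
  let χm : ℕ → Rn n → ℝ := fun m z => χ (((m : ℝ) + 1)⁻¹ • z)
  have hχm : ∀ m, ContDiff ℝ ∞ (χm m) := fun m => χ.contDiff.comp (contDiff_const_smul _)
  have hχs : ∀ m, HasCompactSupport (χm m) := fun m =>
    χ.hasCompactSupport.comp_smul (inv_ne_zero (by positivity))
  obtain ⟨C, hC⟩ := (hasCompactSupport_gradient (n := n) χ.hasCompactSupport).exists_bound_of_continuous
    (continuous_gradient χ.contDiff)
  have hC0 : 0 ≤ C := (norm_nonneg _).trans (hC 0)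
  have hφd : ∀ z, DifferentiableAt ℝ φ z := fun z => φ.differentiableAt
  have hgrad : ∀ m z, gradient (fun y => χm m y * φ y) z
      = χm m z • gradient φ z + (φ z * ((m : ℝ) + 1)⁻¹) • gradient χ (((m : ℝ) + 1)⁻¹ • z) := by
    intro m z
    refine ext_inner_right ℝ fun y => ?_
    rw [inner_gradient, inner_add_left, real_inner_smul_left, real_inner_smul_left, inner_gradient,
      inner_gradient]
    have hd : HasFDerivAt (χm m) (((m : ℝ) + 1)⁻¹ • fderiv ℝ χ (((m : ℝ) + 1)⁻¹ • z)) z := by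
      have h1 : HasFDerivAt (χ : Rn n → ℝ) (fderiv ℝ χ (((m : ℝ) + 1)⁻¹ • z))
          (((m : ℝ) + 1)⁻¹ • z) :=
        ((χ.contDiff (n := ⊤)).differentiable (by simp)).differentiableAt.hasFDerivAt
      have h2 := h1.comp z ((hasFDerivAt_id z).const_smul (((m : ℝ) + 1)⁻¹))
      refine h2.congr_fderiv ?_
      ext y
      simp
    have hp : HasFDerivAt (fun y => χm m y * φ y) _ z := hd.mul (hφd z).hasFDerivAt
    rw [hp.fderiv]
    simp
    ring
  have hlim : Filter.Tendsto (fun m : ℕ => ∫ z, (a z * (χm m z * φ z)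
      + inner ℝ (b z) (gradient (fun y => χm m y * φ y) z))) Filter.atTop
      (𝓝 (∫ z, (a z * φ z + inner ℝ (b z) (gradient φ z)))) := by
    refine tendsto_integral_of_dominated_convergence
      (fun z => ‖a z‖ * ‖φ z‖ + ‖b z‖ * (‖gradient φ z‖ + C * ‖φ z‖)) ?_ ?_ ?_ ?_
    · intro m
      have hs : ContDiff ℝ ∞ (fun y => χm m y * φ y) := (hχm m).mul (φ.smooth ⊤)
      exact (ha.1.mul hs.continuous.aestronglyMeasurable).add
        (hb.1.inner (continuous_gradient hs).aestronglyMeasurable)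
    · have h1 : MemLp (fun z => ‖φ z‖) 2 (volume : Measure (Rn n)) := (φ.memLp 2 volume).norm
      have h2 : MemLp (fun z => ‖gradient φ z‖) 2 (volume : Measure (Rn n)) :=
        (memLp_gradient_schwartz φ).norm
      exact (ha.norm.integrable_mul h1).add
        (hb.norm.integrable_mul (h2.add (h1.const_mul C)))
    · intro m
      refine Filter.Eventually.of_forall fun z => ?_
      rw [hgrad]
      have hm1 : ‖χm m z‖ ≤ 1 := by
        rw [Real.norm_of_nonneg χ.nonneg]; exact χ.le_one
      have hm2 : ‖((m : ℝ) + 1)⁻¹‖ ≤ 1 := by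
        rw [Real.norm_of_nonneg (by positivity)]
        exact inv_le_one_of_one_le₀ (by linarith [(Nat.cast_nonneg m : (0 : ℝ) ≤ m)])
      refine (norm_add_le _ _).trans (add_le_add ?_ ((norm_inner_le_norm _ _).trans
        (mul_le_mul_of_nonneg_left ((norm_add_le _ _).trans (add_le_add ?_ ?_)) (norm_nonneg _))))
      · rw [norm_mul, norm_mul]
        exact mul_le_mul_of_nonneg_left (mul_le_of_le_one_left (norm_nonneg _) hm1) (norm_nonneg _)
      · rw [norm_smul]
        exact mul_le_of_le_one_left (norm_nonneg _) hm1
      · rw [norm_smul, norm_mul, mul_comm C]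
        exact mul_le_mul (mul_le_of_le_one_right (norm_nonneg _) hm2) (hC _) (norm_nonneg _)
          (norm_nonneg _)
    -- The cutoff equals `1` near `z` as soon as `m + 1 > ‖z‖`, so the integrand is eventually
    -- constant in `m`.
    · refine Filter.Eventually.of_forall fun z => ?_
      refine tendsto_const_nhds.congr' ?_
      obtain ⟨N, hN⟩ := exists_nat_gt ‖z‖
      filter_upwards [Filter.eventually_ge_atTop N] with m hm
      have hz : ‖z‖ < (m : ℝ) + 1 := by
        have : (N : ℝ) ≤ m := by exact_mod_cast hm
        linarith
      have hev : (fun y => χm m y * φ y) =ᶠ[𝓝 z] φ := by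
        have hball : Metric.ball (0 : Rn n) ((m : ℝ) + 1) ∈ 𝓝 z :=
          Metric.isOpen_ball.mem_nhds (by simpa using hz)
        filter_upwards [hball] with y hy
        have : χm m y = 1 := by
          refine χ.one_of_mem_closedBall ?_
          rw [mem_closedBall_zero_iff, norm_smul, Real.norm_of_nonneg (by positivity)]
          rw [mem_ball_zero_iff] at hy
          change ((m : ℝ) + 1)⁻¹ * ‖y‖ ≤ 1
          rw [inv_mul_le_iff₀ (by positivity)]
          linarith
        rw [this, one_mul]
      rw [gradient_eventuallyEq hev, hev.eq_of_nhds]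
  refine tendsto_nhds_unique hlim ?_
  have hz : ∀ m : ℕ, ∫ z, (a z * (χm m z * φ z)
      + inner ℝ (b z) (gradient (fun y => χm m y * φ y) z)) = 0 := fun m =>
    h _ ((hχm m).mul (φ.smooth ⊤)) (hχs m).mul_right
  simp_rw [hz]
  exact tendsto_const_nhds

/-! ### Low frequencies of the form function in dimension at least five -/

/-- This is where the dimension matters: `|ξ|⁻⁴` is integrable near the origin since `n > 4`. Away
from the origin the weight is at most `1`. -/
theorem integrable_norm_sq_div_pow_four {n : ℕ} (hn : 5 ≤ n) (g : 𝓢(Rn n, ℂ)) :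
    Integrable (fun ξ => ‖g ξ‖ ^ 2 / (2 * Real.pi * ‖ξ‖) ^ 4) (volume : Measure (Rn n)) := by
  have hm : AEStronglyMeasurable (fun ξ => ‖g ξ‖ ^ 2 / (2 * Real.pi * ‖ξ‖) ^ 4)
      (volume : Measure (Rn n)) := by
    have : Measurable (fun ξ => ‖g ξ‖ ^ 2 / (2 * Real.pi * ‖ξ‖) ^ 4) :=
      (g.continuous.measurable.norm.pow_const 2).div (by fun_prop)
    exact this.aestronglyMeasurable
  have h2pi : 1 ≤ 2 * Real.pi := by linarith [Real.two_le_pi]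
  obtain ⟨C, hC0, hC⟩ : ∃ C, 0 ≤ C ∧ ∀ ξ, ‖g ξ‖ ≤ C :=
    ⟨_, apply_nonneg _ _, SchwartzMap.norm_le_seminorm ℝ g⟩
  have hnear : IntegrableOn (fun ξ => ‖g ξ‖ ^ 2 / (2 * Real.pi * ‖ξ‖) ^ 4)
      (Metric.ball (0 : Rn n) 1) volume := by
    refine integrableOn_ball_of_norm_le_rpow (C := C ^ 2) (α := 4) ?_ ?_ ?_ hm
    · rw [finrank_euclideanSpace_fin]; omega
    · rw [finrank_euclideanSpace_fin]
      have : (5 : ℝ) ≤ n := by exact_mod_cast hn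
      linarith
    · refine Filter.Eventually.of_forall fun ξ => ?_
      rw [Real.norm_of_nonneg (by positivity), Real.rpow_neg (norm_nonneg _), ← div_eq_mul_inv,
        show ‖ξ‖ ^ (4 : ℝ) = ‖ξ‖ ^ 4 by norm_cast]
      rcases eq_or_ne ξ 0 with rfl | hξ
      · simp
      have h0 : 0 < ‖ξ‖ := norm_pos_iff.2 hξ
      refine div_le_div₀ (by positivity) (pow_le_pow_left₀ (norm_nonneg _) (hC ξ) 2) (by positivity) ?_
      exact pow_le_pow_left₀ h0.le (le_mul_of_one_le_left h0.le h2pi) 4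
  have hfar : IntegrableOn (fun ξ => ‖g ξ‖ ^ 2 / (2 * Real.pi * ‖ξ‖) ^ 4)
      (Metric.ball (0 : Rn n) 1)ᶜ volume := by
    refine Integrable.mono (integrable_norm_sq_schwartz g).integrableOn hm.restrict ?_
    refine (ae_restrict_iff' Metric.isOpen_ball.measurableSet.compl).2
      (Filter.Eventually.of_forall fun ξ hξ => ?_)
    have h1 : 1 ≤ ‖ξ‖ := by simpa using hξ
    rw [Real.norm_of_nonneg (by positivity), Real.norm_of_nonneg (by positivity)]
    exact div_le_self (by positivity) (one_le_pow₀ (h1.trans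
      (le_mul_of_one_le_left (norm_nonneg _) h2pi)))
  rw [← integrableOn_univ, ← union_compl_self (Metric.ball (0 : Rn n) 1)]
  exact hnear.union hfar

/-! ### Resolvent approximation of `(-Δ)⁻¹ σ₂`. -/

theorem inner_gradient_gradient {n : ℕ} (φ θ : 𝓢(Rn n, ℝ)) (x : Rn n) :
    inner ℝ (gradient φ x) (gradient θ x)
      = ∑ j, (∂_{EuclideanSpace.basisFun (Fin n) ℝ j} φ) x
        * (∂_{EuclideanSpace.basisFun (Fin n) ℝ j} θ) x := by
  rw [← (EuclideanSpace.basisFun (Fin n) ℝ).sum_inner_mul_inner]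
  refine Finset.sum_congr rfl fun j _ => ?_
  rw [inner_gradient, inner_gradient_right, SchwartzMap.lineDerivOp_apply_eq_fderiv,
    SchwartzMap.lineDerivOp_apply_eq_fderiv]

theorem integrable_schwartz_mul {n : ℕ} (φ θ : 𝓢(Rn n, ℝ)) :
    Integrable (fun x => φ x * θ x) (volume : Measure (Rn n)) :=
  (φ.memLp 2 volume).integrable_mul (θ.memLp 2 volume)

theorem integral_inner_gradient_gradient {n : ℕ} (φ θ : 𝓢(Rn n, ℝ)) :
    ∫ x, inner ℝ (gradient φ x) (gradient θ x) = - ∫ x, (Δ φ) x * θ x := by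
  simp_rw [inner_gradient_gradient]
  rw [integral_finsetSum _ fun j _ => integrable_schwartz_mul _ _,
    SchwartzMap.laplacian_eq_sum (EuclideanSpace.basisFun (Fin n) ℝ)]
  simp_rw [SchwartzMap.integral_mul_lineDerivOp_right_eq_neg_left, sum_apply, Finset.sum_mul]
  rw [integral_finsetSum _ fun j _ => integrable_schwartz_mul _ _, Finset.sum_neg_distrib]

/-- A real Schwartz solution of the resolvent equation. -/
theorem exists_resolvent_real {n : ℕ} {ε : ℝ} (hε : 0 < ε) (s : 𝓢(Rn n, ℝ)) :
    ∃ χ : 𝓢(Rn n, ℂ), ε • schwartzRe n χ - Δ (schwartzRe n χ) = s ∧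
      ∀ ξ, 𝓕 χ ξ = (ε + (2 * Real.pi * ‖ξ‖) ^ 2)⁻¹ • 𝓕 (schwartzOfReal n s) ξ := by
  obtain ⟨χ, h1, h2⟩ := exists_resolvent hε (schwartzOfReal n s)
  refine ⟨χ, ?_, h2⟩
  have h3 := congrArg (schwartzRe n) h1
  rw [map_sub, map_smul] at h3
  have h4 : schwartzRe n (Δ χ) = Δ (schwartzRe n χ) := (laplacian_postcompCLM _ χ).symm
  rw [h4] at h3
  rw [h3]
  ext x
  rw [schwartzRe_apply, schwartzOfReal_apply, Complex.ofReal_re]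

/-- Equivalent to `ε A ≤ (ε + A)²`. It will give a gain of `ε` in the homogeneous negative norm of
`ε χ`. -/
theorem resolvent_sq_mul_le {ε A : ℝ} (hε : 0 < ε) (hA : 0 ≤ A) :
    ε ^ 2 * ((ε + A)⁻¹ ^ 2 * A) ≤ ε := by
  rw [inv_pow, inv_mul_eq_div, mul_div_assoc', div_le_iff₀ (by positivity)]
  have h1 : 0 ≤ ε ^ 2 * A := by positivity
  have h2 : 0 ≤ ε * A ^ 2 := by positivity
  have h3 : 0 ≤ ε ^ 3 := by positivity
  nlinarith

theorem resolvent_hat_le {n : ℕ} {ε : ℝ} (hε : 0 < ε) (s χ : 𝓢(Rn n, ℂ))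
    (h2 : ∀ ξ, 𝓕 χ ξ = (ε + (2 * Real.pi * ‖ξ‖) ^ 2)⁻¹ • 𝓕 s ξ) (ξ : Rn n) :
    ‖𝓕 (ε • χ) ξ‖ ^ 2 / (2 * Real.pi * ‖ξ‖) ^ 2
      ≤ ε * (‖𝓕 s ξ‖ ^ 2 / (2 * Real.pi * ‖ξ‖) ^ 4) := by
  rw [FourierTransform.fourier_smul, smul_apply, h2, norm_smul, norm_smul,
    Real.norm_of_nonneg hε.le, Real.norm_of_nonneg (by positivity)]
  rcases eq_or_ne ξ 0 with rfl | hξ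
  · simp
  have h0 := norm_pos_iff.2 hξ
  have hA0 : 0 < (2 * Real.pi * ‖ξ‖) ^ 2 := by positivity
  have hA4 : (2 * Real.pi * ‖ξ‖) ^ 4 = ((2 * Real.pi * ‖ξ‖) ^ 2) ^ 2 := by ring
  rw [hA4]
  generalize (2 * Real.pi * ‖ξ‖) ^ 2 = A at hA0
  have h := mul_le_mul_of_nonneg_right (resolvent_sq_mul_le hε hA0.le)
    (by positivity : 0 ≤ ‖𝓕 s ξ‖ ^ 2 / A ^ 2)
  refine Eq.trans_le ?_ h
  field_simp

theorem integrable_resolvent_hat_div {n : ℕ} (hn : 5 ≤ n) {ε : ℝ} (hε : 0 < ε) {s χ : 𝓢(Rn n, ℂ)}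
    (h2 : ∀ ξ, 𝓕 χ ξ = (ε + (2 * Real.pi * ‖ξ‖) ^ 2)⁻¹ • 𝓕 s ξ) :
    Integrable (fun ξ => ‖𝓕 (ε • χ) ξ‖ ^ 2 / (2 * Real.pi * ‖ξ‖) ^ 2) (volume : Measure (Rn n)) ∧
    ∫ ξ, ‖𝓕 (ε • χ) ξ‖ ^ 2 / (2 * Real.pi * ‖ξ‖) ^ 2
      ≤ ε * ∫ ξ, ‖𝓕 s ξ‖ ^ 2 / (2 * Real.pi * ‖ξ‖) ^ 4 := by
  have hK := integrable_norm_sq_div_pow_four hn (𝓕 s)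
  have hint : Integrable (fun ξ => ‖𝓕 (ε • χ) ξ‖ ^ 2 / (2 * Real.pi * ‖ξ‖) ^ 2)
      (volume : Measure (Rn n)) := by
    refine (hK.const_mul ε).mono ?_ (Filter.Eventually.of_forall fun ξ => ?_)
    · have : Measurable (fun ξ => ‖𝓕 (ε • χ) ξ‖ ^ 2 / (2 * Real.pi * ‖ξ‖) ^ 2) :=
        ((𝓕 (ε • χ)).continuous.measurable.norm.pow_const 2).div (by fun_prop)
      exact this.aestronglyMeasurable
    · rw [Real.norm_of_nonneg (by positivity), Real.norm_of_nonneg (by positivity)]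
      exact resolvent_hat_le hε s χ h2 ξ
  refine ⟨hint, ?_⟩
  rw [← integral_const_mul]
  exact integral_mono hint (hK.const_mul ε) (resolvent_hat_le hε s χ h2)

/-- From `(ε + A)⁻² ≤ A⁻²` with `A = (2π |ξ|)²`: the bound is uniform in `ε` and equals the `L²`
norm of `(-Δ)⁻¹ s`. -/
theorem norm_toLp_schwartzRe_le {n : ℕ} (hn : 5 ≤ n) {ε : ℝ} (hε : 0 < ε) {s χ : 𝓢(Rn n, ℂ)}
    (h2 : ∀ ξ, 𝓕 χ ξ = (ε + (2 * Real.pi * ‖ξ‖) ^ 2)⁻¹ • 𝓕 s ξ) :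
    ‖(schwartzRe n χ).toLp 2 volume‖ ≤ √(∫ ξ, ‖𝓕 s ξ‖ ^ 2 / (2 * Real.pi * ‖ξ‖) ^ 4) := by
  refine Real.le_sqrt_of_sq_le ?_
  rw [norm_sq_Lp_two]
  calc ∫ z, ‖((schwartzRe n χ).toLp 2 volume) z‖ ^ 2 = ∫ z, ‖schwartzRe n χ z‖ ^ 2 := by
        refine integral_congr_ae ?_
        filter_upwards [(schwartzRe n χ).coeFn_toLp 2 volume] with z hz
        rw [hz]
    _ ≤ ∫ z, ‖χ z‖ ^ 2 := by
        refine integral_mono (integrable_norm_sq_schwartz _) (integrable_norm_sq_schwartz χ)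
          fun z => ?_
        exact pow_le_pow_left₀ (norm_nonneg _) (Complex.abs_re_le_norm _) 2
    _ = ∫ ξ, ‖𝓕 χ ξ‖ ^ 2 := (SchwartzMap.integral_norm_sq_fourier χ).symm
    _ ≤ _ := by
        have : Nonempty (Fin n) := ⟨⟨0, by omega⟩⟩
        have hne : ∀ᵐ ξ : Rn n, ξ ≠ 0 := by simp [ae_iff]
        refine integral_mono_ae (integrable_norm_sq_schwartz (𝓕 χ))
          (integrable_norm_sq_div_pow_four hn _) ?_
        filter_upwards [hne] with ξ hξ
        have h0 := norm_pos_iff.2 hξ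
        have hA4 : (2 * Real.pi * ‖ξ‖) ^ 4 = ((2 * Real.pi * ‖ξ‖) ^ 2) ^ 2 := by ring
        rw [h2, norm_smul, Real.norm_of_nonneg (by positivity), mul_pow, inv_pow, inv_mul_eq_div,
          hA4]
        refine div_le_div_of_nonneg_left (by positivity) (by positivity) ?_
        exact pow_le_pow_left₀ (by positivity) (by linarith) 2

/-- The error of the approximate solution of `-Δ χ = s` is `-ε χ`, and its negative Sobolev norm is
`O(√ε)`; the duality estimate turns this into a bound against `‖∇θ‖`. -/
theorem abs_integral_inner_gradient_resolvent_sub_le {n : ℕ} (hn : 5 ≤ n) {s : 𝓢(Rn n, ℝ)} {ε : ℝ}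
    (hε : 0 < ε) {χ : 𝓢(Rn n, ℂ)} (h1 : ε • schwartzRe n χ - Δ (schwartzRe n χ) = s)
    (h2 : ∀ ξ, 𝓕 χ ξ = (ε + (2 * Real.pi * ‖ξ‖) ^ 2)⁻¹ • 𝓕 (schwartzOfReal n s) ξ)
    (θ : 𝓢(Rn n, ℝ)) :
    |(∫ z, inner ℝ (gradient (schwartzRe n χ) z) (gradient θ z)) - ∫ z, s z * θ z|
      ≤ √(ε * ∫ ξ, ‖𝓕 (schwartzOfReal n s) ξ‖ ^ 2 / (2 * Real.pi * ‖ξ‖) ^ 4)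
        * √(∫ z, ‖gradient θ z‖ ^ 2) := by
  have e3 : ∫ z, s z * θ z
      = ε * (∫ z, schwartzRe n χ z * θ z) - ∫ z, (Δ (schwartzRe n χ)) z * θ z := by
    rw [← h1, ← integral_const_mul, ← integral_sub ((integrable_schwartz_mul _ _).const_mul _)
      (integrable_schwartz_mul _ _)]
    refine integral_congr_ae (Filter.Eventually.of_forall fun z => ?_)
    simp only [sub_apply, smul_apply, smul_eq_mul]
    ring
  have e4 : ε * (∫ z, schwartzRe n χ z * θ z) = (∫ z, (θ z : ℂ) * (ε • χ) z).re := by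
    have hi : Integrable (fun z => (θ z : ℂ) * (ε • χ) z) (volume : Measure (Rn n)) :=
      ((schwartzOfReal n θ).memLp 2 volume).integrable_mul ((ε • χ).memLp 2 volume)
    rw [← integral_const_mul]
    refine Eq.trans ?_ (integral_re (𝕜 := ℂ) hi)
    refine integral_congr_ae (Filter.Eventually.of_forall fun z => ?_)
    simp only [schwartzRe_apply, smul_apply, Complex.real_smul, RCLike.re_to_complex,
      Complex.re_ofReal_mul]
    ring
  obtain ⟨hint, hle⟩ := integrable_resolvent_hat_div hn hε h2
  have hb := norm_integral_mul_le (by omega) θ (ε • χ) hint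
  rw [integral_inner_gradient_gradient, e3, show ∀ a b : ℝ, -a - (b - a) = -b by intros; ring, e4,
    abs_neg]
  refine (Complex.abs_re_le_norm _).trans (hb.trans ?_)
  exact mul_le_mul_of_nonneg_right (Real.sqrt_le_sqrt hle) (Real.sqrt_nonneg _)

theorem IsFormFunction₂.abs_inner_sub_functional_le {n : ℕ} {σ₂ : Rn n → ℝ}
    (h : IsFormFunction₂ σ₂) {D : ℝ} {φ : 𝓢(Rn n, ℝ)}
    (hD : ∀ θ : 𝓢(Rn n, ℝ), |(∫ z, inner ℝ (gradient φ z) (gradient θ z)) - ∫ z, h.schwartz z * θ z|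
      ≤ D * √(∫ z, ‖gradient θ z‖ ^ 2)) (f : HDot n) :
    |inner ℝ ((memLp_gradient_schwartz φ).toLp _) (HDot.gradCLM n f) - h.functional f|
      ≤ D * ‖HDot.gradCLM n f‖ := by
  revert f
  apply HDot.induction
  · exact isClosed_le (((HDot.gradPair _).continuous.sub h.functional.continuous).abs)
      (continuous_const.mul (HDot.gradCLM n).continuous.norm)
  intro θ f k1 k2 k3 k4
  have e1 : inner ℝ ((memLp_gradient_schwartz φ).toLp _) (HDot.gradCLM n f)
      = ∫ z, inner ℝ (gradient φ z) (gradient θ z) := by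
    rw [inner_toLp_left]
    refine integral_congr_ae ?_
    filter_upwards [k4] with z hz
    rw [HDot.gradCLM_apply, hz]
  have e2 : h.functional f = ∫ z, h.schwartz z * θ z := by
    rw [IsFormFunction₂.functional, HDot.pair_apply]
    refine integral_congr_ae ?_
    filter_upwards [k3] with z hz
    rw [hz, mul_comm, h.schwartz_apply]
  rw [e1, e2, HDot.norm_gradCLM_of_test k4]
  exact hD (k2.toSchwartzMap k1)

theorem integrable_inner_of_memLp {n : ℕ} {a b : Rn n → Rn n}
    (ha : MemLp a 2 (volume : Measure (Rn n))) (hb : MemLp b 2 (volume : Measure (Rn n))) :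
    Integrable (fun z => inner ℝ (a z) (b z)) (volume : Measure (Rn n)) :=
  (ha.norm.integrable_mul hb.norm).mono (ha.1.inner hb.1)
    (Filter.Eventually.of_forall fun z => by
      simpa using norm_inner_le_norm (𝕜 := ℝ) (a z) (b z))

/-- The resolvent solutions are Schwartz but need not have compact support, so the weak equation `-Δ
f = F` has to be extended to Schwartz test functions. -/
theorem inner_gradient_schwartz_eq {n : ℕ} {f : HDot n} {F : Lp ℝ 2 (volume : Measure (Rn n))}
    (hF : ∀ η : Rn n → ℝ, ContDiff ℝ ∞ η → HasCompactSupport η →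
          ∫ z, inner ℝ (HDot.grad f z) (gradient η z) = ∫ z, F z * η z) (φ : 𝓢(Rn n, ℝ)) :
    inner ℝ ((memLp_gradient_schwartz φ).toLp _) (HDot.gradCLM n f)
        = inner ℝ (φ.toLp 2 volume) F := by
  have hb : MemLp (HDot.grad f) 2 (volume : Measure (Rn n)) := Lp.memLp (HDot.gradCLM n f)
  have h0 := integral_schwartz_eq_zero (a := fun z => -F z) (b := HDot.grad f)
    (Lp.memLp F).neg hb (fun η k1 k2 => by
      have i1 : Integrable (fun z => -F z * η z) (volume : Measure (Rn n)) :=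
        (Lp.memLp F).neg.integrable_mul (memLp_test k1.continuous k2 2)
      rw [integral_add i1 (integrable_inner_of_memLp hb
        (memLp_test (continuous_gradient k1) (hasCompactSupport_gradient k2) 2)), hF η k1 k2]
      simp_rw [neg_mul]
      rw [integral_neg, neg_add_cancel]) φ
  have i1 : Integrable (fun z => -F z * φ z) (volume : Measure (Rn n)) :=
    (Lp.memLp F).neg.integrable_mul (φ.memLp 2 volume)
  rw [integral_add i1 (integrable_inner_of_memLp hb (memLp_gradient_schwartz φ))] at h0
  simp_rw [neg_mul] at h0
  rw [integral_neg] at h0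
  rw [inner_toLp_left, SchwartzMap.toLp, inner_toLp_left]
  have e1 : ∫ z, inner ℝ (gradient φ z) (HDot.gradCLM n f z)
      = ∫ z, inner ℝ (HDot.grad f z) (gradient φ z) :=
    integral_congr_ae (Filter.Eventually.of_forall fun z => real_inner_comm _ _)
  have e2 : ∫ z, inner ℝ (φ z) (F z) = ∫ z, F z * φ z :=
    integral_congr_ae (Filter.Eventually.of_forall fun z => rfl)
  rw [e1, e2]
  linarith

/-- Formally `∫ σ₂ f = ∫ (-Δ)⁻¹ σ₂ · F` when `-Δ f = F`. The resolvent replaces `(-Δ)⁻¹`: its `L²`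
norm stays below `√K`, and the error, proportional to `‖∇f‖`, vanishes as `ε → 0`. The resulting
constant does not involve `‖∇f‖`, which is what controls long times. -/
theorem IsFormFunction₂.exists_functional_le {n : ℕ} (hn : 5 ≤ n) {σ₂ : Rn n → ℝ}
    (h : IsFormFunction₂ σ₂) : ∃ C, 0 ≤ C ∧
      ∀ (f : HDot n) (F : Lp ℝ 2 (volume : Measure (Rn n))),
        (∀ η : Rn n → ℝ, ContDiff ℝ ∞ η → HasCompactSupport η →
          ∫ z, inner ℝ (HDot.grad f z) (gradient η z) = ∫ z, F z * η z) →
        |h.functional f| ≤ C * ‖F‖ := by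
  set K := ∫ ξ, ‖𝓕 (schwartzOfReal n h.schwartz) ξ‖ ^ 2 / (2 * Real.pi * ‖ξ‖) ^ 4
  refine ⟨√K, Real.sqrt_nonneg _, fun f F hF => ?_⟩
  have key : ∀ ε : ℝ, 0 < ε →
      |h.functional f| ≤ √K * ‖F‖ + √(ε * K) * ‖HDot.gradCLM n f‖ := by
    intro ε hε
    obtain ⟨χ, h1, h2⟩ := exists_resolvent_real hε h.schwartz
    have hb := h.abs_inner_sub_functional_le
      (abs_integral_inner_gradient_resolvent_sub_le hn hε h1 h2) f
    set φ := schwartzRe n χ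
    have e1 := inner_gradient_schwartz_eq hF φ
    have hφ : ‖φ.toLp 2 volume‖ ≤ √K := norm_toLp_schwartzRe_le hn hε h2
    have h3 := abs_le.1 hb
    have h4 : |inner ℝ (φ.toLp 2 volume) F| ≤ √K * ‖F‖ :=
      (abs_real_inner_le_norm _ _).trans (mul_le_mul_of_nonneg_right hφ (norm_nonneg _))
    rw [e1] at h3
    have h5 := abs_le.1 h4
    exact abs_le.2 ⟨by linarith, by linarith⟩
  have hlim : Filter.Tendsto (fun ε : ℝ => √K * ‖F‖ + √(ε * K) * ‖HDot.gradCLM n f‖) (𝓝[>] 0)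
      (𝓝 (√K * ‖F‖ + √(0 * K) * ‖HDot.gradCLM n f‖)) := by
    refine Filter.Tendsto.mono_left ?_ nhdsWithin_le_nhds
    exact Continuous.tendsto (by fun_prop) 0
  simp only [zero_mul, Real.sqrt_zero, add_zero] at hlim
  exact ge_of_tendsto hlim (Filter.eventually_of_mem self_mem_nhdsWithin fun ε hε => key ε hε)

/-! ### Density of test functions in `H¹(ℝ^n)` -/

theorem locallyIntegrable_of_memLp_two {n : ℕ} {F : Type*} [NormedAddCommGroup F] {a : Rn n → F}
    (ha : MemLp a 2 (volume : Measure (Rn n))) : LocallyIntegrable a (volume : Measure (Rn n)) :=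
  ha.locallyIntegrable (by norm_num)

/-- The partial derivative of a Schwartz function. -/
def schwartzPartial {n : ℕ} (j : Fin n) (φ : 𝓢(Rn n, ℝ)) : 𝓢(Rn n, ℝ) :=
  ∂_{EuclideanSpace.basisFun (Fin n) ℝ j} φ

theorem schwartzPartial_apply {n : ℕ} (j : Fin n) (φ : 𝓢(Rn n, ℝ)) (x : Rn n) :
    schwartzPartial j φ x = inner ℝ (EuclideanSpace.basisFun (Fin n) ℝ j) (gradient φ x) := by
  rw [inner_gradient_right]
  exact SchwartzMap.lineDerivOp_apply_eq_fderiv _ _ _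

theorem laplacian_eq_sum_schwartzPartial {n : ℕ} (φ : 𝓢(Rn n, ℝ)) :
    Δ φ = ∑ j, schwartzPartial j (schwartzPartial j φ) :=
  SchwartzMap.laplacian_eq_sum (EuclideanSpace.basisFun (Fin n) ℝ) φ

theorem integral_mul_laplacian_eq {n : ℕ} {a : Rn n → ℝ} {b : Rn n → Rn n}
    (ha : MemLp a 2 (volume : Measure (Rn n))) (hb : MemLp b 2 (volume : Measure (Rn n)))
    (hw : ∀ (φ : 𝓢(Rn n, ℝ)) (j : Fin n), ∫ z, inner ℝ (b z) (EuclideanSpace.basisFun (Fin n) ℝ j) * φ z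
      = - ∫ z, a z * schwartzPartial j φ z) (φ : 𝓢(Rn n, ℝ)) :
    ∫ z, inner ℝ (b z) (gradient φ z) = - ∫ z, a z * (Δ φ) z := by
  have i1 : ∀ j, Integrable (fun z => inner ℝ (b z) (EuclideanSpace.basisFun (Fin n) ℝ j)
      * schwartzPartial j φ z) (volume : Measure (Rn n)) := fun j =>
    (hb.inner_const _).integrable_mul ((schwartzPartial j φ).memLp 2 volume)
  have i2 : ∀ j, Integrable (fun z => a z * schwartzPartial j (schwartzPartial j φ) z)
      (volume : Measure (Rn n)) := fun j =>
    ha.integrable_mul ((schwartzPartial j (schwartzPartial j φ)).memLp 2 volume)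
  have e1 : ∀ z, inner ℝ (b z) (gradient φ z)
      = ∑ j, inner ℝ (b z) (EuclideanSpace.basisFun (Fin n) ℝ j) * schwartzPartial j φ z := by
    intro z
    simp_rw [schwartzPartial_apply]
    exact ((EuclideanSpace.basisFun (Fin n) ℝ).sum_inner_mul_inner _ _).symm
  have e2 : ∀ z, a z * (Δ φ) z = ∑ j, a z * schwartzPartial j (schwartzPartial j φ) z := by
    intro z
    rw [laplacian_eq_sum_schwartzPartial, sum_apply, Finset.mul_sum]
  simp_rw [e1, e2]
  rw [integral_finsetSum _ fun j _ => i1 j, integral_finsetSum _ fun j _ => i2 j,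
    ← Finset.sum_neg_distrib]
  exact Finset.sum_congr rfl fun j _ => hw _ j

/-- The only `H¹` solution of `a - Δ a = 0` is zero. -/
theorem ae_eq_zero_of_helmholtz {n : ℕ} {a : Rn n → ℝ} {b : Rn n → Rn n}
    (ha : MemLp a 2 (volume : Measure (Rn n))) (hb : MemLp b 2 (volume : Measure (Rn n)))
    (hw : ∀ (η : Rn n → ℝ) (y : Rn n), ContDiff ℝ ∞ η → HasCompactSupport η →
      ∫ z, (inner ℝ (b z) y * η z + inner ℝ (a z • y) (gradient η z)) = 0)
    (ht : ∀ η : Rn n → ℝ, ContDiff ℝ ∞ η → HasCompactSupport η →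
      ∫ z, (a z * η z + inner ℝ (b z) (gradient η z)) = 0) :
    a =ᵐ[volume] 0 ∧ b =ᵐ[volume] 0 := by
  have hby : ∀ y : Rn n, MemLp (fun z => inner ℝ (b z) y) 2 (volume : Measure (Rn n)) := fun y =>
    hb.inner_const y
  have hay : ∀ y : Rn n, MemLp (fun z => a z • y) 2 (volume : Measure (Rn n)) := fun y =>
    (ContinuousLinearMap.toSpanSingleton ℝ y).comp_memLp' ha
  have hws : ∀ (φ : 𝓢(Rn n, ℝ)) (j : Fin n),
      ∫ z, inner ℝ (b z) (EuclideanSpace.basisFun (Fin n) ℝ j) * φ z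
        = - ∫ z, a z * schwartzPartial j φ z := by
    intro φ j
    have h := integral_schwartz_eq_zero (hby _) (hay _)
      (fun η h1 h2 => hw η (EuclideanSpace.basisFun (Fin n) ℝ j) h1 h2) φ
    have i1 : Integrable (fun z => inner ℝ (b z) (EuclideanSpace.basisFun (Fin n) ℝ j) * φ z)
        (volume : Measure (Rn n)) := (hby _).integrable_mul (φ.memLp 2 volume)
    rw [integral_add i1 (integrable_inner_of_memLp (hay _) (memLp_gradient_schwartz _))] at h
    simp_rw [real_inner_smul_left, ← schwartzPartial_apply] at h
    linarith
  have hts := integral_schwartz_eq_zero ha hb ht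
  have hres : ∀ φ : 𝓢(Rn n, ℝ), ∫ z, a z * (φ z - (Δ φ) z) = 0 := by
    intro φ
    have i0 : Integrable (fun z => a z * φ z) (volume : Measure (Rn n)) :=
      ha.integrable_mul (φ.memLp 2 volume)
    have i1 : Integrable (fun z => a z * (Δ φ) z) (volume : Measure (Rn n)) :=
      ha.integrable_mul ((Δ φ).memLp 2 volume)
    have h := hts φ
    rw [integral_add i0 (integrable_inner_of_memLp hb (memLp_gradient_schwartz φ)),
      integral_mul_laplacian_eq ha hb hws] at h
    simp_rw [mul_sub]
    rw [integral_sub i0 i1]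
    linarith
  have ha0 : a =ᵐ[volume] 0 := by
    refine ae_eq_zero_of_integral_contDiff_smul_eq_zero (locallyIntegrable_of_memLp_two ha)
      fun η h1 h2 => ?_
    -- Every test function is `χ - Δ χ` for some Schwartz `χ`, and `a` annihilates all such
    -- functions.
    obtain ⟨χ, hχ, -⟩ := exists_resolvent_real one_pos (h2.toSchwartzMap h1)
    rw [one_smul] at hχ
    rw [← hres (schwartzRe n χ)]
    refine integral_congr_ae (Filter.Eventually.of_forall fun z => ?_)
    have hz : η z = schwartzRe n χ z - (Δ (schwartzRe n χ)) z := by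
      rw [← sub_apply, hχ]; rfl
    simp only [smul_eq_mul]
    rw [hz, mul_comm]
  refine ⟨ha0, ?_⟩
  have hbj : ∀ j, (fun z => inner ℝ (b z) (EuclideanSpace.basisFun (Fin n) ℝ j))
      =ᵐ[volume] 0 := by
    intro j
    refine ae_eq_zero_of_integral_contDiff_smul_eq_zero (locallyIntegrable_of_memLp_two (hby _))
      fun η h1 h2 => ?_
    rw [← hw η (EuclideanSpace.basisFun (Fin n) ℝ j) h1 h2]
    refine integral_congr_ae ?_
    filter_upwards [ha0] with z hz
    rw [hz, Pi.zero_apply, zero_smul, inner_zero_left, add_zero, smul_eq_mul, mul_comm]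
  filter_upwards [ae_all_iff.2 hbj] with z hz
  have h := (EuclideanSpace.basisFun (Fin n) ℝ).sum_sq_inner_left (b z)
  simp_rw [hz, Pi.zero_apply] at h
  have h2 : ‖b z‖ ^ 2 = 0 := by rw [← h]; simp
  exact norm_eq_zero.1 (pow_eq_zero_iff two_ne_zero |>.1 h2)

/-- The Hilbert space `L²(ℝ^n) × L²(ℝ^n; ℝ^n)`. -/
abbrev L2Jet (n : ℕ) : Type :=
  WithLp 2 (Lp ℝ 2 (volume : Measure (Rn n)) × Lp (Rn n) 2 (volume : Measure (Rn n)))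

/-- The element of `L2Jet` attached to a pair of square integrable functions. -/
def jet {n : ℕ} {a : Rn n → ℝ} {b : Rn n → Rn n} (ha : MemLp a 2 (volume : Measure (Rn n)))
    (hb : MemLp b 2 (volume : Measure (Rn n))) : L2Jet n :=
  WithLp.toLp 2 (ha.toLp a, hb.toLp b)

theorem inner_jet {n : ℕ} {a : Rn n → ℝ} {b : Rn n → Rn n}
    (ha : MemLp a 2 (volume : Measure (Rn n))) (hb : MemLp b 2 (volume : Measure (Rn n)))
    (x : L2Jet n) :
    inner ℝ (jet ha hb) x = ∫ z, (a z * x.fst z + inner ℝ (b z) (x.snd z)) := by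
  rw [WithLp.prod_inner_apply]
  change inner ℝ (ha.toLp a) x.fst + inner ℝ (hb.toLp b) x.snd = _
  have i1 : Integrable (fun z => a z * x.fst z) (volume : Measure (Rn n)) :=
    ha.integrable_mul (Lp.memLp x.fst)
  rw [inner_toLp_left, inner_toLp_left, integral_add i1
    (integrable_inner_of_memLp hb (Lp.memLp x.snd))]
  congr 1
  exact integral_congr_ae (Filter.Eventually.of_forall fun z => mul_comm _ _)

theorem memLp_gradient_test {n : ℕ} {η : Rn n → ℝ} (h1 : ContDiff ℝ ∞ η)
    (h2 : HasCompactSupport η) : MemLp (gradient η) 2 (volume : Measure (Rn n)) :=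
  memLp_test (continuous_gradient h1) (hasCompactSupport_gradient h2) 2

theorem memLp_fderiv_test {n : ℕ} {η : Rn n → ℝ} (h1 : ContDiff ℝ ∞ η)
    (h2 : HasCompactSupport η) (y : Rn n) :
    MemLp (fun z => fderiv ℝ η z y) 2 (volume : Measure (Rn n)) :=
  memLp_test ((h1.continuous_fderiv (by simp)).clm_apply continuous_const)
    ((h2.fderiv (𝕜 := ℝ)).comp_left (g := fun L : Rn n →L[ℝ] ℝ => L y) rfl) 2

theorem memLp_smul_test {n : ℕ} {η : Rn n → ℝ} (h1 : ContDiff ℝ ∞ η)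
    (h2 : HasCompactSupport η) (y : Rn n) :
    MemLp (fun z => η z • y) 2 (volume : Measure (Rn n)) :=
  memLp_test (h1.continuous.smul continuous_const) h2.smul_right 2

/-- Test functions are dense in the set of pairs `(g, ∇g)` with weak gradient `∇g`. -/
theorem mem_closure_span_jet {n : ℕ} {x : L2Jet n}
    (hx : ∀ (η : Rn n → ℝ) (y : Rn n) (h1 : ContDiff ℝ ∞ η) (h2 : HasCompactSupport η),
      inner ℝ (jet (memLp_fderiv_test h1 h2 y) (memLp_smul_test h1 h2 y)) x = 0) :
    x ∈ (Submodule.span ℝ {w : L2Jet n | ∃ (η : Rn n → ℝ) (h1 : ContDiff ℝ ∞ η)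
      (h2 : HasCompactSupport η), w = jet (memLp_test h1.continuous h2 2)
        (memLp_gradient_test h1 h2)}).topologicalClosure := by
  set S : Set (L2Jet n) := {w : L2Jet n | ∃ (η : Rn n → ℝ) (h1 : ContDiff ℝ ∞ η)
      (h2 : HasCompactSupport η), w = jet (memLp_test h1.continuous h2 2)
        (memLp_gradient_test h1 h2)} with hS
  set W := (Submodule.span ℝ S).topologicalClosure with hW
  have : CompleteSpace W := (Submodule.isClosed_topologicalClosure _).completeSpace_coe
  -- Orthogonality to all `(∂_y η, η y)` says that the second component is the weak gradient of the
  -- first. It holds for jets of test functions, hence on their closure.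
  have hSW : ∀ w ∈ W, ∀ (η : Rn n → ℝ) (y : Rn n) (h1 : ContDiff ℝ ∞ η)
      (h2 : HasCompactSupport η),
      inner ℝ (jet (memLp_fderiv_test h1 h2 y) (memLp_smul_test h1 h2 y)) w = 0 := by
    intro w hw η y h1 h2
    have hle : W ≤ (ℝ ∙ (jet (memLp_fderiv_test h1 h2 y) (memLp_smul_test h1 h2 y)))ᗮ := by
      refine Submodule.topologicalClosure_minimal _ ?_ (Submodule.isClosed_orthogonal _)
      rw [Submodule.span_le]
      rintro _ ⟨θ, k1, k2, rfl⟩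
      rw [SetLike.mem_coe, Submodule.mem_orthogonal_singleton_iff_inner_right, inner_jet]
      have hi1 : Integrable (fun z => fderiv ℝ η z y * θ z) (volume : Measure (Rn n)) :=
        (memLp_fderiv_test h1 h2 y).integrable_mul (memLp_test k1.continuous k2 2)
      have hi2 : Integrable (fun z => η z * fderiv ℝ θ z y) (volume : Measure (Rn n)) :=
        (memLp_test h1.continuous h2 2).integrable_mul (memLp_fderiv_test k1 k2 y)
      have hi3 : Integrable (fun z => η z * θ z) (volume : Measure (Rn n)) :=
        (memLp_test h1.continuous h2 2).integrable_mul (memLp_test k1.continuous k2 2)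
      have e : ∫ z, (fderiv ℝ η z y * (jet (memLp_test k1.continuous k2 2)
          (memLp_gradient_test k1 k2)).fst z + inner ℝ (η z • y)
          ((jet (memLp_test k1.continuous k2 2) (memLp_gradient_test k1 k2)).snd z))
          = ∫ z, (fderiv ℝ η z y * θ z + η z * fderiv ℝ θ z y) := by
        refine integral_congr_ae ?_
        filter_upwards [(memLp_test k1.continuous k2 2).coeFn_toLp,
          (memLp_gradient_test k1 k2).coeFn_toLp] with z hz1 hz2
        change fderiv ℝ η z y * (MemLp.toLp θ (memLp_test k1.continuous k2 2)) z + inner ℝ (η z • y)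
          ((MemLp.toLp (gradient θ) (memLp_gradient_test k1 k2)) z) = _
        rw [hz1, hz2, real_inner_smul_left, inner_gradient_right]
      rw [e, integral_add hi1 hi2, integral_mul_fderiv_eq_neg_fderiv_mul_of_integrable hi1 hi2 hi3
        (fun x _ => (h1.differentiable (by simp)).differentiableAt)
        (fun x _ => (k1.differentiable (by simp)).differentiableAt), add_neg_cancel]
    exact (Submodule.mem_orthogonal_singleton_iff_inner_right).1 (hle hw)
  -- The remainder `(a, b)` satisfies `b = ∇a`, as `x` and its projection do, and is orthogonal to
  -- all jets, that is `a - div b = 0` weakly. So it solves the Helmholtz equation and vanishes.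
  set r := x - W.starProjection x with hr
  have hrW : r ∈ Wᗮ := Submodule.sub_starProjection_mem_orthogonal x
  have hPW : W.starProjection x ∈ W := Submodule.starProjection_apply_mem _ _
  have hz := ae_eq_zero_of_helmholtz (Lp.memLp r.fst) (Lp.memLp r.snd)
    (fun η y h1 h2 => by
      have h0 : inner ℝ (jet (memLp_fderiv_test h1 h2 y) (memLp_smul_test h1 h2 y)) r = 0 := by
        rw [hr, inner_sub_right, hx η y h1 h2, hSW _ hPW η y h1 h2, sub_zero]
      rw [inner_jet] at h0
      rw [← h0]
      refine integral_congr_ae (Filter.Eventually.of_forall fun z => ?_)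
      simp only [real_inner_smul_left, inner_gradient_right]
      rw [real_inner_comm]
      ring)
    (fun η h1 h2 => by
      have h0 := (Submodule.mem_orthogonal _ _).1 hrW _ (Submodule.le_topologicalClosure _
        (Submodule.subset_span ⟨η, h1, h2, rfl⟩))
      rw [inner_jet] at h0
      rw [← h0]
      refine integral_congr_ae (Filter.Eventually.of_forall fun z => ?_)
      simp only
      rw [real_inner_comm]
      ring)
  have hr0 : r = 0 := by
    have h1 : r.fst = 0 := Lp.ext (hz.1.trans (Lp.coeFn_zero _ _ _).symm)
    have h2 : r.snd = 0 := Lp.ext (hz.2.trans (Lp.coeFn_zero _ _ _).symm)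
    exact WithLp.ofLp_injective 2 (Prod.ext h1 h2)
  rw [sub_eq_zero.1 (hr.symm.trans hr0)]
  exact hPW

/-- A weak identity `-Δ ψ = F` may be tested against any `f ∈ Ḣ¹ ∩ L²`. -/
theorem HDot.inner_grad_eq_of_weak {n : ℕ} {ψ f : HDot n}
    {F g : Lp ℝ 2 (volume : Measure (Rn n))}
    (hψ : ∀ η : Rn n → ℝ, ContDiff ℝ ∞ η → HasCompactSupport η →
      ∫ z, inner ℝ (HDot.grad ψ z) (gradient η z) = ∫ z, F z * η z)
    (hf : ∀ η : Rn n → ℝ, ContDiff ℝ ∞ η → HasCompactSupport η →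
      ∫ z, HDot.toFun f z * η z = ∫ z, g z * η z) :
    inner ℝ (HDot.gradCLM n ψ) (HDot.gradCLM n f) = inner ℝ F g := by
  set x : L2Jet n := WithLp.toLp 2 (g, HDot.gradCLM n f) with hx
  have hmem := mem_closure_span_jet (x := x) (fun η y h1 h2 => by
    rw [inner_jet]
    change ∫ z, (fderiv ℝ η z y * g z + inner ℝ (η z • y) (HDot.grad f z)) = 0
    have i1 : Integrable (fun z => fderiv ℝ η z y * g z) (volume : Measure (Rn n)) :=
      (memLp_fderiv_test h1 h2 y).integrable_mul (Lp.memLp g)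
    have i2 : Integrable (fun z => inner ℝ (η z • y) (HDot.grad f z)) (volume : Measure (Rn n)) :=
      integrable_inner_of_memLp (memLp_smul_test h1 h2 y) (Lp.memLp (HDot.gradCLM n f))
    rw [integral_add i1 i2, HDot.integral_inner_grad_mul f h1 h2 y,
      hf _ ((h1.fderiv_right (m := ∞) (by simp)).clm_apply contDiff_const)
        ((h2.fderiv (𝕜 := ℝ)).comp_left (g := fun L : Rn n →L[ℝ] ℝ => L y) rfl)]
    simp_rw [mul_comm (fderiv ℝ η _ y)]
    exact add_neg_cancel _)
  -- The equation for `ψ` says that `v` is orthogonal to the jets of test functions, hence to their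
  -- closure, which contains `x = (g, ∇f)`.
  let v : L2Jet n := WithLp.toLp 2 (-F, HDot.gradCLM n ψ)
  have hle : (Submodule.span ℝ {w : L2Jet n | ∃ (η : Rn n → ℝ) (h1 : ContDiff ℝ ∞ η)
      (h2 : HasCompactSupport η), w = jet (memLp_test h1.continuous h2 2)
        (memLp_gradient_test h1 h2)}).topologicalClosure ≤ (ℝ ∙ v)ᗮ := by
    refine Submodule.topologicalClosure_minimal _ ?_ (Submodule.isClosed_orthogonal _)
    rw [Submodule.span_le]
    rintro _ ⟨θ, k1, k2, rfl⟩
    rw [SetLike.mem_coe, Submodule.mem_orthogonal_singleton_iff_inner_left,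
      WithLp.prod_inner_apply]
    change inner ℝ (MemLp.toLp θ (memLp_test k1.continuous k2 2)) (-F)
      + inner ℝ (MemLp.toLp (gradient θ) (memLp_gradient_test k1 k2)) (HDot.gradCLM n ψ) = 0
    rw [inner_neg_right, inner_toLp_left, inner_toLp_left]
    have e := hψ θ k1 k2
    have e1 : ∫ z, inner ℝ (θ z) (F z) = ∫ z, F z * θ z :=
      integral_congr_ae (Filter.Eventually.of_forall fun z => rfl)
    have e2 : ∫ z, inner ℝ (gradient θ z) (HDot.gradCLM n ψ z)
        = ∫ z, inner ℝ (HDot.grad ψ z) (gradient θ z) :=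
      integral_congr_ae (Filter.Eventually.of_forall fun z => real_inner_comm _ _)
    rw [e1, e2, e, neg_add_cancel]
  have h0 := (Submodule.mem_orthogonal_singleton_iff_inner_right).1 (hle hmem)
  rw [WithLp.prod_inner_apply] at h0
  have h1 : inner ℝ (-F) g + inner ℝ (HDot.gradCLM n ψ) (HDot.gradCLM n f) = 0 := h0
  rw [inner_neg_left] at h1
  linarith

/-! ### Conservation of quadratic forms by time averaging -/

theorem tendsto_slope_integral {E : Type*} [NormedAddCommGroup E] [NormedSpace ℝ E] [CompleteSpace E]
    {Y : ℝ → E} (hY : Continuous Y) (t : ℝ) :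
    Filter.Tendsto (fun h : ℝ => h⁻¹ • ((∫ τ in (0 : ℝ)..(t + h), Y τ) - ∫ τ in (0 : ℝ)..t, Y τ))
      (𝓝[>] 0) (𝓝 (Y t)) :=
  ((hasDerivAt_iff_tendsto_slope_zero.1 (hY.integral_hasStrictDerivAt 0 t).hasDerivAt).mono_left
    (nhdsWithin_mono _ fun _ hx => ne_of_gt hx))

/-- `X` is only continuous, so `B (X t) (X t)` cannot be differentiated. The increments `G (t + r) -
G t` of its primitive are differentiable, and the derivative of `B` on them is `2 B (X (t + r) - X
t) (∫ X) = 0`. Dividing by `r²` and letting `r → 0` recovers `X`. -/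
theorem bilin_apply_self_eq {E : Type*} [NormedAddCommGroup E] [NormedSpace ℝ E] [CompleteSpace E]
    (B : E →L[ℝ] E →L[ℝ] ℝ) (hB : ∀ x y, B x y = B y x) {X : ℝ → E} (hX : ContinuousOn X (Ici 0))
    (h : ∀ s t, 0 ≤ s → s ≤ t → B (X t - X s) (∫ τ in s..t, X τ) = 0) {t : ℝ} (ht : 0 ≤ t) :
    B (X t) (X t) = B (X 0) (X 0) := by
  -- `X` is extended by its initial value so that the primitive is differentiable on all of `ℝ`.
  set Y : ℝ → E := fun τ => X (max τ 0) with hYdef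
  have hY : Continuous Y :=
    hX.comp_continuous (continuous_id.max continuous_const) fun τ => mem_Ici.2 (le_max_right _ _)
  have hYX : ∀ τ, 0 ≤ τ → Y τ = X τ := fun τ hτ => by rw [hYdef]; simp only [max_eq_left hτ]
  set G : ℝ → E := fun t => ∫ τ in (0 : ℝ)..t, Y τ with hG
  have hGd : ∀ τ, HasDerivAt G (Y τ) τ := fun τ => (hY.integral_hasStrictDerivAt 0 τ).hasDerivAt
  have hconst : ∀ r : ℝ, 0 < r →
      B (G (t + r) - G t) (G (t + r) - G t) = B (G (0 + r) - G 0) (G (0 + r) - G 0) := by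
    intro r hr
    have hd : ∀ τ, HasDerivAt (fun τ => G (τ + r) - G τ) (Y (τ + r) - Y τ) τ := fun τ =>
      ((hGd (τ + r)).comp_add_const τ r).sub (hGd τ)
    have hf : ∀ τ, HasDerivAt (fun τ => B (G (τ + r) - G τ) (G (τ + r) - G τ))
        (B (G (τ + r) - G τ) (Y (τ + r) - Y τ) + B (Y (τ + r) - Y τ) (G (τ + r) - G τ)) τ := fun τ =>
      B.hasDerivAt_of_bilinear (fun _ => hd τ) (fun _ => hd τ)
    refine constant_of_has_deriv_right_zero (a := 0) (b := t)
      (f := fun τ => B (G (τ + r) - G τ) (G (τ + r) - G τ))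
      (fun τ _ => (hf τ).continuousAt.continuousWithinAt) (fun τ hτ => ?_) t ⟨ht, le_rfl⟩
    have hτ0 : 0 ≤ τ := hτ.1
    have e1 : G (τ + r) - G τ = ∫ x in τ..(τ + r), X x := by
      rw [hG]
      simp only
      rw [intervalIntegral.integral_interval_sub_left (hY.intervalIntegrable _ _)
        (hY.intervalIntegrable _ _)]
      refine intervalIntegral.integral_congr fun x hx => hYX x ?_
      rw [uIcc_of_le (by linarith)] at hx
      exact hτ0.trans hx.1
    have e2 : B (Y (τ + r) - Y τ) (G (τ + r) - G τ) = 0 := by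
      rw [e1, hYX _ hτ0, hYX _ (by linarith)]
      exact h τ (τ + r) hτ0 (by linarith)
    have e3 := (hf τ).hasDerivWithinAt (s := Ici τ)
    rwa [hB (G (τ + r) - G τ), e2, add_zero] at e3
  have hlim : ∀ τ, Filter.Tendsto
      (fun r : ℝ => B (r⁻¹ • (G (τ + r) - G τ)) (r⁻¹ • (G (τ + r) - G τ)))
      (𝓝[>] 0) (𝓝 (B (Y τ) (Y τ))) := fun τ => by
    have h1 := tendsto_slope_integral hY τ
    exact ((B.continuous.clm_apply continuous_id).tendsto (Y τ)).comp h1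
  have h1 := hlim t
  have h2 := hlim 0
  have h3 : (fun r : ℝ => B (r⁻¹ • (G (t + r) - G t)) (r⁻¹ • (G (t + r) - G t))) =ᶠ[𝓝[>] 0]
      fun r : ℝ => B (r⁻¹ • (G (0 + r) - G 0)) (r⁻¹ • (G (0 + r) - G 0)) := by
    filter_upwards [self_mem_nhdsWithin] with r hr
    simp only [map_smul, smul_apply]
    rw [hconst r hr]
  have := tendsto_nhds_unique (h1.congr' h3) h2
  rwa [hYX t ht, hYX 0 le_rfl] at this

/-- The fundamental theorem of calculus with `L` moved outside the integral: each weak evolution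
equation becomes an identity for the single vector `∫ X` of the phase space. -/
theorem sub_eq_clm_integral {E : Type*} [NormedAddCommGroup E] [NormedSpace ℝ E] [CompleteSpace E]
    {X : ℝ → E} (hX : ContinuousOn X (Ici 0)) (L : E →L[ℝ] ℝ) {f : ℝ → ℝ}
    (hf : ∀ t ∈ Ici (0 : ℝ), HasDerivWithinAt f (L (X t)) (Ici 0) t) {s t : ℝ} (hs : 0 ≤ s)
    (hst : s ≤ t) : f t - f s = L (∫ τ in s..t, X τ) := by
  have hsub : Icc s t ⊆ Ici (0 : ℝ) := fun x hx => hs.trans hx.1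
  have hint : IntervalIntegrable X volume s t :=
    (hX.mono (by rwa [uIcc_of_le hst])).intervalIntegrable
  rw [← L.intervalIntegral_comp_comm hint, intervalIntegral.integral_eq_sub_of_hasDeriv_right]
  · intro x hx
    rw [uIcc_of_le hst] at hx
    exact ((hf x (hsub hx)).continuousWithinAt).mono (by rw [uIcc_of_le hst]; exact hsub)
  · intro x hx
    rw [min_eq_left hst, max_eq_right hst] at hx
    have hx0 : 0 ≤ x := hs.trans hx.1.le
    exact (hf x hx0).mono fun y hy => hx0.trans (le_of_lt hy)
  · exact (L.continuous.comp_continuousOn (hX.mono (by rwa [uIcc_of_le hst]))).intervalIntegrable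

/-! ### A single Hartley mode -/

/-- The phase space of a single mode. -/
abbrev ModeSpace (n : ℕ) : Type := ℝ × ℝ × HDot n × Lp ℝ 2 (volume : Measure (Rn n))

/-- The value of the functional `f ↦ ∫ σ₂ f`. -/
def IsFormFunction₂.value {n : ℕ} {σ₂ : Rn n → ℝ} (hσ : IsFormFunction₂ σ₂) (f : HDot n) : ℝ :=
  hσ.functional f

/-- The system satisfied by the Hartley coefficients of a solution at a frequency of squared
length `κ₂`, where `s` is the corresponding eigenvalue of the convolution with `σ₁`. -/
structure IsModeSolution {n : ℕ} (γ c κ₂ s : ℝ) {σ₂ : Rn n → ℝ} (hσ : IsFormFunction₂ σ₂)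
    (X : ℝ → ModeSpace n) : Prop where
  continuousOn : ContinuousOn X (Ici 0)
  re : ∀ t ∈ Ici (0 : ℝ), HasDerivWithinAt (fun τ => (X τ).1) (κ₂ / 2 * (X t).2.1) (Ici 0) t
  im : ∀ t ∈ Ici (0 : ℝ), HasDerivWithinAt (fun τ => (X τ).2.1)
    (-(κ₂ / 2) * (X t).1 - γ * s * hσ.value (X t).2.2.1) (Ici 0) t
  velocity : ∀ η : Rn n → ℝ, ContDiff ℝ ∞ η → HasCompactSupport η → ∀ t ∈ Ici (0 : ℝ),
    HasDerivWithinAt (fun τ => ∫ z, HDot.toFun (X τ).2.2.1 z * η z)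
      (-2 * c ^ 2 * ∫ z, (X t).2.2.2 z * η z) (Ici 0) t
  wave : ∀ η : Rn n → ℝ, ContDiff ℝ ∞ η → HasCompactSupport η → ∀ t ∈ Ici (0 : ℝ),
    HasDerivWithinAt (fun τ => ∫ z, (X τ).2.2.2 z * η z)
      ((1 / 2) * (∫ z, inner ℝ (HDot.grad (X t).2.2.1 z) (gradient η z))
        + γ * s * (X t).1 * ∫ z, σ₂ z * η z) (Ici 0) t

/-- The components of the phase space of a mode. -/
def modeRe (n : ℕ) : ModeSpace n →L[ℝ] ℝ := ContinuousLinearMap.fst ℝ _ _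

/-- The components of the phase space of a mode. -/
def modeIm (n : ℕ) : ModeSpace n →L[ℝ] ℝ :=
  (ContinuousLinearMap.fst ℝ _ _).comp (ContinuousLinearMap.snd ℝ _ _)

/-- The components of the phase space of a mode. -/
def modePsi (n : ℕ) : ModeSpace n →L[ℝ] HDot n :=
  ((ContinuousLinearMap.fst ℝ _ _).comp (ContinuousLinearMap.snd ℝ _ _)).comp
    (ContinuousLinearMap.snd ℝ _ _)

/-- The components of the phase space of a mode. -/
def modePi (n : ℕ) : ModeSpace n →L[ℝ] Lp ℝ 2 (volume : Measure (Rn n)) :=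
  ((ContinuousLinearMap.snd ℝ _ _).comp (ContinuousLinearMap.snd ℝ _ _)).comp
    (ContinuousLinearMap.snd ℝ _ _)

/-- The real inner product as a continuous bilinear map. -/
def realInner (F : Type*) [NormedAddCommGroup F] [InnerProductSpace ℝ F] : F →L[ℝ] F →L[ℝ] ℝ :=
  innerSL ℝ

/-- The value of the real inner product. -/
def realDot {F : Type*} [NormedAddCommGroup F] [InnerProductSpace ℝ F] (x y : F) : ℝ :=
  inner ℝ x y

theorem realDot_comm {F : Type*} [NormedAddCommGroup F] [InnerProductSpace ℝ F] (x y : F) :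
    realDot x y = realDot y x := real_inner_comm _ _

theorem realDot_self {F : Type*} [NormedAddCommGroup F] [InnerProductSpace ℝ F] (x : F) :
    realDot x x = ‖x‖ ^ 2 := real_inner_self_eq_norm_sq x

theorem realDot_sub {F : Type*} [NormedAddCommGroup F] [InnerProductSpace ℝ F] (v x y : F) :
    realDot v (x - y) = realDot v x - realDot v y := inner_sub_right _ _ _

theorem realDot_smul {F : Type*} [NormedAddCommGroup F] [InnerProductSpace ℝ F] (v x : F) (r : ℝ) :
    realDot v (r • x) = r * realDot v x := inner_smul_right _ _ _

theorem realDot_two_smul_sub {F : Type*} [NormedAddCommGroup F] [InnerProductSpace ℝ F]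
    (v w u : F) (r : ℝ) :
    realDot v ((2 : ℝ) • (w - r • u)) = 2 * (realDot v w - r * realDot v u) := by
  rw [realDot_smul, realDot_sub, realDot_smul]

theorem realDot_two_smul_sub_smul {F : Type*} [NormedAddCommGroup F] [InnerProductSpace ℝ F]
    (w u v : F) (r q : ℝ) :
    realDot ((2 : ℝ) • (w - r • u)) (q • v)
      = 2 * q * (realDot w v - r * realDot u v) := by
  rw [realDot_comm, realDot_two_smul_sub, realDot_comm _ w, realDot_comm _ u,
    realDot_smul, realDot_smul]
  ring

/-- The Dirichlet form on `Ḣ¹(ℝⁿ)`. -/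
def HDot.gradDot {n : ℕ} (f g : HDot n) : ℝ := realDot (HDot.gradCLM n f) (HDot.gradCLM n g)

theorem HDot.gradDot_comm {n : ℕ} (f g : HDot n) : HDot.gradDot f g = HDot.gradDot g f :=
  realDot_comm _ _

theorem HDot.gradDot_self {n : ℕ} (f : HDot n) : HDot.gradDot f f = ‖HDot.gradCLM n f‖ ^ 2 :=
  realDot_self _

/-- The polarized energy of a mode. -/
def modeForm {n : ℕ} (γ c κ₂ s : ℝ) {σ₂ : Rn n → ℝ} (hσ : IsFormFunction₂ σ₂) :
    ModeSpace n →L[ℝ] ModeSpace n →L[ℝ] ℝ :=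
  (κ₂ / 4) • ((ContinuousLinearMap.mul ℝ ℝ).bilinearComp (modeRe n) (modeRe n)
      + (ContinuousLinearMap.mul ℝ ℝ).bilinearComp (modeIm n) (modeIm n))
    + (γ * s / 2) • ((ContinuousLinearMap.mul ℝ ℝ).bilinearComp (modeRe n)
        (hσ.functional.comp (modePsi n))
      + (ContinuousLinearMap.mul ℝ ℝ).bilinearComp (hσ.functional.comp (modePsi n)) (modeRe n))
    + c ^ 2 • (realInner _).bilinearComp (modePi n) (modePi n)
    + (1 / 4 : ℝ) • (realInner _).bilinearComp ((HDot.gradCLM n).comp (modePsi n))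
        ((HDot.gradCLM n).comp (modePsi n))

theorem modeForm_apply {n : ℕ} (γ c κ₂ s : ℝ) {σ₂ : Rn n → ℝ} (hσ : IsFormFunction₂ σ₂)
    (x y : ModeSpace n) :
    modeForm γ c κ₂ s hσ x y = κ₂ / 4 * (x.1 * y.1 + x.2.1 * y.2.1)
      + γ * s / 2 * (x.1 * hσ.value y.2.2.1 + hσ.value x.2.2.1 * y.1)
      + c ^ 2 * realDot x.2.2.2 y.2.2.2
      + 1 / 4 * HDot.gradDot x.2.2.1 y.2.2.1 := rfl

/-- The energy of a mode. -/
def modeEnergy {n : ℕ} (γ c κ₂ s : ℝ) {σ₂ : Rn n → ℝ} (hσ : IsFormFunction₂ σ₂)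
    (x : ModeSpace n) : ℝ :=
  κ₂ / 4 * (x.1 ^ 2 + x.2.1 ^ 2) + γ * s * x.1 * hσ.value x.2.2.1 + c ^ 2 * realDot x.2.2.2 x.2.2.2
    + 1 / 4 * HDot.gradDot x.2.2.1 x.2.2.1

theorem modeForm_self {n : ℕ} (γ c κ₂ s : ℝ) {σ₂ : Rn n → ℝ} (hσ : IsFormFunction₂ σ₂)
    (x : ModeSpace n) : modeForm γ c κ₂ s hσ x x = modeEnergy γ c κ₂ s hσ x := by
  refine (modeForm_apply γ c κ₂ s hσ x x).trans ?_
  rw [modeEnergy]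
  ring

/-! ### The mode equations integrated in time, and conservation of energy. -/

/-- Integrating `∂_t ψ = -2c² ϖ` shows that the increment of `ψ` lies in `L²` as well as in `Ḣ¹`, so
it can be paired with an `L²` right-hand side. -/
theorem IsModeSolution.weak_psi {n : ℕ} {γ c κ₂ s : ℝ} {σ₂ : Rn n → ℝ} {hσ : IsFormFunction₂ σ₂}
    {X : ℝ → ModeSpace n} (h : IsModeSolution γ c κ₂ s hσ X) {a b : ℝ} (ha : 0 ≤ a) (hab : a ≤ b)
    (η : Rn n → ℝ) (h1 : ContDiff ℝ ∞ η) (h2 : HasCompactSupport η) :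
    ∫ z, HDot.toFun (X b - X a).2.2.1 z * η z
      = ∫ z, ((-2 * c ^ 2) • (∫ τ in a..b, X τ).2.2.2 :
          Lp ℝ 2 (volume : Measure (Rn n))) z * η z := by
  have hpair : ∀ w : Lp ℝ 2 (volume : Measure (Rn n)),
      ∫ z, w z * η z = inner ℝ ((memLp_test h1.continuous h2 2).toLp η) w := fun w => by
    rw [inner_toLp_left]
    exact integral_congr_ae (Filter.Eventually.of_forall fun z => rfl)
  have key := sub_eq_clm_integral h.continuousOn ((-2 * c ^ 2) •
    ((innerSL ℝ ((memLp_test h1.continuous h2 2).toLp η)).comp (modePi n)))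
    (f := fun τ => ∫ z, HDot.toFun (X τ).2.2.1 z * η z)
    (fun t ht => by
      have := h.velocity η h1 h2 t ht
      rw [hpair] at this
      exact this) ha hab
  rw [hpair, inner_smul_right]
  refine Eq.trans ?_ key
  simp_rw [← HDot.pair_apply h1.continuous h2]
  rw [← map_sub]
  rfl

theorem integral_toLp_test {n : ℕ} {η : Rn n → ℝ} (h1 : ContDiff ℝ ∞ η) (h2 : HasCompactSupport η)
    (w : Lp ℝ 2 (volume : Measure (Rn n))) :
    ∫ z, w z * η z = realDot ((memLp_test h1.continuous h2 2).toLp η) w := by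
  rw [realDot, inner_toLp_left]
  exact integral_congr_ae (Filter.Eventually.of_forall fun z => rfl)

theorem HDot.integral_inner_grad_gradient {n : ℕ} {η : Rn n → ℝ} (h1 : ContDiff ℝ ∞ η)
    (h2 : HasCompactSupport η) (f : HDot n) :
    ∫ z, inner ℝ (HDot.grad f z) (gradient η z)
      = inner ℝ ((memLp_gradient_test h1 h2).toLp (gradient η)) (HDot.gradCLM n f) := by
  rw [inner_toLp_left]
  exact integral_congr_ae (Filter.Eventually.of_forall fun z => real_inner_comm _ _)

theorem weak_pi_of_difference {n : ℕ} {γ s q : ℝ} {σ₂ : Rn n → ℝ} (hσ : IsFormFunction₂ σ₂)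
    {η : Rn n → ℝ} (h1 : ContDiff ℝ ∞ η) (h2 : HasCompactSupport η)
    {f : HDot n} {v w : Lp ℝ 2 (volume : Measure (Rn n))}
    (h : (∫ z, w z * η z) - ∫ z, v z * η z
      = 1 / 2 * (∫ z, inner ℝ (HDot.grad f z) (gradient η z)) + (γ * s * ∫ z, σ₂ z * η z) * q) :
    ∫ z, inner ℝ (HDot.grad f z) (gradient η z)
      = ∫ z, ((2 : ℝ) • ((w - v) - (γ * s * q) • hσ.schwartz.toLp 2 volume) :
          Lp ℝ 2 (volume : Measure (Rn n))) z * η z := by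
  have hσp : ∫ z, σ₂ z * η z = ∫ z, (hσ.schwartz.toLp 2 volume) z * η z := by
    refine integral_congr_ae ?_
    filter_upwards [hσ.schwartz.coeFn_toLp 2 volume] with z hz
    rw [hz, hσ.schwartz_apply]
  rw [hσp] at h
  simp only [integral_toLp_test h1 h2] at h ⊢
  rw [realDot_two_smul_sub, realDot_sub, h]
  ring

/-- The counterpart of `IsModeSolution.weak_psi`: integrating the wave equation shows that `-Δ ∫ ψ`
belongs to `L²`. It serves both energy conservation and the zero mode when `n ≥ 5`. -/
theorem IsModeSolution.weak_pi {n : ℕ} {γ c κ₂ s : ℝ} {σ₂ : Rn n → ℝ} {hσ : IsFormFunction₂ σ₂}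
    {X : ℝ → ModeSpace n} (h : IsModeSolution γ c κ₂ s hσ X) {a b : ℝ} (ha : 0 ≤ a) (hab : a ≤ b)
    (η : Rn n → ℝ) (h1 : ContDiff ℝ ∞ η) (h2 : HasCompactSupport η) :
    ∫ z, inner ℝ (HDot.grad (∫ τ in a..b, X τ).2.2.1 z) (gradient η z)
      = ∫ z, ((2 : ℝ) • ((X b - X a).2.2.2 - (γ * s * (∫ τ in a..b, X τ).1) •
          hσ.schwartz.toLp 2 volume) : Lp ℝ 2 (volume : Measure (Rn n))) z * η z := by
  have key := sub_eq_clm_integral h.continuousOn ((1 / 2 : ℝ) •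
      ((HDot.gradPair ((memLp_gradient_test h1 h2).toLp (gradient η))).comp (modePsi n))
      + (γ * s * ∫ z, σ₂ z * η z) • modeRe n)
    (f := fun τ => ∫ z, (X τ).2.2.2 z * η z)
    (fun t ht => by
      refine (h.wave η h1 h2 t ht).congr_deriv ?_
      refine (congrArg₂ _ (congrArg _ (HDot.integral_inner_grad_gradient h1 h2 _)) ?_)
      exact mul_right_comm _ _ _) ha hab
  exact weak_pi_of_difference hσ h1 h2 (key.trans (congrArg₂ _ (congrArg _
    (HDot.integral_inner_grad_gradient h1 h2 _).symm) rfl))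

theorem modeForm_comm {n : ℕ} (γ c κ₂ s : ℝ) {σ₂ : Rn n → ℝ} (hσ : IsFormFunction₂ σ₂)
    (x y : ModeSpace n) : modeForm γ c κ₂ s hσ x y = modeForm γ c κ₂ s hσ y x := by
  refine (modeForm_apply γ c κ₂ s hσ x y).trans (Eq.trans ?_ (modeForm_apply γ c κ₂ s hσ y x).symm)
  rw [realDot_comm x.2.2.2, HDot.gradDot_comm x.2.2.1]
  ring

/-- The generator is skew for the energy form. With `D = X b - X a` and `I = ∫ X`, the terms in
`ℓ(I_ψ) I_p` cancel between the Schrödinger part and the coupling. Those in `⟨σ₂, I_ϖ⟩ I_q` and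
`⟨D_ϖ, I_ϖ⟩` cancel against the Dirichlet form. -/
theorem modeForm_eq_zero {n : ℕ} {γ c κ₂ s : ℝ} {σ₂ : Rn n → ℝ} {hσ : IsFormFunction₂ σ₂}
    {D I : ModeSpace n} (h1 : D.1 = κ₂ / 2 * I.2.1)
    (h2 : D.2.1 = -(κ₂ / 2) * I.1 - γ * s * hσ.value I.2.2.1)
    (h3 : HDot.gradDot I.2.2.1 D.2.2.1
      = realDot ((2 : ℝ) • (D.2.2.2 - (γ * s * I.1) • hσ.schwartz.toLp 2 volume))
        ((-2 * c ^ 2) • I.2.2.2))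
    (h4 : hσ.value D.2.2.1 = -2 * c ^ 2 * realDot (hσ.schwartz.toLp 2 volume) I.2.2.2) :
    modeForm γ c κ₂ s hσ D I = 0 := by
  have h5 : HDot.gradDot D.2.2.1 I.2.2.1
      = 2 * (-2 * c ^ 2) * (realDot D.2.2.2 I.2.2.2
        - γ * s * I.1 * realDot (hσ.schwartz.toLp 2 volume) I.2.2.2) :=
    ((HDot.gradDot_comm _ _).trans h3).trans (realDot_two_smul_sub_smul _ _ _ _ _)
  refine (modeForm_apply γ c κ₂ s hσ D I).trans ?_
  rw [h5, h1, h2, h4]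
  ring

theorem IsFormFunction₂.value_eq_of_weak {n : ℕ} {σ₂ : Rn n → ℝ} (hσ : IsFormFunction₂ σ₂)
    {f : HDot n} {w : Lp ℝ 2 (volume : Measure (Rn n))} {r : ℝ}
    (h : ∀ η : Rn n → ℝ, ContDiff ℝ ∞ η → HasCompactSupport η →
      ∫ z, HDot.toFun f z * η z = ∫ z, (r • w : Lp ℝ 2 (volume : Measure (Rn n))) z * η z) :
    hσ.value f = r * realDot (hσ.schwartz.toLp 2 volume) w := by
  have h0 : hσ.value f = ∫ z, HDot.toFun f z * σ₂ z :=
    HDot.pair_apply hσ.smooth.continuous hσ.compactSupport f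
  rw [h0, h _ hσ.smooth hσ.compactSupport, ← realDot_smul, realDot, SchwartzMap.toLp, inner_toLp_left]
  exact integral_congr_ae (Filter.Eventually.of_forall fun z => rfl)

/-- The energy of a mode is conserved. -/
theorem IsModeSolution.energy_eq {n : ℕ} {γ c κ₂ s : ℝ} {σ₂ : Rn n → ℝ} {hσ : IsFormFunction₂ σ₂}
    {X : ℝ → ModeSpace n} (h : IsModeSolution γ c κ₂ s hσ X) {t : ℝ} (ht : 0 ≤ t) :
    modeEnergy γ c κ₂ s hσ (X t) = modeEnergy γ c κ₂ s hσ (X 0) :=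
  (modeForm_self γ c κ₂ s hσ (X t)).symm.trans <|
    (bilin_apply_self_eq _ (modeForm_comm γ c κ₂ s hσ) h.continuousOn
      (fun _ _ ha hab => modeForm_eq_zero
        (sub_eq_clm_integral h.continuousOn ((κ₂ / 2) • modeIm n) h.re ha hab)
        (sub_eq_clm_integral h.continuousOn
          (-(κ₂ / 2) • modeRe n - (γ * s) • (hσ.functional.comp (modePsi n))) h.im ha hab)
        -- The weak Laplace equation for `∫ ψ` is tested against the increment of `ψ`, which lies in
        -- `Ḣ¹ ∩ L²`.
        (HDot.inner_grad_eq_of_weak (h.weak_pi ha hab) (h.weak_psi ha hab))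
        (hσ.value_eq_of_weak (h.weak_psi ha hab))) ht).trans (modeForm_self γ c κ₂ s hσ (X 0))

/-! ### Bounds for a single mode -/

/-- The homogeneous norm `‖∇f‖` on `Ḣ¹(ℝⁿ)`. -/
def HDot.gradNorm {n : ℕ} (f : HDot n) : ℝ := ‖HDot.gradCLM n f‖

theorem HDot.gradNorm_zero {n : ℕ} : HDot.gradNorm (0 : HDot n) = 0 :=
  (congrArg norm (map_zero _)).trans norm_zero

theorem modeEnergy_eq {n : ℕ} (γ c κ₂ s : ℝ) {σ₂ : Rn n → ℝ} (hσ : IsFormFunction₂ σ₂)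
    (x : ModeSpace n) :
    modeEnergy γ c κ₂ s hσ x = κ₂ / 4 * (x.1 ^ 2 + x.2.1 ^ 2) + γ * s * x.1 * hσ.value x.2.2.1
      + c ^ 2 * ‖x.2.2.2‖ ^ 2 + 1 / 4 * HDot.gradNorm x.2.2.1 ^ 2 := by
  rw [modeEnergy, realDot_self, HDot.gradDot_self, HDot.gradNorm]

/-- Young's inequality weighted to use up all of `¼ g²`, the full Dirichlet energy. What remains is
the fraction `4 γ² κ S²` of the kinetic term, hence the threshold `1`. -/
theorem abs_coupling_le {κ₂ κ S γ s q l g : ℝ} (hκ : 0 ≤ κ) (hκ₂ : 1 ≤ κ₂) (hs : |s| ≤ S)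
    (hl : |l| ≤ √κ * g) :
    |γ * s * q * l| ≤ 1 / 4 * g ^ 2 + 4 * γ ^ 2 * κ * S ^ 2 * (κ₂ / 4 * q ^ 2) := by
  have hS : 0 ≤ S := (abs_nonneg s).trans hs
  have h1 : |γ * s * q * l| ≤ |γ| * S * |q| * (√κ * g) := by
    rw [abs_mul, abs_mul, abs_mul]
    gcongr
  have h2 : |γ| * S * |q| * (√κ * g) ≤ 1 / 4 * g ^ 2 + (|γ| * S * |q| * √κ) ^ 2 := by
    nlinarith [sq_nonneg (1 / 2 * g - |γ| * S * |q| * √κ)]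
  have h3 : (|γ| * S * |q| * √κ) ^ 2 = γ ^ 2 * S ^ 2 * q ^ 2 * κ := by
    rw [mul_pow, mul_pow, mul_pow, sq_abs, sq_abs, Real.sq_sqrt hκ]
  have h4 : γ ^ 2 * S ^ 2 * q ^ 2 * κ * 1 ≤ γ ^ 2 * S ^ 2 * q ^ 2 * κ * κ₂ := by
    gcongr
  linarith

theorem kappa_nonneg {n : ℕ} (σ₂ : Rn n → ℝ) : 0 ≤ kappa σ₂ :=
  div_nonneg (integral_nonneg fun _ => by positivity) (by positivity)

/-- The coupling is bounded from below at time `t` and from above at time `0`, and the conserved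
energy connects the two; the result is multiplied by `4`. -/
theorem IsModeSolution.norm_sq_le {n : ℕ} (hn : 3 ≤ n) {γ c κ₂ s S : ℝ} {σ₂ : Rn n → ℝ}
    {hσ : IsFormFunction₂ σ₂} (hs : |s| ≤ S) (hκ₂ : 1 ≤ κ₂)
    (hsmall : 4 * γ ^ 2 * kappa σ₂ * S ^ 2 < 1)
    {X : ℝ → ModeSpace n} (h : IsModeSolution γ c κ₂ s hσ X) {t : ℝ} (ht : 0 ≤ t) :
    (1 - 4 * γ ^ 2 * kappa σ₂ * S ^ 2) * (κ₂ * ((X t).1 ^ 2 + (X t).2.1 ^ 2))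
      ≤ 2 * (κ₂ * ((X 0).1 ^ 2 + (X 0).2.1 ^ 2)) + 4 * c ^ 2 * ‖(X 0).2.2.2‖ ^ 2
        + 2 * HDot.gradNorm (X 0).2.2.1 ^ 2 := by
  have he := h.energy_eq ht
  rw [modeEnergy_eq, modeEnergy_eq] at he
  have hb : ∀ x : ModeSpace n, |γ * s * x.1 * hσ.value x.2.2.1|
      ≤ 1 / 4 * HDot.gradNorm x.2.2.1 ^ 2
        + 4 * γ ^ 2 * kappa σ₂ * S ^ 2 * (κ₂ / 4 * x.1 ^ 2) := fun x =>
    abs_coupling_le (kappa_nonneg σ₂) hκ₂ hs (hσ.abs_functional_le hn _)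
  have h1 := (abs_le.1 (hb (X t))).1
  have h2 := (abs_le.1 (hb (X 0))).2
  have hθ : 0 ≤ 4 * γ ^ 2 * kappa σ₂ * S ^ 2 := by
    have := kappa_nonneg σ₂
    positivity
  have h3 : 0 ≤ c ^ 2 * ‖(X t).2.2.2‖ ^ 2 := by positivity
  have h4 : 0 ≤ κ₂ * (X t).2.1 ^ 2 := by positivity
  have h5 : 0 ≤ κ₂ * (X 0).2.1 ^ 2 := by positivity
  have h6 : 0 ≤ κ₂ * (X 0).1 ^ 2 := by positivity
  have h7 := mul_nonneg hθ h4
  have h8 := mul_le_mul_of_nonneg_right hsmall.le h6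
  generalize 4 * γ ^ 2 * kappa σ₂ * S ^ 2 = θ at *
  nlinarith

theorem eq_of_hasDerivWithinAt_zero {f : ℝ → ℝ}
    (h : ∀ t ∈ Ici (0 : ℝ), HasDerivWithinAt f 0 (Ici 0) t) {t : ℝ} (ht : 0 ≤ t) : f t = f 0 :=
  constant_of_has_deriv_right_zero (a := 0) (b := t)
    (fun τ hτ => ((h τ hτ.1).continuousWithinAt).mono fun _ hx => hx.1)
    (fun τ hτ => (h τ hτ.1).mono fun _ hx => le_trans hτ.1 (mem_Ici.1 hx)) t ⟨ht, le_rfl⟩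

theorem IsModeSolution.re_eq_zero {n : ℕ} {γ c s : ℝ} {σ₂ : Rn n → ℝ}
    {hσ : IsFormFunction₂ σ₂} {X : ℝ → ModeSpace n} (h : IsModeSolution γ c 0 s hσ X)
    (h0 : (X 0).1 = 0) {t : ℝ} (ht : 0 ≤ t) : (X t).1 = 0 :=
  (eq_of_hasDerivWithinAt_zero (f := fun τ => (X τ).1)
    (fun τ hτ => (h.re τ hτ).congr_deriv (by ring)) ht).trans h0

/-- At zero frequency the real part stays `0`, so the coupling disappears and the conserved energy
is that of a free wave. -/
theorem IsModeSolution.wave_energy {n : ℕ} {γ c s : ℝ} {σ₂ : Rn n → ℝ}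
    {hσ : IsFormFunction₂ σ₂} {X : ℝ → ModeSpace n} (h : IsModeSolution γ c 0 s hσ X)
    (h0 : (X 0).1 = 0) {t : ℝ} (ht : 0 ≤ t) :
    c ^ 2 * ‖(X t).2.2.2‖ ^ 2 + 1 / 4 * HDot.gradNorm (X t).2.2.1 ^ 2
      = c ^ 2 * ‖(X 0).2.2.2‖ ^ 2 + 1 / 4 * HDot.gradNorm (X 0).2.2.1 ^ 2 := by
  have he := h.energy_eq ht
  rw [modeEnergy_eq, modeEnergy_eq, h.re_eq_zero h0 ht, h0] at he
  linarith

/-- In dimension at least five the zero mode stays bounded. -/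
theorem exists_zero_mode_bound_of_five_le {n : ℕ} (hn : 5 ≤ n) {γ c s : ℝ} (hc : 0 < c)
    {σ₂ : Rn n → ℝ} (hσ : IsFormFunction₂ σ₂) (x₀ : ModeSpace n) (hx : x₀.1 = 0) :
    ∃ K, ∀ X : ℝ → ModeSpace n, IsModeSolution γ c 0 s hσ X → X 0 = x₀ →
      ∀ t, 0 ≤ t → |(X t).2.1| ≤ K := by
  obtain ⟨C, hC, hCb⟩ := hσ.exists_functional_le hn
  set E : ℝ := c ^ 2 * ‖x₀.2.2.2‖ ^ 2 + 1 / 4 * HDot.gradNorm x₀.2.2.1 ^ 2 with hE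
  have hE0 : 0 ≤ E := by positivity
  -- The outer `2` comes from `-Δ ∫ ψ = 2 (ϖ(t) - ϖ(0))`, and each root bounds one of the two norms
  -- through the wave energy.
  refine ⟨|x₀.2.1| + |γ * s| * (C * (2 * (√(E / c ^ 2) + √(E / c ^ 2)))), ?_⟩
  rintro X h rfl t ht
  have hw : ∀ τ, 0 ≤ τ → ‖(X τ).2.2.2‖ ≤ √(E / c ^ 2) := fun τ hτ => by
    refine Real.le_sqrt_of_sq_le ?_
    rw [le_div_iff₀ (by positivity)]
    have := h.wave_energy hx hτ
    have := sq_nonneg (HDot.gradNorm (X τ).2.2.1)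
    linarith
  have hI : (∫ τ in (0 : ℝ)..t, X τ).1 = 0 := by
    have h1 : modeRe n (∫ τ in (0 : ℝ)..t, X τ) = ∫ τ in (0 : ℝ)..t, modeRe n (X τ) :=
      ((modeRe n).intervalIntegral_comp_comm
        ((h.continuousOn.mono (by rw [uIcc_of_le ht]; exact fun x hx => hx.1)).intervalIntegrable)).symm
    refine h1.trans (intervalIntegral.integral_zero_ae (Filter.Eventually.of_forall fun τ hτ => ?_))
    rw [uIoc_of_le ht] at hτ
    exact h.re_eq_zero hx hτ.1.le
  have hD := sub_eq_clm_integral h.continuousOn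
      (-((0 : ℝ) / 2) • modeRe n - (γ * s) • (hσ.functional.comp (modePsi n))) h.im le_rfl ht
  have hD' : (X t).2.1 - (X 0).2.1
      = -((0 : ℝ) / 2) * (∫ τ in (0 : ℝ)..t, X τ).1
        - γ * s * hσ.value (∫ τ in (0 : ℝ)..t, X τ).2.2.1 := hD
  have hF := hCb _ _ (h.weak_pi le_rfl ht)
  have hF' : |hσ.value (∫ τ in (0 : ℝ)..t, X τ).2.2.1|
      ≤ C * (2 * (√(E / c ^ 2) + √(E / c ^ 2))) := by
    refine hF.trans (mul_le_mul_of_nonneg_left ?_ hC)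
    refine (norm_smul_le _ _).trans ?_
    rw [Real.norm_two]
    refine mul_le_mul_of_nonneg_left ?_ zero_le_two
    refine (norm_sub_le _ _).trans ?_
    have h0 : ‖(γ * s * (∫ τ in (0 : ℝ)..t, X τ).1) • hσ.schwartz.toLp 2 volume‖ = 0 := by
      refine (norm_smul _ _).trans ?_
      rw [hI]
      simp
    refine (add_le_add ((norm_sub_le _ _).trans (add_le_add (hw t ht) (hw 0 le_rfl))) h0.le).trans ?_
    rw [add_zero]
  have h5 : (X t).2.1 = (X 0).2.1 + -(γ * s * hσ.value (∫ τ in (0 : ℝ)..t, X τ).2.2.1) := by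
    linarith
  refine (congrArg abs h5).le.trans ((abs_add_le _ _).trans (add_le_add le_rfl ?_))
  refine (abs_neg _).le.trans ((abs_mul _ _).le.trans ?_)
  exact mul_le_mul_of_nonneg_left hF' (abs_nonneg _)

/-- Without wave data the zero mode is constant. -/
theorem exists_zero_mode_bound_of_eq_zero {n : ℕ} (hn : 3 ≤ n) {γ c s : ℝ}
    {σ₂ : Rn n → ℝ} (hσ : IsFormFunction₂ σ₂) (x₀ : ModeSpace n) (hx : x₀.1 = 0)
    (h1 : x₀.2.2.1 = 0) (h2 : x₀.2.2.2 = 0) :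
    ∃ K, ∀ X : ℝ → ModeSpace n, IsModeSolution γ c 0 s hσ X → X 0 = x₀ →
      ∀ t, 0 ≤ t → |(X t).2.1| ≤ K := by
  refine ⟨|x₀.2.1|, ?_⟩
  rintro X h rfl t ht
  -- The free wave energy vanishes initially, hence always, so the forcing of the imaginary part is
  -- zero.
  have hv : ∀ τ, 0 ≤ τ → hσ.value (X τ).2.2.1 = 0 := fun τ hτ => by
    have he := h.wave_energy hx hτ
    rw [h1, h2, HDot.gradNorm_zero, norm_zero] at he
    have h3 : 0 ≤ c ^ 2 * ‖(X τ).2.2.2‖ ^ 2 := by positivity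
    have h4 : HDot.gradNorm (X τ).2.2.1 = 0 := by
      have := sq_nonneg (HDot.gradNorm (X τ).2.2.1)
      have h5 : HDot.gradNorm (X τ).2.2.1 ^ 2 = 0 := by linarith
      exact pow_eq_zero_iff two_ne_zero |>.1 h5
    have h6 : |hσ.value (X τ).2.2.1| ≤ √(kappa σ₂) * HDot.gradNorm (X τ).2.2.1 :=
      hσ.abs_functional_le hn _
    rw [h4, mul_zero] at h6
    exact abs_nonpos_iff.1 h6
  refine (congrArg abs (eq_of_hasDerivWithinAt_zero (f := fun τ => (X τ).2.1)
    (fun τ hτ => (h.im τ hτ).congr_deriv ?_) ht)).le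
  rw [hv τ hτ]
  ring

/-! ### Hartley coefficients of vector-valued functions -/

theorem memLp_torusCas_smul {d : ℕ} {F : Type*} [NormedAddCommGroup F] [NormedSpace ℝ F]
    (k : Fin d → ℤ) {f : Torus d → F} {p : ℝ≥0∞} (hf : MemLp f p volume) :
    MemLp (fun x => torusCas k x • f x) p (volume : Measure (Torus d)) :=
  hf.of_le_mul (c := 2) ((torusCas k).continuous.aestronglyMeasurable.smul hf.1)
    (Filter.Eventually.of_forall fun x => by
      rw [norm_smul]
      exact mul_le_mul_of_nonneg_right (abs_torusCas_le k x) (norm_nonneg _))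

theorem integrable_torusCas_smul {d : ℕ} {F : Type*} [NormedAddCommGroup F] [NormedSpace ℝ F]
    (k : Fin d → ℤ) {f : Torus d → F} (hf : MemLp f 2 volume) :
    Integrable (fun x => torusCas k x • f x) (volume : Measure (Torus d)) :=
  (memLp_torusCas_smul k hf).integrable one_le_two

theorem integrable_norm_Lp_le {d : ℕ} {F : Type*} [NormedAddCommGroup F]
    (f : Lp F 2 (volume : Measure (Torus d))) :
    ∫ x, ‖f x‖ ≤ √(torusMass d) * ‖f‖ := by
  have hf := Lp.memLp f
  have h1 : Integrable (fun x => f x) (volume : Measure (Torus d)) := hf.integrable one_le_two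
  rw [integral_norm_eq_lintegral_enorm h1.1, ← eLpNorm_one_eq_lintegral_enorm, Lp.norm_def,
    mul_comm (√(torusMass d))]
  have h2 := eLpNorm_le_eLpNorm_mul_rpow_measure_univ (μ := (volume : Measure (Torus d)))
    (p := 1) (q := 2) one_le_two hf.1
  have h3 : √(torusMass d)
      = ((volume : Measure (Torus d)) univ ^ (1 / (1 : ℝ≥0∞).toReal - 1 / (2 : ℝ≥0∞).toReal)).toReal := by
    rw [Real.sqrt_eq_rpow, torusMass, Measure.real, ENNReal.toReal_rpow]
    norm_num
  rw [h3, ← ENNReal.toReal_mul]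
  refine ENNReal.toReal_mono (ENNReal.mul_ne_top hf.eLpNorm_ne_top ?_) h2
  refine (ENNReal.rpow_lt_top_of_nonneg ?_ (measure_ne_top _ _)).ne
  norm_num

/-- The Hartley coefficient as a continuous linear map. -/
def casCLM (F : Type*) [NormedAddCommGroup F] [NormedSpace ℝ F] {d : ℕ} (k : Fin d → ℤ) :
    Lp F 2 (volume : Measure (Torus d)) →L[ℝ] F :=
  LinearMap.mkContinuous
    { toFun := fun f => casCoeff k f
      map_add' := fun f g => by
        unfold casCoeff
        rw [← integral_add (integrable_torusCas_smul k (Lp.memLp f))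
          (integrable_torusCas_smul k (Lp.memLp g))]
        refine integral_congr_ae ?_
        filter_upwards [Lp.coeFn_add f g] with x hx
        rw [hx, Pi.add_apply, smul_add]
      map_smul' := fun r f => by
        unfold casCoeff
        rw [RingHom.id_apply, ← integral_smul]
        refine integral_congr_ae ?_
        filter_upwards [Lp.coeFn_smul r f] with x hx
        rw [hx, Pi.smul_apply, smul_comm] }
    (2 * √(torusMass d)) fun f => by
      refine (norm_integral_le_integral_norm _).trans ?_
      rw [mul_assoc]
      refine le_trans ?_ (mul_le_mul_of_nonneg_left (integrable_norm_Lp_le f) zero_le_two)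
      rw [← integral_const_mul]
      refine integral_mono (integrable_torusCas_smul k (Lp.memLp f)).norm
        (((Lp.memLp f).integrable one_le_two).norm.const_mul 2) fun x => ?_
      change ‖torusCas k x • f x‖ ≤ 2 * ‖f x‖
      rw [norm_smul]
      exact mul_le_mul_of_nonneg_right (abs_torusCas_le k x) (norm_nonneg _)

theorem casCoeff_clm {d : ℕ} {F G : Type*} [NormedAddCommGroup F] [NormedSpace ℝ F]
    [NormedAddCommGroup G] [NormedSpace ℝ G] [CompleteSpace F] [CompleteSpace G]
    (L : F →L[ℝ] G) (k : Fin d → ℤ) (f : Lp F 2 (volume : Measure (Torus d))) :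
    L (casCoeff k f) = ∫ x, torusCas k x • L (f x) := by
  unfold casCoeff
  rw [← L.integral_comp_comm (integrable_torusCas_smul k (Lp.memLp f))]
  simp_rw [map_smul]

theorem casCoeff_zero {d : ℕ} {F : Type*} [NormedAddCommGroup F] [NormedSpace ℝ F]
    (f : Torus d → F) : casCoeff 0 f = ∫ x, f x := by
  unfold casCoeff
  simp_rw [torusCas_zero, one_smul]

/-- A Bessel inequality. -/
theorem sum_le_of_orthogonal {ι H : Type*} [DecidableEq ι] [NormedAddCommGroup H]
    [InnerProductSpace ℝ H] {N : ℝ} (hN : 0 < N) (x : H) (w : ι → H) (a : ι → ℝ)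
    (h1 : ∀ k, inner ℝ (w k) x = a k)
    (h2 : ∀ k l, inner ℝ (w k) (w l) = if k = l then N * a k else 0) (S : Finset ι) :
    ∑ k ∈ S, a k ≤ N * ‖x‖ ^ 2 := by
  have h3 : inner ℝ (∑ k ∈ S, w k) x = ∑ k ∈ S, a k := by
    rw [sum_inner]
    simp_rw [h1]
  have h4 : inner ℝ (∑ k ∈ S, w k) (∑ k ∈ S, w k) = N * ∑ k ∈ S, a k := by
    rw [sum_inner, Finset.mul_sum]
    refine Finset.sum_congr rfl fun k hk => ?_
    rw [inner_sum]
    simp_rw [h2]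
    rw [Finset.sum_ite_eq, if_pos hk]
  -- Expanding gives `0 ≤ N² ‖x‖² - N ∑ a k`.
  have h5 : 0 ≤ inner ℝ (N • x - ∑ k ∈ S, w k) (N • x - ∑ k ∈ S, w k) := real_inner_self_nonneg
  rw [inner_sub_left, inner_sub_right, inner_sub_right, h4, inner_smul_left, inner_smul_left,
    inner_smul_right, inner_smul_right, h3, real_inner_comm (∑ k ∈ S, w k) x, h3,
    real_inner_self_eq_norm_sq] at h5
  simp only [conj_trivial] at h5
  have h6 : N * (∑ k ∈ S, a k) ≤ N * (N * ‖x‖ ^ 2) := by linarith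
  exact le_of_mul_le_mul_left h6 hN

/-- The functions `cas k • casCoeff k f` are orthogonal in `L²(𝕋^d; F)`. Only the Bessel inequality
is needed, since it is applied to initial data. -/
theorem sum_norm_sq_casCoeff_le {d : ℕ} {F : Type*} [NormedAddCommGroup F] [InnerProductSpace ℝ F]
    [CompleteSpace F] (f : Lp F 2 (volume : Measure (Torus d))) (S : Finset (Fin d → ℤ)) :
    ∑ k ∈ S, ‖casCoeff k f‖ ^ 2 ≤ torusMass d * ‖f‖ ^ 2 := by
  have hm : ∀ k : Fin d → ℤ, MemLp (fun x => torusCas k x • casCoeff k f) 2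
      (volume : Measure (Torus d)) := fun k =>
    memLp_torusCas_smul k (memLp_const _)
  refine sum_le_of_orthogonal (torusMass_pos d) f (fun k => (hm k).toLp _) _ (fun k => ?_)
    (fun k l => ?_) S
  · have h := casCoeff_clm (innerSL ℝ (casCoeff k f)) k f
    rw [innerSL_apply_apply, real_inner_self_eq_norm_sq] at h
    rw [h, MeasureTheory.L2.inner_def]
    refine integral_congr_ae ?_
    filter_upwards [(hm k).coeFn_toLp] with x hx
    rw [hx, inner_smul_left, innerSL_apply_apply]
    rfl
  · rw [MeasureTheory.L2.inner_def]
    have h : ∫ x, inner ℝ ((hm k).toLp _ x) ((hm l).toLp _ x)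
        = ∫ x, (torusCas k x * torusCas l x) * inner ℝ (casCoeff k f) (casCoeff l f) := by
      refine integral_congr_ae ?_
      filter_upwards [(hm k).coeFn_toLp, (hm l).coeFn_toLp] with x hx hy
      rw [hx, hy, real_inner_smul_left, real_inner_smul_right, mul_assoc]
    rw [h, integral_mul_const, integral_torusCas_mul]
    split_ifs with hkl
    · rw [← hkl, real_inner_self_eq_norm_sq]
    · rw [zero_mul]

/-! ### Hartley coefficients on the product -/

theorem memLp_torusCas_mul_prod {d n : ℕ} (k : Fin d → ℤ) {η : Rn n → ℝ}
    (hη : MemLp η 2 (volume : Measure (Rn n))) :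
    MemLp (fun p : Torus d × Rn n => torusCas k p.1 * η p.2) 2 volume := by
  refine (memLp_two_iff_integrable_sq ?_).2 ?_
  · exact ((torusCas k).continuous.comp continuous_fst).aestronglyMeasurable.mul hη.1.comp_snd
  · simp_rw [mul_pow]
    exact Integrable.mul_prod (f := fun x => torusCas k x ^ 2) (g := fun z => η z ^ 2)
      (integrable_of_continuous (by fun_prop)) hη.integrable_sq

/-- The tensor product of a Hartley function with a function of the transverse variable. -/
def casTensorFun {d n : ℕ} (k : Fin d → ℤ) (η : Lp ℝ 2 (volume : Measure (Rn n))) : L2Prod d n :=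
  (memLp_torusCas_mul_prod k (Lp.memLp η)).toLp _

theorem coeFn_casTensorFun {d n : ℕ} (k : Fin d → ℤ) (η : Lp ℝ 2 (volume : Measure (Rn n))) :
    casTensorFun k η =ᵐ[volume] fun p : Torus d × Rn n => torusCas k p.1 * η p.2 :=
  MemLp.coeFn_toLp _

theorem ae_prod_snd {d n : ℕ} {P : Rn n → Prop} (h : ∀ᵐ z, P z) :
    ∀ᵐ p : Torus d × Rn n, P p.2 :=
  Measure.quasiMeasurePreserving_snd.ae h

theorem inner_casTensorFun {d n : ℕ} (k l : Fin d → ℤ) (η θ : Lp ℝ 2 (volume : Measure (Rn n))) :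
    inner ℝ (casTensorFun (d := d) k η) (casTensorFun l θ)
      = if k = l then torusMass d * inner ℝ η θ else 0 := by
  rw [MeasureTheory.L2.inner_def]
  have h : ∫ p, inner ℝ (casTensorFun (d := d) k η p) (casTensorFun l θ p)
      = ∫ p : Torus d × Rn n, (torusCas k p.1 * torusCas l p.1) * (inner ℝ (η p.2) (θ p.2)) := by
    refine integral_congr_ae ?_
    filter_upwards [coeFn_casTensorFun k η, coeFn_casTensorFun l θ] with p hx hy
    rw [hx, hy]
    simp only [RCLike.inner_apply, conj_trivial]
    ring
  rw [h, Measure.volume_eq_prod, integral_prod_mul (fun x => torusCas k x * torusCas l x)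
    (fun z => inner ℝ (η z) (θ z)), integral_torusCas_mul, MeasureTheory.L2.inner_def]
  split_ifs
  · rfl
  · rw [zero_mul]

/-- The tensor product with a Hartley function as a continuous linear map. -/
def casTensor {d : ℕ} (n : ℕ) (k : Fin d → ℤ) :
    Lp ℝ 2 (volume : Measure (Rn n)) →L[ℝ] L2Prod d n :=
  LinearMap.mkContinuous
    { toFun := casTensorFun k
      map_add' := fun η θ => by
        refine Lp.ext ?_
        filter_upwards [coeFn_casTensorFun (d := d) k (η + θ), coeFn_casTensorFun (d := d) k η,
          coeFn_casTensorFun (d := d) k θ, Lp.coeFn_add (casTensorFun (d := d) k η) (casTensorFun k θ),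
          ae_prod_snd (Lp.coeFn_add η θ)] with p h1 h2 h3 h4 h5
        rw [h1, h4, Pi.add_apply, h2, h3, h5, Pi.add_apply, mul_add]
      map_smul' := fun r η => by
        refine Lp.ext ?_
        filter_upwards [coeFn_casTensorFun (d := d) k (r • η), coeFn_casTensorFun (d := d) k η,
          Lp.coeFn_smul r (casTensorFun (d := d) k η),
          ae_prod_snd (Lp.coeFn_smul r η)] with p h1 h2 h3 h4
        rw [RingHom.id_apply, h1, h3, Pi.smul_apply, h2, h4, Pi.smul_apply, smul_eq_mul, smul_eq_mul]
        ring }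
    (√(torusMass d)) fun η => by
      change ‖casTensorFun k η‖ ≤ _
      refine (sq_le_sq₀ (norm_nonneg _) (by positivity)).1 ?_
      rw [mul_pow, Real.sq_sqrt (torusMass_pos d).le, ← real_inner_self_eq_norm_sq,
        inner_casTensorFun, if_pos rfl, real_inner_self_eq_norm_sq]

/-- The Hartley coefficient of a function on `𝕋^d × ℝ^n`. -/
def casPartial {d : ℕ} (n : ℕ) (k : Fin d → ℤ) :
    L2Prod d n →L[ℝ] Lp ℝ 2 (volume : Measure (Rn n)) :=
  -- Duality defines the coefficient in `L²(ℝ^n)` without choosing slices of `f`, and gives its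
  -- continuity at once.
  ContinuousLinearMap.adjoint (casTensor n k)

theorem inner_casPartial {d n : ℕ} (k : Fin d → ℤ) (η : Lp ℝ 2 (volume : Measure (Rn n)))
    (f : L2Prod d n) : inner ℝ η (casPartial n k f) = inner ℝ (casTensorFun k η) f :=
  ContinuousLinearMap.adjoint_inner_right (casTensor n k) η f

theorem sum_norm_sq_casPartial_le {d n : ℕ} (f : L2Prod d n) (S : Finset (Fin d → ℤ)) :
    ∑ k ∈ S, ‖casPartial n k f‖ ^ 2 ≤ torusMass d * ‖f‖ ^ 2 := by
  refine sum_le_of_orthogonal (torusMass_pos d) f (fun k => casTensorFun k (casPartial n k f)) _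
    (fun k => ?_) (fun k l => ?_) S
  · rw [← inner_casPartial, real_inner_self_eq_norm_sq]
  · rw [inner_casTensorFun]
    split_ifs with h
    · rw [← h, real_inner_self_eq_norm_sq]
    · rfl

theorem integral_casPartial_mul {d n : ℕ} (k : Fin d → ℤ) {η : Rn n → ℝ} (h1 : Continuous η)
    (h2 : HasCompactSupport η) (f : L2Prod d n) :
    ∫ z, casPartial n k f z * η z = ∫ p : Torus d × Rn n, f p * (torusCas k p.1 * η p.2) := by
  have h := inner_casPartial k ((memLp_test h1 h2 2).toLp η) f
  rw [inner_toLp_left, MeasureTheory.L2.inner_def] at h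
  refine Eq.trans ?_ (h.trans (integral_congr_ae ?_))
  · exact integral_congr_ae (Filter.Eventually.of_forall fun z => rfl)
  · filter_upwards [coeFn_casTensorFun (d := d) k ((memLp_test h1 h2 2).toLp η),
      ae_prod_snd (memLp_test h1 h2 2).coeFn_toLp] with p hp hq
    rw [hp, hq]
    rfl

theorem casPartial_zero_eq_zero {d n : ℕ} {f : L2Prod d n}
    (hf : ∀ᵐ z : Rn n, ∫ x, f (x, z) = 0) : casPartial n 0 f = 0 := by
  have h : inner ℝ (casPartial n 0 f) (casPartial n 0 f) = 0 := by
    rw [inner_casPartial, MeasureTheory.L2.inner_def]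
    set η := casPartial n 0 f
    have hint : Integrable (fun p => inner ℝ (casTensorFun (d := d) 0 η p) (f p)) volume :=
      MeasureTheory.L2.integrable_inner _ _
    have he : (fun p => inner ℝ (casTensorFun (d := d) 0 η p) (f p))
        =ᵐ[volume] fun p : Torus d × Rn n => η p.2 * f p := by
      filter_upwards [coeFn_casTensorFun (d := d) 0 η] with p hp
      rw [hp, torusCas_zero, one_mul]
      exact mul_comm _ _
    rw [integral_congr_ae he]
    have hint2 := hint.congr he
    refine (integral_prod_symm _ hint2).trans (integral_eq_zero_of_ae ?_)
    filter_upwards [hf] with z hz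
    exact (integral_const_mul (η z) fun x => f (x, z)).trans (by rw [hz, mul_zero]; rfl)
  exact inner_self_eq_zero.1 h

/-! ### The modes of a solution -/

/-- The eigenvalue of the convolution with `σ₁` on the Hartley functions of index `k`. -/
def convEigenvalue {d : ℕ} (σ₁ : Torus d → ℝ) (k : Fin d → ℤ) : ℝ :=
  ∫ x, σ₁ x * (torusChar k x).re

theorem IsFormFunction₁.continuous {d : ℕ} {σ₁ : Torus d → ℝ} (h : IsFormFunction₁ σ₁) :
    Continuous σ₁ := h.smooth.continuous

theorem IsFormFunction₁.apply_neg {d : ℕ} {σ₁ : Torus d → ℝ} (h : IsFormFunction₁ σ₁)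
    (x : Torus d) : σ₁ (-x) = σ₁ x :=
  h.radial _ _ (by simp only [Pi.neg_apply, norm_neg])

theorem IsFormFunction₁.abs_convEigenvalue_le {d : ℕ} {σ₁ : Torus d → ℝ}
    (h : IsFormFunction₁ σ₁) (k : Fin d → ℤ) : |convEigenvalue σ₁ k| ≤ ∫ x, |σ₁ x| := by
  refine (norm_integral_le_integral_norm (fun x => σ₁ x * (torusChar k x).re)).trans
    (integral_mono ?_ ?_ fun x => ?_)
  · exact (integrable_of_continuous (h.continuous.mul
      (Complex.continuous_re.comp (torusChar k).continuous))).norm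
  · exact integrable_of_continuous h.continuous.abs
  · simp only [Real.norm_eq_abs, abs_mul]
    refine mul_le_of_le_one_right (abs_nonneg _) ?_
    exact (Complex.abs_re_le_norm _).trans (norm_torusChar_apply k x).le

/-- Radial symmetry makes `σ₁` even, so the sine part of the shifted Hartley function drops out. -/
theorem IsFormFunction₁.integral_mul_torusCas_add {d : ℕ} {σ₁ : Torus d → ℝ}
    (h : IsFormFunction₁ σ₁) (k : Fin d → ℤ) (y : Torus d) :
    ∫ x, σ₁ (x - y) * torusCas k x = convEigenvalue σ₁ k * torusCas k y := by
  have h0 : ∫ x, σ₁ x * (torusChar k x).im = 0 := by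
    have := Measure.IsAddHaarMeasure.isNegInvariant_of_regular (volume : Measure (Torus d))
    have h1 := integral_neg_eq_self (fun x => σ₁ x * (torusChar k x).im) (volume : Measure (Torus d))
    simp_rw [h.apply_neg, torusChar_neg_apply, Complex.conj_im, mul_neg, integral_neg] at h1
    linarith
  rw [← integral_add_right_eq_self _ y]
  simp_rw [add_sub_cancel_right, torusCas_add]
  have e : ∀ x, σ₁ x * ((torusChar k x).re * torusCas k y + (torusChar k x).im * torusCas (-k) y)
      = σ₁ x * (torusChar k x).re * torusCas k y
        + σ₁ x * (torusChar k x).im * torusCas (-k) y := fun x => by ring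
  simp_rw [e]
  have hc := (torusChar k).continuous
  rw [integral_add (integrable_of_continuous (by have := h.continuous; fun_prop))
    (integrable_of_continuous (by have := h.continuous; fun_prop)),
    integral_mul_const, integral_mul_const, h0, zero_mul, add_zero, convEigenvalue]

theorem IsFormFunction₁.integral_torusConv_mul {d : ℕ} {σ₁ : Torus d → ℝ}
    (h : IsFormFunction₁ σ₁) (k : Fin d → ℤ) {m : Torus d → ℝ} (hm : Integrable m) :
    ∫ x, torusConv σ₁ m x * torusCas k x = convEigenvalue σ₁ k * ∫ y, torusCas k y * m y := by
  unfold torusConv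
  simp_rw [← integral_mul_const]
  have hg : Integrable (fun p : Torus d × Torus d => m p.2) (volume.prod volume) :=
    hm.comp_snd volume
  have hint : Integrable (Function.uncurry fun x y => σ₁ (x - y) * m y * torusCas k x)
      ((volume : Measure (Torus d)).prod volume) := by
    have hc : Continuous fun p : Torus d × Torus d => σ₁ (p.1 - p.2) * torusCas k p.1 := by
      have := h.continuous
      fun_prop
    obtain ⟨C, hC⟩ := isCompact_univ.exists_bound_of_continuousOn (hc.continuousOn (s := univ))
    refine (hg.bdd_mul (c := C) hc.aestronglyMeasurable
      (Filter.Eventually.of_forall fun p => hC p (mem_univ p))).congr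
      (Filter.Eventually.of_forall fun p => ?_)
    simp only [Function.uncurry]
    ring
  rw [integral_integral_swap hint, ← integral_const_mul]
  refine integral_congr_ae (Filter.Eventually.of_forall fun y => ?_)
  simp only
  rw [← mul_assoc, ← h.integral_mul_torusCas_add, ← integral_mul_const]
  refine integral_congr_ae (Filter.Eventually.of_forall fun x => ?_)
  simp only
  ring

theorem isTestFunction_torusCas_mul {d n : ℕ} (k : Fin d → ℤ) {η : Rn n → ℝ} (h1 : ContDiff ℝ ∞ η)
    (h2 : HasCompactSupport η) :
    IsTestFunction (fun p : Torus d × Rn n => torusCas k p.1 * η p.2) where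
  smooth := (ContDiff.comp (g := fun x : Fin d → ℝ => torusCas k (torusProj x))
    (torusSmooth_torusCas k) contDiff_fst).mul (h1.comp contDiff_snd)
  compactSupport := by
    refine HasCompactSupport.intro (isCompact_univ.prod h2) fun p hp => ?_
    have : p.2 ∉ tsupport η := fun h => hp ⟨mem_univ _, h⟩
    rw [image_eq_zero_of_notMem_tsupport this, mul_zero]

theorem gradient_const_mul {n : ℕ} {η : Rn n → ℝ} (h1 : ContDiff ℝ ∞ η) (a : ℝ) (z : Rn n) :
    gradient (fun w => a * η w) z = a • gradient η z := by
  unfold gradient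
  rw [fderiv_const_mul (h1.differentiable (by simp) z), map_smul]

theorem integral_toFun_test {d n : ℕ} (k : Fin d → ℤ) {η : Rn n → ℝ} (h1 : ContDiff ℝ ∞ η)
    (h2 : HasCompactSupport η) (ψ : L2HDot d n) :
    ∫ x, ∫ z, HDot.toFun (ψ x) z * (torusCas k x * η z)
      = ∫ z, HDot.toFun (casCoeff k ψ) z * η z := by
  refine Eq.trans ?_ ((casCoeff_clm (HDot.pair h1.continuous h2) k ψ).symm.trans
    (HDot.pair_apply h1.continuous h2 _))
  refine integral_congr_ae (Filter.Eventually.of_forall fun x => ?_)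
  refine Eq.trans ?_ (congrArg (torusCas k x • ·) (HDot.pair_apply h1.continuous h2 (ψ x)).symm)
  simp only [smul_eq_mul]
  rw [← integral_const_mul]
  refine integral_congr_ae (Filter.Eventually.of_forall fun z => ?_)
  simp only
  ring

theorem integral_grad_test {d n : ℕ} (k : Fin d → ℤ) {η : Rn n → ℝ} (h1 : ContDiff ℝ ∞ η)
    (h2 : HasCompactSupport η) (ψ : L2HDot d n) :
    ∫ x, ∫ z, inner ℝ (HDot.grad (ψ x) z) (gradient (fun w => torusCas k x * η w) z)
      = ∫ z, inner ℝ (HDot.grad (casCoeff k ψ) z) (gradient η z) := by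
  refine Eq.trans ?_ ((casCoeff_clm (HDot.gradPair
    ((memLp_gradient_test h1 h2).toLp (gradient η))) k ψ).symm.trans
    (HDot.integral_inner_grad_gradient h1 h2 _).symm)
  refine integral_congr_ae (Filter.Eventually.of_forall fun x => ?_)
  refine Eq.trans ?_ (congrArg (torusCas k x • ·) (HDot.integral_inner_grad_gradient h1 h2 (ψ x)))
  simp only [smul_eq_mul]
  rw [← integral_const_mul]
  refine integral_congr_ae (Filter.Eventually.of_forall fun z => ?_)
  simp only
  rw [gradient_const_mul h1, real_inner_smul_right]

theorem integral_potential_mul {d n : ℕ} {σ₁ : Torus d → ℝ} {σ₂ : Rn n → ℝ}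
    (hσ₁ : IsFormFunction₁ σ₁) (hσ₂ : IsFormFunction₂ σ₂) (k : Fin d → ℤ) (ψ : L2HDot d n) :
    ∫ x, potential σ₁ σ₂ ψ x * torusCas k x
      = convEigenvalue σ₁ k * hσ₂.value (casCoeff k ψ) := by
  have e : ∀ y, ∫ z, σ₂ z * HDot.toFun (ψ y) z = hσ₂.functional (ψ y) := fun y => by
    refine Eq.trans ?_ (HDot.pair_apply hσ₂.smooth.continuous hσ₂.compactSupport (ψ y)).symm
    simp_rw [mul_comm]
  have hint : Integrable (fun y => ∫ z, σ₂ z * HDot.toFun (ψ y) z) := by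
    simp_rw [e]
    exact hσ₂.functional.integrable_comp ((Lp.memLp ψ).integrable one_le_two)
  refine (hσ₁.integral_torusConv_mul k hint).trans (congrArg _ ?_)
  simp_rw [e]
  exact (casCoeff_clm hσ₂.functional k ψ).symm

/-- The mode of index `k` of a state. -/
def modeState {d n : ℕ} (k : Fin d → ℤ) (u : H1Torus d) (ψ : L2HDot d n) (ϖ : L2Prod d n) :
    ModeSpace n :=
  ((casCoeff k (H1Torus.toFun u)).re, (casCoeff k (H1Torus.toFun u)).im, casCoeff k ψ,
    casPartial n k ϖ)

theorem continuous_casCoeff_toFun {d : ℕ} (k : Fin d → ℤ) :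
    Continuous fun u : H1Torus d => casCoeff k (H1Torus.toFun u) :=
  (casCLM ℂ k).continuous.comp ((WithLp.continuous_fst 2 _ _).comp continuous_subtype_val)

theorem casCoeff_complex {d : ℕ} (k : Fin d → ℤ) (f : Torus d → ℂ) :
    casCoeff k f = ∫ x, f x * (torusCas k x : ℂ) := by
  unfold casCoeff
  refine integral_congr_ae (Filter.Eventually.of_forall fun x => ?_)
  simp only
  rw [Complex.real_smul, mul_comm]

theorem casCoeff_re {d : ℕ} (k : Fin d → ℤ) (f : L2Torus d) :
    ∫ x, torusCas k x * (f x).re = (casCoeff k f).re :=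
  (casCoeff_clm Complex.reCLM k f).symm

/-- The Schrödinger equation is tested against `cas k`. The forcing is real because both `cas k` and
the potential are real, so after multiplication by `-i` it enters only the imaginary part. -/
theorem IsSolution.hasDerivWithinAt_casCoeff {d n : ℕ} {γ c : ℝ} {σ₁ : Torus d → ℝ}
    {σ₂ : Rn n → ℝ} (hσ₁ : IsFormFunction₁ σ₁) (hσ₂ : IsFormFunction₂ σ₂)
    {u : ℝ → H1Torus d} {ψ : ℝ → L2HDot d n} {ϖ : ℝ → L2Prod d n}
    (h : IsSolution γ c σ₁ σ₂ u ψ ϖ) (k : Fin d → ℤ) {t : ℝ} (ht : t ∈ Ici (0 : ℝ)) :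
    HasDerivWithinAt (fun s => casCoeff k (H1Torus.toFun (u s)))
      (-Complex.I * ((freqSq k : ℂ) / 2 * casCoeff k (H1Torus.toFun (u t))
        + (γ * convEigenvalue σ₁ k * hσ₂.value (casCoeff k (ψ t)) : ℝ))) (Ici 0) t := by
  have h1 := (h.schrodinger _ (torusSmooth_ofReal_torusCas k) t ht).const_mul (-Complex.I)
  have e1 : ∀ s, -Complex.I * (Complex.I * ∫ x, H1Torus.toFun (u s) x * (torusCas k x : ℂ))
      = casCoeff k (H1Torus.toFun (u s)) := fun s => by
    rw [casCoeff_complex, ← mul_assoc, neg_mul, Complex.I_mul_I, neg_neg, one_mul]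
  simp_rw [e1] at h1
  refine h1.congr_deriv (congrArg _ ?_)
  have e2 : ∫ x, H1Torus.toFun (u t) x * torusLaplacian (fun x => (torusCas k x : ℂ)) x
      = -(freqSq k : ℂ) * casCoeff k (H1Torus.toFun (u t)) := by
    rw [casCoeff_complex, ← integral_const_mul]
    refine integral_congr_ae (Filter.Eventually.of_forall fun x => ?_)
    simp only
    rw [torusLaplacian_torusCas]
    ring
  have e3 : ∫ x, (potential σ₁ σ₂ (ψ t) x : ℂ) * (torusCas k x : ℂ)
      = ((convEigenvalue σ₁ k * hσ₂.value (casCoeff k (ψ t)) : ℝ) : ℂ) := by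
    rw [← integral_potential_mul hσ₁ hσ₂]
    refine Eq.trans ?_ integral_ofReal
    exact integral_congr_ae (Filter.Eventually.of_forall fun x => (Complex.ofReal_mul _ _).symm)
  rw [e2, e3]
  push_cast
  ring

theorem IsSolution.isModeSolution {d n : ℕ} {γ c : ℝ} {σ₁ : Torus d → ℝ}
    {σ₂ : Rn n → ℝ} (hσ₁ : IsFormFunction₁ σ₁) (hσ₂ : IsFormFunction₂ σ₂)
    {u : ℝ → H1Torus d} {ψ : ℝ → L2HDot d n} {ϖ : ℝ → L2Prod d n}
    (h : IsSolution γ c σ₁ σ₂ u ψ ϖ) (k : Fin d → ℤ) :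
    IsModeSolution γ c (freqSq k) (convEigenvalue σ₁ k) hσ₂
      fun t => modeState k (u t) (ψ t) (ϖ t) where
  continuousOn := by
    have h1 := (continuous_casCoeff_toFun k).comp_continuousOn h.continuousOn_u
    exact (Complex.continuous_re.comp_continuousOn h1).prodMk
      ((Complex.continuous_im.comp_continuousOn h1).prodMk
        (((casCLM (HDot n) k).continuous.comp_continuousOn h.continuousOn_ψ).prodMk
          ((casPartial n k).continuous.comp_continuousOn h.continuousOn_ϖ)))
  re := fun t ht => by
    refine (Complex.reCLM.hasFDerivAt.comp_hasDerivWithinAt t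
      (h.hasDerivWithinAt_casCoeff hσ₁ hσ₂ k ht)).congr_deriv ?_
    simp [modeState]
  im := fun t ht => by
    refine (Complex.imCLM.hasFDerivAt.comp_hasDerivWithinAt t
      (h.hasDerivWithinAt_casCoeff hσ₁ hσ₂ k ht)).congr_deriv ?_
    simp [modeState]
    ring
  velocity := fun η h1 h2 t ht => by
    have h3 := h.velocity _ (isTestFunction_torusCas_mul k h1 h2) t ht
    simp_rw [integral_toFun_test k h1 h2] at h3
    rwa [← integral_casPartial_mul k h1.continuous h2] at h3
  wave := fun η h1 h2 t ht => by
    have h3 := h.wave _ (isTestFunction_torusCas_mul k h1 h2) t ht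
    simp_rw [← integral_casPartial_mul k h1.continuous h2] at h3
    rw [integral_grad_test k h1 h2] at h3
    refine h3.congr_deriv (congrArg _ ?_)
    have hint : Integrable (fun y => (H1Torus.toFun (u t) y).re) :=
      ((Lp.memLp (u t).1.fst).integrable one_le_two).re
    have e : ∫ p : Torus d × Rn n,
            σ₂ p.2 * torusConv σ₁ (fun y => (H1Torus.toFun (u t) y).re) p.1
              * (torusCas k p.1 * η p.2)
        = (∫ x, torusConv σ₁ (fun y => (H1Torus.toFun (u t) y).re) x * torusCas k x)
          * ∫ z, σ₂ z * η z := by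
      rw [← integral_prod_mul, Measure.volume_eq_prod]
      refine integral_congr_ae (Filter.Eventually.of_forall fun p => ?_)
      simp only
      ring
    rw [e, hσ₁.integral_torusConv_mul k hint]
    have e4 : ∫ y, torusCas k y * (H1Torus.toFun (u t) y).re = (casCoeff k (H1Torus.toFun (u t))).re :=
      casCoeff_re k _
    rw [e4, modeState]
    ring

/-! ### The `H¹` norm and the summation of the modes -/

theorem casCoeff_snd {d : ℕ} (u : H1Torus d) (j : Fin d) (k : Fin d → ℤ) :
    casCoeff k (u.1.snd j) = -((k j : ℝ) : ℂ) * casCoeff (-k) (H1Torus.toFun u) := by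
  have h := u.2 j _ (torusSmooth_ofReal_torusCas k)
  rw [torusPartial_torusCas, ← casCoeff_complex] at h
  rw [← neg_eq_iff_eq_neg.2 h, casCoeff_complex, ← integral_const_mul, ← integral_neg]
  refine integral_congr_ae (Filter.Eventually.of_forall fun x => ?_)
  simp only [H1Torus.toFun]
  ring

/-- Parseval for `u` and each `∂_j u`. The coefficient of `∂_j u` at `k` is `-k_j` times that of `u`
at `-k`, so the sum is reindexed by `k ↦ -k`. -/
theorem hasSum_norm_sq_H1Torus {d : ℕ} (u : H1Torus d) :
    HasSum (fun k : Fin d → ℤ => (1 + freqSq k) * ‖casCoeff k (H1Torus.toFun u)‖ ^ 2)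
      (torusMass d * ‖u‖ ^ 2) := by
  have h1 := hasSum_norm_sq_casCoeff u.1.fst
  have h2 : ∀ j, HasSum (fun k : Fin d → ℤ => (k j : ℝ) ^ 2 * ‖casCoeff k (H1Torus.toFun u)‖ ^ 2)
      (torusMass d * ‖u.1.snd j‖ ^ 2) := fun j => by
    have h3 := hasSum_norm_sq_casCoeff (u.1.snd j)
    rw [← (Equiv.neg (Fin d → ℤ)).hasSum_iff]
    convert h3 using 2 with k
    rw [casCoeff_snd, norm_mul, mul_pow, norm_neg, Complex.norm_real, Real.norm_eq_abs, sq_abs]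
    simp
  have h4 := h1.add (hasSum_sum (s := Finset.univ) fun j _ => h2 j)
  have hn : ‖u‖ ^ 2 = ‖u.1.fst‖ ^ 2 + ∑ j, ‖u.1.snd j‖ ^ 2 := by
    rw [Submodule.coe_norm, WithLp.prod_norm_sq_eq_of_L2, PiLp.norm_sq_eq_of_L2]
  rw [hn, mul_add, Finset.mul_sum]
  convert h4 using 2 with k
  rw [add_mul, one_mul, freqSq, Finset.sum_mul]
  rfl

theorem modeState_norm_sq {d n : ℕ} (k : Fin d → ℤ) (u : H1Torus d) (ψ : L2HDot d n)
    (ϖ : L2Prod d n) : (modeState k u ψ ϖ).1 ^ 2 + (modeState k u ψ ϖ).2.1 ^ 2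
      = ‖casCoeff k (H1Torus.toFun u)‖ ^ 2 := by
  rw [← Complex.normSq_eq_norm_sq, Complex.normSq_apply, modeState]
  ring

/-- The norm of `HDot n` does not come from an inner product. The gradient commutes with Hartley
coefficients, so the Bessel inequality is applied to the gradients in `L²`. -/
theorem sum_gradNorm_sq_casCoeff_le {d n : ℕ} (ψ : L2HDot d n) (S : Finset (Fin d → ℤ)) :
    ∑ k ∈ S, HDot.gradNorm (casCoeff k ψ) ^ 2
      ≤ torusMass d * ‖(HDot.gradCLM n).compLp ψ‖ ^ 2 := by
  have h : ∀ k, HDot.gradNorm (casCoeff k ψ) = ‖casCoeff k ((HDot.gradCLM n).compLp ψ)‖ := fun k => by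
    refine congrArg norm ((casCoeff_clm (HDot.gradCLM n) k ψ).trans (integral_congr_ae ?_))
    filter_upwards [(HDot.gradCLM n).coeFn_compLp ψ] with x hx
    rw [hx]
  simp_rw [h]
  exact sum_norm_sq_casCoeff_le _ S

theorem exists_zero_mode_bound {d n : ℕ} (hn : 3 ≤ n) {γ c : ℝ} (hc : 0 < c)
    {σ₁ : Torus d → ℝ} {σ₂ : Rn n → ℝ} (hσ₁ : IsFormFunction₁ σ₁) (hσ₂ : IsFormFunction₂ σ₂)
    {uInit : H1Torus d} {ψInit : L2HDot d n} {ϖInit : L2Prod d n}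
    (hu : ∫ x, H1Torus.toFun uInit x = 0)
    (hmean : 5 ≤ n ∨ ((∫ x, ψInit x = 0) ∧ ∀ᵐ z : Rn n, ∫ x, ϖInit (x, z) = 0)) :
    ∃ K : ℝ, ∀ (u : ℝ → H1Torus d) (ψ : ℝ → L2HDot d n) (ϖ : ℝ → L2Prod d n),
      IsSolution γ c σ₁ σ₂ u ψ ϖ → u 0 = uInit → ψ 0 = ψInit → ϖ 0 = ϖInit →
        ∀ t : ℝ, 0 ≤ t → ‖casCoeff 0 (H1Torus.toFun (u t))‖ ≤ K := by
  have h0 : (modeState 0 uInit ψInit ϖInit).1 = 0 := by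
    rw [modeState, casCoeff_zero, hu, Complex.zero_re]
  have hK : ∃ K, ∀ X : ℝ → ModeSpace n,
      IsModeSolution γ c 0 (convEigenvalue σ₁ 0) hσ₂ X → X 0 = modeState 0 uInit ψInit ϖInit →
      ∀ t, 0 ≤ t → |(X t).2.1| ≤ K := by
    rcases hmean with h5 | ⟨h1, h2⟩
    · exact exists_zero_mode_bound_of_five_le h5 hc hσ₂ _ h0
    · exact exists_zero_mode_bound_of_eq_zero hn hσ₂ _ h0 ((casCoeff_zero _).trans h1)
        (casPartial_zero_eq_zero h2)
  obtain ⟨K, hK⟩ := hK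
  refine ⟨K, ?_⟩
  rintro u ψ ϖ h rfl rfl rfl t ht
  have hX := h.isModeSolution hσ₁ hσ₂ 0
  rw [show freqSq (0 : Fin d → ℤ) = 0 by simp [freqSq]] at hX
  have h1 := hX.re_eq_zero h0 ht
  have h2 := hK _ hX rfl t ht
  have h3 := modeState_norm_sq 0 (u t) (ψ t) (ϖ t)
  rw [h1, zero_pow two_ne_zero, zero_add, ← sq_abs] at h3
  rwa [← (pow_left_inj₀ (abs_nonneg _) (norm_nonneg _) two_ne_zero).1 h3]

/-- The size of the mode of index `k` of the initial data. -/
def modeSize {d n : ℕ} (c : ℝ) (u : H1Torus d) (ψ : L2HDot d n) (ϖ : L2Prod d n)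
    (k : Fin d → ℤ) : ℝ :=
  2 * ((1 + freqSq k) * ‖casCoeff k (H1Torus.toFun u)‖ ^ 2) + 4 * c ^ 2 * ‖casPartial n k ϖ‖ ^ 2
    + 2 * HDot.gradNorm (casCoeff k ψ) ^ 2

theorem modeSize_nonneg {d n : ℕ} (c : ℝ) (u : H1Torus d) (ψ : L2HDot d n) (ϖ : L2Prod d n)
    (k : Fin d → ℤ) : 0 ≤ modeSize c u ψ ϖ k := by
  have := freqSq_nonneg k
  unfold modeSize
  positivity

theorem sum_modeSize_le {d n : ℕ} (c : ℝ) (u : H1Torus d) (ψ : L2HDot d n) (ϖ : L2Prod d n)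
    (S : Finset (Fin d → ℤ)) :
    ∑ k ∈ S, modeSize c u ψ ϖ k ≤ 2 * (torusMass d * ‖u‖ ^ 2) + 4 * c ^ 2 * (torusMass d * ‖ϖ‖ ^ 2)
      + 2 * (torusMass d * ‖(HDot.gradCLM n).compLp ψ‖ ^ 2) := by
  unfold modeSize
  rw [Finset.sum_add_distrib, Finset.sum_add_distrib, ← Finset.mul_sum, ← Finset.mul_sum,
    ← Finset.mul_sum]
  have e1 := sum_le_hasSum S (fun k _ => mul_nonneg (add_nonneg zero_le_one (freqSq_nonneg k))
    (sq_nonneg _)) (hasSum_norm_sq_H1Torus u)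
  exact add_le_add (add_le_add (mul_le_mul_of_nonneg_left e1 zero_le_two)
    (mul_le_mul_of_nonneg_left (sum_norm_sq_casPartial_le ϖ S) (by positivity)))
    (mul_le_mul_of_nonneg_left (sum_gradNorm_sq_casCoeff_le ψ S) zero_le_two)

/-- The mode estimate controls `|k|² |u_k|²`. The factor `2` comes from `1 + |k|² ≤ 2 |k|²` for `k ≠
0`. -/
theorem IsSolution.norm_sq_casCoeff_le {d n : ℕ} (hn : 3 ≤ n) {γ c : ℝ}
    {σ₁ : Torus d → ℝ} {σ₂ : Rn n → ℝ} (hσ₁ : IsFormFunction₁ σ₁) (hσ₂ : IsFormFunction₂ σ₂)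
    (hsmall : 4 * γ ^ 2 * kappa σ₂ * (∫ x, |σ₁ x|) ^ 2 < 1)
    {u : ℝ → H1Torus d} {ψ : ℝ → L2HDot d n} {ϖ : ℝ → L2Prod d n}
    (h : IsSolution γ c σ₁ σ₂ u ψ ϖ) {k : Fin d → ℤ} (hk : k ≠ 0) {t : ℝ} (ht : 0 ≤ t) :
    (1 + freqSq k) * ‖casCoeff k (H1Torus.toFun (u t))‖ ^ 2
      ≤ 2 / (1 - 4 * γ ^ 2 * kappa σ₂ * (∫ x, |σ₁ x|) ^ 2) * modeSize c (u 0) (ψ 0) (ϖ 0) k := by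
  have hf := one_le_freqSq hk
  have e := (h.isModeSolution hσ₁ hσ₂ k).norm_sq_le hn (hσ₁.abs_convEigenvalue_le k) hf hsmall ht
  rw [modeState_norm_sq, modeState_norm_sq] at e
  have hδ0 := sub_pos.2 hsmall
  generalize 1 - 4 * γ ^ 2 * kappa σ₂ * (∫ x, |σ₁ x|) ^ 2 = δ at *
  have e2 : δ * (freqSq k * ‖casCoeff k (H1Torus.toFun (u t))‖ ^ 2)
      ≤ modeSize c (u 0) (ψ 0) (ϖ 0) k := by
    refine e.trans (add_le_add (add_le_add (mul_le_mul_of_nonneg_left ?_ zero_le_two) le_rfl) le_rfl)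
    exact mul_le_mul_of_nonneg_right (le_add_of_nonneg_left zero_le_one) (sq_nonneg _)
  have e3 : freqSq k * ‖casCoeff k (H1Torus.toFun (u t))‖ ^ 2
      ≤ modeSize c (u 0) (ψ 0) (ϖ 0) k / δ := by
    rwa [le_div_iff₀' hδ0]
  have e4 : ‖casCoeff k (H1Torus.toFun (u t))‖ ^ 2
      ≤ freqSq k * ‖casCoeff k (H1Torus.toFun (u t))‖ ^ 2 :=
    le_mul_of_one_le_left (sq_nonneg _) hf
  rw [div_mul_eq_mul_div, mul_div_assoc]
  linarith

theorem exists_norm_bound {d n : ℕ} (hn : 3 ≤ n) {γ c : ℝ} (hc : 0 < c)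
    {σ₁ : Torus d → ℝ} {σ₂ : Rn n → ℝ} (hσ₁ : IsFormFunction₁ σ₁) (hσ₂ : IsFormFunction₂ σ₂)
    (hsmall : 4 * γ ^ 2 * kappa σ₂ * (∫ x, |σ₁ x|) ^ 2 < 1)
    {uInit : H1Torus d} {ψInit : L2HDot d n} {ϖInit : L2Prod d n}
    (hu : ∫ x, H1Torus.toFun uInit x = 0)
    (hmean : 5 ≤ n ∨ ((∫ x, ψInit x = 0) ∧ ∀ᵐ z : Rn n, ∫ x, ϖInit (x, z) = 0)) :
    ∃ B : ℝ, ∀ (u : ℝ → H1Torus d) (ψ : ℝ → L2HDot d n) (ϖ : ℝ → L2Prod d n),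
      IsSolution γ c σ₁ σ₂ u ψ ϖ → u 0 = uInit → ψ 0 = ψInit → ϖ 0 = ϖInit →
        ∀ t : ℝ, 0 ≤ t → torusMass d * ‖u t‖ ^ 2 ≤ B := by
  obtain ⟨K, hK⟩ := exists_zero_mode_bound (γ := γ) hn hc hσ₁ hσ₂ hu hmean
  have hδ : 0 ≤ 2 / (1 - 4 * γ ^ 2 * kappa σ₂ * (∫ x, |σ₁ x|) ^ 2) :=
    div_nonneg zero_le_two (sub_pos.2 hsmall).le
  refine ⟨K ^ 2 + 2 / (1 - 4 * γ ^ 2 * kappa σ₂ * (∫ x, |σ₁ x|) ^ 2)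
    * (2 * (torusMass d * ‖uInit‖ ^ 2) + 4 * c ^ 2 * (torusMass d * ‖ϖInit‖ ^ 2)
      + 2 * (torusMass d * ‖(HDot.gradCLM n).compLp ψInit‖ ^ 2)), fun u ψ ϖ h h1 h2 h3 t ht => ?_⟩
  have hzero := hK u ψ ϖ h h1 h2 h3 t ht
  subst h1 h2 h3
  -- Bounding finite partial sums suffices: `K²` is spent at most once, on `k = 0`, and the other
  -- modes are controlled by the Bessel bounds on the data.
  refine hasSum_le_of_sum_le (hasSum_norm_sq_H1Torus (u t)) fun S => ?_
  have hk : ∀ k, (1 + freqSq k) * ‖casCoeff k (H1Torus.toFun (u t))‖ ^ 2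
      ≤ (if k = 0 then K ^ 2 else 0)
        + 2 / (1 - 4 * γ ^ 2 * kappa σ₂ * (∫ x, |σ₁ x|) ^ 2)
          * modeSize c (u 0) (ψ 0) (ϖ 0) k := fun k => by
    by_cases hk0 : k = 0
    · rw [if_pos hk0, hk0, show (1 + freqSq (0 : Fin d → ℤ)) = 1 by simp [freqSq], one_mul]
      exact (pow_le_pow_left₀ (norm_nonneg _) hzero 2).trans
        (le_add_of_nonneg_right (mul_nonneg hδ (modeSize_nonneg _ _ _ _ _)))
    · rw [if_neg hk0, zero_add]
      exact h.norm_sq_casCoeff_le hn hσ₁ hσ₂ hsmall hk0 ht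
  refine (Finset.sum_le_sum fun k _ => hk k).trans ?_
  rw [Finset.sum_add_distrib, ← Finset.mul_sum]
  refine add_le_add ?_ (mul_le_mul_of_nonneg_left (sum_modeSize_le c _ _ _ S) hδ)
  rw [Finset.sum_ite_eq']
  split_ifs
  · exact le_rfl
  · exact sq_nonneg K

end SchrodingerWave

end

open SchrodingerWave in
theorem mainTheorem4 (d n : ℕ) (hn : 3 ≤ n) (γ c : ℝ) (hγ : 0 < γ) (hc : 0 < c)
    (σ₁ : Torus d → ℝ) (σ₂ : Rn n → ℝ) (hσ₁ : IsFormFunction₁ σ₁) (hσ₂ : IsFormFunction₂ σ₂)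
    (hsmall : 4 * γ ^ 2 * kappa σ₂ * (∫ x, |σ₁ x|) ^ 2 < 1)
    (uInit : H1Torus d) (ψInit : L2HDot d n) (ϖInit : L2Prod d n)
    (hu : ∫ x, H1Torus.toFun uInit x = 0)
    (hmean : 5 ≤ n ∨ ((∫ x, ψInit x = 0) ∧ ∀ᵐ z : Rn n, ∫ x, ϖInit (x, z) = 0)) :
    ∃ C : ℝ, 0 < C ∧
      ∀ (u : ℝ → H1Torus d) (ψ : ℝ → L2HDot d n) (ϖ : ℝ → L2Prod d n),
        IsSolution γ c σ₁ σ₂ u ψ ϖ → u 0 = uInit → ψ 0 = ψInit → ϖ 0 = ϖInit →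
          ∀ t : ℝ, 0 ≤ t → ‖u t‖ ≤ C := by
  obtain ⟨B, hB⟩ := exists_norm_bound hn hc hσ₁ hσ₂ hsmall hu hmean
  -- Adding `1` only makes the constant strictly positive.
  refine ⟨√(B / torusMass d) + 1, by positivity, fun u ψ ϖ h h1 h2 h3 t ht => ?_⟩
  refine (Real.le_sqrt_of_sq_le ?_).trans (le_add_of_nonneg_right zero_le_one)
  rw [le_div_iff₀ (torusMass_pos d), mul_comm]
  exact hB u ψ ϖ h h1 h2 h3 t ht
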